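/- Let $N\ge 3$, $\alpha\in(0,2)$, $\beta>0$, $b,c\in\mathbb R$, and consider the differential expression $$A_{b,c}u=(1+|x|^\alpha)\Delta u+b|x|^{\alpha-2}x\cdot\nabla u-c|x|^{\alpha-2}u-|x|^\beta u ,\qquad x\in\mathbb R^N .$$ There exist real numbers $\lambda>0$ such that $$\frac{(N-2)^2}{8|x|^2}+\Bigl(c-1-\frac{\alpha-b}{2}(\alpha-2+N)\Bigr)|x|^{\alpha-2}+\lambda>0\qquad\text{for all }x\in\mathbb R^N\setminus\{0\};\tag{1}$$ fix any such $\lambda$. In the complex Hilbert space $L^2(\mathbb R^N)$ define the sesquilinear form $$\mathfrak a(u,v)=\int_{\mathbb R^N}\Bigl((1+|x|^\alpha)\nabla u\cdot\nabla\overline v+(\alpha-b)|x|^{\alpha-2}x\cdot\nabla u\,\overline v+c|x|^{\alpha-2}u\overline v+|x|^\beta u\overline v+\lambda u\overline v\Bigr)dx$$ with domain $$D(\mathfrak a)=\bigl\{u\in H^1(\mathbb R^N): (1+|x|^\alpha)^{1/2}\nabla u,\ (|x|^{\alpha-2})^{1/2}u,\ (|x|^{\beta})^{1/2}u\in L^2(\mathbb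 R^N)\bigr\},$$ and put $\|u\|_{\mathfrak a}=(\operatorname{Re}\mathfrak a(u,u)+\|u\|_{L^2}^2)^{1/2}$. Then: (i) $\mathfrak a$ is densely defined ($D(\mathfrak a)$ is dense in $L^2(\mathbb R^N)$), accretive ($\operatorname{Re}\mathfrak a(u,u)\ge0$ for $u\in D(\mathfrak a)$), continuous (there is $M\ge 0$ with $|\mathfrak a(u,v)|\le M\|u\|_{\mathfrak a}\|v\|_{\mathfrak a}$ for all $u,v\in D(\mathfrak a)$) and closed ($(D(\mathfrak a),\|\cdot\|_{\mathfrak a})$ is complete). (ii) There is a well-defined closed linear operator $(\widetilde A_{b,c},D(\widetilde A_{b,c}))$ on $L^2(\mathbb R^N)$, given by $$D(\widetilde A_{b,c})=\{u\in D(\mathfrak a):\exists\, v\in L^2(\mathbb R^N)\ \text{such that}\ \mathfrak a(u,h)=\langle v,h\rangle\ \ \forall h\in D(\mathfrak a)\},\qquad -\widetilde A_{b,c}u=v ,$$ where $\langle v,h\rangle=\int_{\mathbb R^N}v\overline h\,dx$. (iii) $\widetilde A_{b,c}$ is the generator of a strongly continuous analytic contraction semigroup on $L^2(\mathbb R^N)$: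 for some $\theta\in(0,\pi/2]$ the semigroup extends to a family $(T(z))_{z\in\Sigma_\theta\cup\{0\}}$ of bounded operators, $\Sigma_\theta=\{z\in\mathbb C\setminus\{0\}:|\arg z|<\theta\}$, with $T(0)=I$, $T(z+w)=T(z)T(w)$, $z\mapsto T(z)$ analytic in $\Sigma_\theta$, $\|T(z)\|\le1$, and $T(z)u\to u$ as $z\to0$ in $\Sigma_\theta$ for every $u\in L^2(\mathbb R^N)$. (iv) $\widetilde A_{b,c}$ is an extension of $(A_{b,c}-\lambda,\mathcal D_0)$, where $\mathcal D_0=C_c^\infty(\mathbb R^N\setminus\{0\})$: every $u\in\mathcal D_0$ belongs to $D(\widetilde A_{b,c})$ and $\widetilde A_{b,c}u=A_{b,c}u-\lambda u$. -/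

import Mathlib

open MeasureTheory Filter Topology
open scoped ContDiff ComplexConjugate

noncomputable section

namespace SingularElliptic

/-! ### Sesquilinear forms on a complex Hilbert space -/

section Abstract

variable {H : Type*} [NormedAddCommGroup H] [InnerProductSpace ℂ H]

/-- A sesquilinear form `a` (linear in the first, antilinear in the second variable), defined on a
linear subspace of `H`. -/
structure SesqForm (H : Type*) [NormedAddCommGroup H] [InnerProductSpace ℂ H] where
  /-- The domain of the form. -/
  domain : Submodule ℂ H
  /-- The form itself. -/
  form : domain →ₗ[ℂ] domain →ₛₗ[starRingEnd ℂ] ℂ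

namespace SesqForm

/-- The domain of the form is dense. -/
def IsDenselyDefined (a : SesqForm H) : Prop := Dense (a.domain : Set H)

/-- `Re a(u,u) ≥ 0` on the domain. -/
def IsAccretive (a : SesqForm H) : Prop := ∀ u : a.domain, 0 ≤ (a.form u u).re

/-- The form norm `‖u‖_a = (Re a(u,u) + ‖u‖²)^(1/2)` (a norm if `a` is accretive). -/
def formNorm (a : SesqForm H) (u : a.domain) : ℝ := √((a.form u u).re + ‖(u : H)‖ ^ 2)

/-- Continuity with respect to the form norm. -/
def IsContinuous (a : SesqForm H) : Prop :=
  ∃ M : ℝ, 0 ≤ M ∧ ∀ u v : a.domain, ‖a.form u v‖ ≤ M * a.formNorm u * a.formNorm v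

/-- The domain is complete with respect to the form norm. -/
def IsClosed (a : SesqForm H) : Prop :=
  ∀ u : ℕ → a.domain,
    (∀ ε > 0, ∃ n₀ : ℕ, ∀ n ≥ n₀, ∀ m ≥ n₀, a.formNorm (u n - u m) < ε) →
      ∃ v : a.domain, Tendsto (fun n => a.formNorm (u n - v)) atTop (𝓝 0)

/-- `B` is the operator for which `-B` is associated with the form `a`:
`D(B) = {u ∈ D(a) : ∃ v ∈ H, ∀ h ∈ D(a), a(u,h) = ⟨v,h⟩}` and `-B u = v`. Mathlib's `inner ℂ h v` is
linear in `v`, so it is `⟨v,h⟩` in the convention where the product is linear in the first entry.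
The graph of `B` is prescribed, so at most one `B` has this property. -/
def IsNegAssociated (a : SesqForm H) (B : H →ₗ.[ℂ] H) : Prop :=
  ∀ u w : H, (u, w) ∈ B.graph ↔
    ∃ hu : u ∈ a.domain, ∀ h : a.domain, a.form ⟨u, hu⟩ h = inner ℂ (h : H) (-w)

end SesqForm

/-! ### Analytic contraction semigroups -/

/-- The open sector `{z ≠ 0 : |arg z| < θ}`. -/
def sector (θ : ℝ) : Set ℂ := {z | z ≠ 0 ∧ |z.arg| < θ}

/-- `T` is a strongly continuous analytic semigroup of contractions on the sector of
half-angle `θ`. -/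
structure IsAnalyticContractionSemigroup (θ : ℝ) (T : ℂ → H →L[ℂ] H) : Prop where
  zero : T 0 = ContinuousLinearMap.id ℂ H
  add : ∀ z ∈ sector θ, ∀ w ∈ sector θ, T (z + w) = (T z).comp (T w)
  analytic : DifferentiableOn ℂ T (sector θ)
  contraction : ∀ z ∈ sector θ, ‖T z‖ ≤ 1
  strongly_continuous : ∀ u : H, Tendsto (fun z => T z u) (𝓝[sector θ] 0) (𝓝 u)

/-- `B` is the infinitesimal generator of `(T t)_{t ≥ 0}`, with its full domain. -/
def IsGenerator (B : H →ₗ.[ℂ] H) (T : ℂ → H →L[ℂ] H) : Prop :=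
  ∀ u w : H, (u, w) ∈ B.graph ↔
    Tendsto (fun t : ℝ => (t : ℂ)⁻¹ • (T (t : ℂ) u - u)) (𝓝[>] 0) (𝓝 w)

/-- `B` generates a strongly continuous analytic contraction semigroup. -/
def GeneratesAnalyticContractionSemigroup (B : H →ₗ.[ℂ] H) : Prop :=
  ∃ θ : ℝ, 0 < θ ∧ θ ≤ Real.pi / 2 ∧ ∃ T : ℂ → H →L[ℂ] H,
    IsAnalyticContractionSemigroup θ T ∧ IsGenerator B T

end Abstract

/-! ### The Sobolev space `H¹(ℝᴺ)` -/

/-- `ℝᴺ` with the Euclidean norm. -/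
abbrev E (N : ℕ) : Type := EuclideanSpace ℝ (Fin N)

/-- `L²(ℝᴺ; ℂ)`. -/
abbrev L2 (N : ℕ) : Type := Lp ℂ 2 (volume : Measure (E N))

variable {N : ℕ}

/-- The classical `i`-th partial derivative of a test function. -/
def partialDeriv (i : Fin N) (φ : E N → ℝ) (x : E N) : ℝ :=
  fderiv ℝ φ x (EuclideanSpace.single i 1)

/-- `g` is the weak `i`-th partial derivative of `u`. -/
def HasWeakPartial (i : Fin N) (u g : L2 N) : Prop :=
  ∀ φ : E N → ℝ, ContDiff ℝ ∞ φ → HasCompactSupport φ →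
    ∫ x, partialDeriv i φ x • u x = - ∫ x, φ x • g x

theorem integrable_test_smul {φ : E N → ℝ} (hφ : Continuous φ) (hc : HasCompactSupport φ)
    (u : L2 N) : Integrable (fun x => φ x • u x) volume := by
  have h1 : MemLp φ 2 (volume : Measure (E N)) := hφ.memLp_of_hasCompactSupport hc
  exact memLp_one_iff_integrable.1 ((Lp.memLp u).smul h1)

theorem continuous_partialDeriv (i : Fin N) {φ : E N → ℝ} (hφ : ContDiff ℝ ∞ φ) :
    Continuous (partialDeriv i φ) :=
  (hφ.continuous_fderiv (by simp)).clm_apply continuous_const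

theorem hasCompactSupport_partialDeriv (i : Fin N) {φ : E N → ℝ} (hc : HasCompactSupport φ) :
    HasCompactSupport (partialDeriv i φ) :=
  hc.fderiv_apply (𝕜 := ℝ) _

theorem integral_smul_add (φ : E N → ℝ) (hφ : Continuous φ) (hc : HasCompactSupport φ)
    (u v : L2 N) :
    ∫ x, φ x • (u + v : L2 N) x = (∫ x, φ x • u x) + ∫ x, φ x • v x := by
  rw [← integral_add (integrable_test_smul hφ hc u) (integrable_test_smul hφ hc v)]
  refine integral_congr_ae ?_
  filter_upwards [Lp.coeFn_add u v] with x hx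
  rw [hx, Pi.add_apply, smul_add]

theorem integral_smul_smul (φ : E N → ℝ) (k : ℂ) (u : L2 N) :
    ∫ x, φ x • (k • u : L2 N) x = k * ∫ x, φ x • u x := by
  rw [← integral_const_mul]
  refine integral_congr_ae ?_
  filter_upwards [Lp.coeFn_smul k u] with x hx
  rw [hx, Pi.smul_apply, smul_eq_mul, mul_smul_comm]

/-- The graph of the weak partial derivative `∂ᵢ` in `L²`. -/
def weakPartialGraph (i : Fin N) : Submodule ℂ (L2 N × L2 N) where
  carrier := {p | HasWeakPartial i p.1 p.2}
  zero_mem' := by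
    intro φ hφ hc
    have h (ψ : E N → ℝ) : ∫ x, ψ x • (0 : L2 N) x = 0 := by
      refine integral_eq_zero_of_ae ?_
      filter_upwards [Lp.coeFn_zero ℂ 2 (volume : Measure (E N))] with x hx
      rw [hx]; simp
    simp only [Prod.fst_zero, Prod.snd_zero, h, neg_zero]
  add_mem' := by
    rintro ⟨u, g⟩ ⟨v, k⟩ h1 h2 φ hφ hc
    have e1 := h1 φ hφ hc
    have e2 := h2 φ hφ hc
    simp only [Prod.mk_add_mk] at *
    rw [integral_smul_add _ (continuous_partialDeriv i hφ) (hasCompactSupport_partialDeriv i hc),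
      integral_smul_add _ hφ.continuous hc, e1, e2, neg_add]
  smul_mem' := by
    rintro k ⟨u, g⟩ h1 φ hφ hc
    have e1 := h1 φ hφ hc
    simp only [Prod.smul_mk] at *
    rw [integral_smul_smul, integral_smul_smul, e1, mul_neg]

theorem weakPartialGraph_functional (i : Fin N) (p : L2 N × L2 N) (hp : p ∈ weakPartialGraph i)
    (h0 : p.1 = 0) : p.2 = 0 := by
  obtain ⟨u, g⟩ := p
  simp only at h0
  subst h0
  have h : ∀ᵐ x : E N, g x = 0 := by
    refine ae_eq_zero_of_integral_contDiff_smul_eq_zero ?_ ?_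
    · exact (Lp.memLp g).locallyIntegrable (by norm_num)
    · intro φ hφ hc
      have e := hp φ hφ hc
      have e0 : ∫ x, partialDeriv i φ x • (0 : L2 N) x = 0 := by
        refine integral_eq_zero_of_ae ?_
        filter_upwards [Lp.coeFn_zero ℂ 2 (volume : Measure (E N))] with x hx
        rw [hx]; simp
      simp only at e
      rw [e0] at e
      exact neg_eq_zero.mp e.symm
  exact (Lp.eq_zero_iff_ae_eq_zero).2 h

/-- The weak partial derivative `∂ᵢ` in `L²`, with its maximal domain. -/
def weakPartial (i : Fin N) : L2 N →ₗ.[ℂ] L2 N := (weakPartialGraph i).toLinearPMap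

theorem mem_graph_weakPartial (i : Fin N) (u g : L2 N) :
    (u, g) ∈ (weakPartial i).graph ↔ HasWeakPartial i u g := by
  rw [weakPartial, Submodule.toLinearPMap_graph_eq _ (weakPartialGraph_functional i)]
  rfl

variable (N) in
/-- The Sobolev space `H¹(ℝᴺ)`: the functions in `L²` with all weak partial derivatives in `L²`. -/
def sobolevH1 : Submodule ℂ (L2 N) := ⨅ i, (weakPartial i).domain

/-- The components of the weak gradient on `H¹(ℝᴺ)`. -/
def weakGrad (i : Fin N) : sobolevH1 N →ₗ[ℂ] L2 N :=
  (weakPartial i).toFun ∘ₗ Submodule.inclusion (iInf_le _ i)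

/-! ### The form -/

/-- The functions `f ∈ L²` with `w f ∈ L²`. -/
def weightedL2 (w : E N → ℝ) : Submodule ℂ (L2 N) where
  carrier := {f | MemLp (fun x => (w x : ℂ) * f x) 2 volume}
  zero_mem' := by
    refine (MemLp.zero (p := 2) (μ := (volume : Measure (E N))) (ε := ℂ)).ae_eq ?_
    filter_upwards [Lp.coeFn_zero ℂ 2 (volume : Measure (E N))] with x hx
    rw [hx]; simp
  add_mem' := by
    intro f g hf hg
    refine (MemLp.add hf hg).ae_eq ?_
    filter_upwards [Lp.coeFn_add f g] with x hx
    rw [hx]; simp [mul_add]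
  smul_mem' := by
    intro k f hf
    refine (MemLp.const_smul hf k).ae_eq ?_
    filter_upwards [Lp.coeFn_smul k f] with x hx
    rw [hx]; simp [mul_left_comm]

/-- `D(a)`: the `u ∈ H¹(ℝᴺ)` such that `(1+|x|^α)^(1/2) ∇u`, `(|x|^(α-2))^(1/2) u` and
`(|x|^β)^(1/2) u` are in `L²`. -/
def formDomain (N : ℕ) (α β : ℝ) : Submodule ℂ (L2 N) where
  carrier := {u | ∃ hu : u ∈ sobolevH1 N,
    (∀ i, weakGrad i ⟨u, hu⟩ ∈ weightedL2 (fun x => √(1 + ‖x‖ ^ α))) ∧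
    u ∈ weightedL2 (fun x => √(‖x‖ ^ (α - 2))) ∧ u ∈ weightedL2 (fun x => √(‖x‖ ^ β))}
  zero_mem' := by
    refine ⟨zero_mem _, fun i => ?_, zero_mem _, zero_mem _⟩
    have : weakGrad i (⟨0, zero_mem _⟩ : sobolevH1 N) = 0 := (weakGrad i).map_zero
    rw [this]
    exact zero_mem _
  add_mem' := by
    rintro u v ⟨hu, hu1, hu2, hu3⟩ ⟨hv, hv1, hv2, hv3⟩
    refine ⟨add_mem hu hv, fun i => ?_, add_mem hu2 hv2, add_mem hu3 hv3⟩
    have : weakGrad i (⟨u + v, add_mem hu hv⟩ : sobolevH1 N)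
        = weakGrad i ⟨u, hu⟩ + weakGrad i ⟨v, hv⟩ := (weakGrad i).map_add ⟨u, hu⟩ ⟨v, hv⟩
    rw [this]
    exact add_mem (hu1 i) (hv1 i)
  smul_mem' := by
    rintro k u ⟨hu, hu1, hu2, hu3⟩
    refine ⟨Submodule.smul_mem _ k hu, fun i => ?_, Submodule.smul_mem _ k hu2,
      Submodule.smul_mem _ k hu3⟩
    have : weakGrad i (⟨k • u, Submodule.smul_mem _ k hu⟩ : sobolevH1 N)
        = k • weakGrad i ⟨u, hu⟩ := (weakGrad i).map_smul k ⟨u, hu⟩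
    rw [this]
    exact Submodule.smul_mem _ k (hu1 i)

variable {α β : ℝ}

/-- The weak gradient on `D(a)`. -/
def grad (i : Fin N) : formDomain N α β →ₗ[ℂ] L2 N :=
  weakGrad i ∘ₗ Submodule.inclusion (fun _ hu => hu.1)

/-- The integrand of `a(u,v)`. -/
def formIntegrand (b c lam : ℝ) (u v : formDomain N α β) (x : E N) : ℂ :=
  ((1 + ‖x‖ ^ α : ℝ) : ℂ) * (∑ i, grad i u x * conj (grad i v x))
    + (((α - b) * ‖x‖ ^ (α - 2) : ℝ) : ℂ) * (∑ i, (x i : ℂ) * grad i u x) * conj ((v : L2 N) x)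
    + ((c * ‖x‖ ^ (α - 2) : ℝ) : ℂ) * (u : L2 N) x * conj ((v : L2 N) x)
    + ((‖x‖ ^ β : ℝ) : ℂ) * (u : L2 N) x * conj ((v : L2 N) x)
    + (lam : ℂ) * (u : L2 N) x * conj ((v : L2 N) x)

theorem integrable_mul_conj {f g : E N → ℂ} (hf : MemLp f 2 volume) (hg : MemLp g 2 volume) :
    Integrable (fun x => f x * conj (g x)) volume :=
  MemLp.integrable_mul (p := 2) (q := 2) hf hg.star

theorem integrable_weight {w : E N → ℝ} (hw : ∀ x, 0 ≤ w x) {f g : L2 N}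
    (hf : f ∈ weightedL2 (fun x => √(w x))) (hg : g ∈ weightedL2 (fun x => √(w x))) :
    Integrable (fun x => (w x : ℂ) * f x * conj (g x)) volume := by
  refine (integrable_mul_conj hf hg).congr (Eventually.of_forall fun x => ?_)
  have h : ((√(w x) : ℝ) : ℂ) * ((√(w x) : ℝ) : ℂ) = (w x : ℂ) := by
    rw [← Complex.ofReal_mul, Real.mul_self_sqrt (hw x)]
  simp only [map_mul, Complex.conj_ofReal]
  rw [← h]
  ring

theorem drift_weight_le (α : ℝ) (x : E N) (i : Fin N) :
    ‖x‖ ^ (α - 2) * |x i| ≤ √(1 + ‖x‖ ^ α) * √(‖x‖ ^ (α - 2)) := by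
  rcases eq_or_ne x 0 with rfl | hx
  · simp only [PiLp.zero_apply, abs_zero, mul_zero]
    positivity
  · have hx0 : 0 < ‖x‖ := norm_pos_iff.2 hx
    have h1 : |x i| ≤ ‖x‖ := by simpa using PiLp.norm_apply_le x i
    have h2 : ‖x‖ ^ α = ‖x‖ ^ (α - 2) * ‖x‖ ^ 2 := by
      rw [← Real.rpow_natCast, ← Real.rpow_add hx0]; norm_num
    have hw : 0 ≤ ‖x‖ ^ (α - 2) := by positivity
    rw [← Real.sqrt_mul (by positivity)]
    refine Real.le_sqrt_of_sq_le ?_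
    have h3 : |x i| ^ 2 ≤ ‖x‖ ^ 2 := by gcongr
    calc (‖x‖ ^ (α - 2) * |x i|) ^ 2 = (‖x‖ ^ (α - 2) * |x i| ^ 2) * ‖x‖ ^ (α - 2) := by ring
      _ ≤ (‖x‖ ^ (α - 2) * ‖x‖ ^ 2) * ‖x‖ ^ (α - 2) := by gcongr
      _ ≤ (1 + ‖x‖ ^ α) * ‖x‖ ^ (α - 2) := by
        rw [h2]
        gcongr
        linarith

theorem integrable_drift (i : Fin N) (u v : formDomain N α β) :
    Integrable (fun x => ((‖x‖ ^ (α - 2) : ℝ) : ℂ) * ((x i : ℂ) * grad i u x)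
      * conj ((v : L2 N) x)) volume := by
  have hu : MemLp (fun x => ((√(1 + ‖x‖ ^ α) : ℝ) : ℂ) * grad i u x) 2 volume := u.2.2.1 i
  have hv : MemLp (fun x => ((√(‖x‖ ^ (α - 2)) : ℝ) : ℂ) * (v : L2 N) x) 2 volume := v.2.2.2.1
  refine (integrable_mul_conj hu hv).mono ?_ (Eventually.of_forall fun x => ?_)
  · have h1 : Measurable fun x : E N => ((‖x‖ ^ (α - 2) : ℝ) : ℂ) := by fun_prop
    have h2 : Measurable fun x : E N => ((x i : ℝ) : ℂ) := by fun_prop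
    have h3 := (Lp.memLp (grad i u)).1
    have h4 := (Lp.memLp (v : L2 N)).1.star
    exact (h1.aestronglyMeasurable.mul (h2.aestronglyMeasurable.mul h3)).mul h4
  · have h := drift_weight_le α x i
    have hw : 0 ≤ ‖x‖ ^ (α - 2) := by positivity
    simp only [norm_mul, RCLike.norm_conj, Complex.norm_real, Real.norm_eq_abs, abs_of_nonneg hw,
      abs_of_nonneg (Real.sqrt_nonneg _)]
    calc ‖x‖ ^ (α - 2) * (|x i| * ‖grad i u x‖) * ‖(v : L2 N) x‖
        = (‖x‖ ^ (α - 2) * |x i|) * (‖grad i u x‖ * ‖(v : L2 N) x‖) := by ring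
      _ ≤ (√(1 + ‖x‖ ^ α) * √(‖x‖ ^ (α - 2))) * (‖grad i u x‖ * ‖(v : L2 N) x‖) := by gcongr
      _ = _ := by ring

theorem integrable_formIntegrand (b c lam : ℝ) (u v : formDomain N α β) :
    Integrable (formIntegrand b c lam u v) volume := by
  have h1 : Integrable (fun x => ((1 + ‖x‖ ^ α : ℝ) : ℂ) *
      (∑ i, grad i u x * conj (grad i v x))) volume := by
    have : Integrable (fun x => ∑ i, ((1 + ‖x‖ ^ α : ℝ) : ℂ) * grad i u x * conj (grad i v x))
        volume :=
      integrable_finsetSum _ fun i _ =>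
        integrable_weight (fun x => by positivity) (u.2.2.1 i) (v.2.2.1 i)
    refine this.congr (Eventually.of_forall fun x => ?_)
    simp only [Finset.mul_sum, mul_assoc]
  have h2 : Integrable (fun x => (((α - b) * ‖x‖ ^ (α - 2) : ℝ) : ℂ) *
      (∑ i, (x i : ℂ) * grad i u x) * conj ((v : L2 N) x)) volume := by
    have : Integrable (fun x => ((α - b : ℝ) : ℂ) * ∑ i, ((‖x‖ ^ (α - 2) : ℝ) : ℂ) *
        ((x i : ℂ) * grad i u x) * conj ((v : L2 N) x)) volume :=
      (integrable_finsetSum _ fun i _ => integrable_drift i u v).const_mul _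
    refine this.congr (Eventually.of_forall fun x => ?_)
    simp only [Finset.mul_sum, Finset.sum_mul, mul_assoc, Complex.ofReal_mul]
  have h3 : Integrable (fun x => ((c * ‖x‖ ^ (α - 2) : ℝ) : ℂ) * (u : L2 N) x *
      conj ((v : L2 N) x)) volume := by
    refine ((integrable_weight (w := fun x => ‖x‖ ^ (α - 2)) (fun x => by positivity)
      u.2.2.2.1 v.2.2.2.1).const_mul (c : ℂ)).congr (Eventually.of_forall fun x => ?_)
    simp only [mul_assoc, Complex.ofReal_mul]
  have h4 : Integrable (fun x => ((‖x‖ ^ β : ℝ) : ℂ) * (u : L2 N) x * conj ((v : L2 N) x))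
      volume :=
    integrable_weight (w := fun x => ‖x‖ ^ β) (fun x => by positivity) u.2.2.2.2 v.2.2.2.2
  have h5 : Integrable (fun x => (lam : ℂ) * (u : L2 N) x * conj ((v : L2 N) x)) volume := by
    refine ((integrable_mul_conj (Lp.memLp (u : L2 N)) (Lp.memLp (v : L2 N))).const_mul
      (lam : ℂ)).congr (Eventually.of_forall fun x => ?_)
    simp only [mul_assoc]
  exact (((h1.add h2).add h3).add h4).add h5

/-- The form
`a(u,v) = ∫ (1+|x|^α) ∇u·∇v̄ + (α-b)|x|^(α-2) x·∇u v̄ + c|x|^(α-2) u v̄ + |x|^β u v̄ + λ u v̄ dx`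
with domain `D(a)`. -/
def ellipticForm (N : ℕ) (α β b c lam : ℝ) : SesqForm (L2 N) where
  domain := formDomain N α β
  form := LinearMap.mk₂'ₛₗ (RingHom.id ℂ) (starRingEnd ℂ)
    (fun u v => ∫ x, formIntegrand b c lam u v x)
    (by
      intro u u' v
      rw [← integral_add (integrable_formIntegrand b c lam u v)
        (integrable_formIntegrand b c lam u' v)]
      refine integral_congr_ae ?_
      have hg : ∀ᵐ x : E N, ∀ i, grad i (u + u') x = grad i u x + grad i u' x := by
        refine ae_all_iff.2 fun i => ?_
        rw [map_add]
        exact Lp.coeFn_add _ _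
      filter_upwards [hg, Lp.coeFn_add (u : L2 N) (u' : L2 N)] with x h1 h2
      simp only [formIntegrand, Submodule.coe_add, h1, h2, Pi.add_apply, add_mul, mul_add,
        Finset.sum_add_distrib]
      ring)
    (by
      intro k u v
      rw [RingHom.id_apply, smul_eq_mul, ← integral_const_mul]
      refine integral_congr_ae ?_
      have hg : ∀ᵐ x : E N, ∀ i, grad i (k • u) x = k * grad i u x := by
        refine ae_all_iff.2 fun i => ?_
        rw [map_smul]
        exact Lp.coeFn_smul _ _
      filter_upwards [hg, Lp.coeFn_smul k (u : L2 N)] with x h1 h2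
      simp only [formIntegrand, Submodule.coe_smul, h1, h2, Pi.smul_apply, smul_eq_mul, mul_assoc,
        mul_left_comm _ k, ← Finset.mul_sum]
      ring)
    (by
      intro u v v'
      rw [← integral_add (integrable_formIntegrand b c lam u v)
        (integrable_formIntegrand b c lam u v')]
      refine integral_congr_ae ?_
      have hg : ∀ᵐ x : E N, ∀ i, grad i (v + v') x = grad i v x + grad i v' x := by
        refine ae_all_iff.2 fun i => ?_
        rw [map_add]
        exact Lp.coeFn_add _ _
      filter_upwards [hg, Lp.coeFn_add (v : L2 N) (v' : L2 N)] with x h1 h2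
      simp only [formIntegrand, Submodule.coe_add, h1, h2, Pi.add_apply]
      simp only [(starRingEnd ℂ).map_add, mul_add, Finset.sum_add_distrib]
      ring)
    (by
      intro k u v
      rw [smul_eq_mul, ← integral_const_mul]
      refine integral_congr_ae ?_
      have hg : ∀ᵐ x : E N, ∀ i, grad i (k • v) x = k * grad i v x := by
        refine ae_all_iff.2 fun i => ?_
        rw [map_smul]
        exact Lp.coeFn_smul _ _
      filter_upwards [hg, Lp.coeFn_smul k (v : L2 N)] with x h1 h2
      simp only [formIntegrand, Submodule.coe_smul, h1, h2, Pi.smul_apply, smul_eq_mul, map_mul,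
        mul_left_comm _ (conj k), ← Finset.mul_sum]
      ring)

/-! ### The differential operator and the choice of `λ` -/

/-- The differential expression
`A u = (1+|x|^α) Δu + b|x|^(α-2) x·∇u - c|x|^(α-2) u - |x|^β u`; here `x·∇u` is the derivative of `u`
at `x` in the direction `x`. -/
def ellipticOp (α β b c : ℝ) (u : E N → ℂ) (x : E N) : ℂ :=
  ((1 + ‖x‖ ^ α : ℝ) : ℂ) * Laplacian.laplacian u x
    + ((b * ‖x‖ ^ (α - 2) : ℝ) : ℂ) * fderiv ℝ u x x
    - ((c * ‖x‖ ^ (α - 2) : ℝ) : ℂ) * u x - ((‖x‖ ^ β : ℝ) : ℂ) * u x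

/-- `u ∈ C_c^∞(ℝᴺ ∖ {0}; ℂ)`, extended by zero. -/
def IsTestAwayFromZero (u : E N → ℂ) : Prop :=
  ContDiff ℝ ∞ u ∧ HasCompactSupport u ∧ (0 : E N) ∉ tsupport u

/-- The choice of `λ > 0`, where `c₀ = ((N-2)/2)²` is the Hardy constant:
`c₀/(2|x|²) + (c - 1 - (α-b)/2 (α-2+N)) |x|^(α-2) + λ > 0` for all `x ≠ 0`. -/
def IsAdmissible (N : ℕ) (α b c lam : ℝ) : Prop :=
  0 < lam ∧ ∀ x : E N, x ≠ 0 →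
    0 < (((N : ℝ) - 2) / 2) ^ 2 / (2 * ‖x‖ ^ 2)
      + (c - 1 - (α - b) / 2 * (α - 2 + N)) * ‖x‖ ^ (α - 2) + lam

end SingularElliptic

end

/-! The whole theorem follows from one estimate: the form is sectorial. Since 2 Re(ū∇u) = ∇|u|² and
div(|x|^(α-2) x) = (α-2+N)|x|^(α-2), the real part of the drift term is a multiple of ∫|x|^(α-2)|u|²
(`integral_drift`, `re_form`). Half of ∫|∇u|² is then traded, by the Hardy inequality (`hardy`), for
the inverse square term of condition (1). What remains is `le_re_form`: Re a(u,u) is at least half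
of the weighted gradient energy plus the two weighted norms of u. On the diagonal the imaginary part
comes from the drift alone, and the pointwise bound |x|^(α-2)|xᵢ| ≤ (1+|x|^α)^(1/2)
(|x|^(α-2))^(1/2) of `drift_weight_le` gives |Im a(u,u)| ≤ K Re a(u,u) with K = |α-b| N
(`abs_im_form_le`).

Continuity is then polarization (`SesqForm.isContinuous_of_sectorial`). Closedness holds because the
form norm is expressed through the L² norms of closed operators, namely weighted derivatives and
multiplications (`exists_limit`, `formNorm_eq`). Lax–Milgram on the form domain makes 1 - μ⁻¹B onto
for every μ > 0, so B is a sectorial operator (`SesqForm.isSectorial_op`). The Yosida approximations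
of B have numerical range in the same sector, hence their exponentials are contractions on a complex
cone (`IsSectorial.isDissipative_smul_yosida`). Their strong limits give the analytic contraction
semigroup on a sector directly, without resolvent estimates or contour integrals.

The two integral identities are needed for every u in the form domain, yet no density of smooth
functions in the form norm is used. A weak derivative in L² is the strong derivative of the
translation group (`hasDerivAt_translate`), which yields the product rule for |u|² against bounded
C¹ functions. The singular radial fields are regularized to bounded ones, and the regularization is
removed by Fatou or by dominated convergence.

An admissible λ exists because |x|^(-2) dominates |x|^(α-2) near 0 when α > 0, while |x|^(α-2) is
bounded away from 0 when α < 2. Finally, B extends the differential expression because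
differentiating the coefficient 1+|x|^α produces α|x|^(α-2) x·∇u, which together with the
coefficient α-b of the form leaves exactly b. -/

noncomputable section

namespace SingularElliptic

/-! ### Exponentials of bounded dissipative operators -/

section Dissipative

variable {H : Type*} [NormedAddCommGroup H] [InnerProductSpace ℂ H]

/-- `Re ⟨C f, f⟩ ≤ 0` for all `f`. -/
def IsDissipative (C : H →L[ℂ] H) : Prop := ∀ f, (inner ℂ f (C f)).re ≤ 0

theorem IsDissipative.add {C D : H →L[ℂ] H} (hC : IsDissipative C) (hD : IsDissipative D) :
    IsDissipative (C + D) := fun f => by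
  have h1 := hC f
  have h2 := hD f
  rw [_root_.add_apply, inner_add_right, Complex.add_re]
  linarith

theorem IsDissipative.smul {C : H →L[ℂ] H} (hC : IsDissipative C) {t : ℝ} (ht : 0 ≤ t) :
    IsDissipative ((t : ℂ) • C) := fun f => by
  have h1 := hC f
  rw [_root_.smul_apply, inner_smul_right, Complex.re_ofReal_mul]
  exact mul_nonpos_of_nonneg_of_nonpos ht h1

variable [CompleteSpace H]

theorem hasDerivAt_exp_smul_apply (C : H →L[ℂ] H) (f : H) (t : ℝ) :
    HasDerivAt (fun s : ℝ => NormedSpace.exp ((s : ℂ) • C) f)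
      (C (NormedSpace.exp ((t : ℂ) • C) f)) t := by
  have h := HasDerivAt.scomp t (hasDerivAt_exp_smul_const' (𝕂 := ℂ) C (t : ℂ))
    Complex.ofRealCLM.hasDerivAt
  rw [Complex.ofRealCLM_apply, Complex.ofReal_one, one_smul] at h
  exact (((ContinuousLinearMap.apply ℂ H f).restrictScalars ℝ).hasFDerivAt.comp_hasDerivAt t h)

/-- Along g(s) = exp(sC)f the derivative of ‖g‖² is 2 Re⟨g, Cg⟩ ≤ 0. -/
theorem IsDissipative.norm_exp_apply_le {C : H →L[ℂ] H} (hC : IsDissipative C) (f : H) :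
    ‖NormedSpace.exp C f‖ ≤ ‖f‖ := by
  set g : ℝ → H := fun s => NormedSpace.exp ((s : ℂ) • C) f with hg
  have hd (t : ℝ) : HasDerivAt (fun s => (inner ℂ (g s) (g s)).re)
      (inner ℂ (g t) (C (g t)) + inner ℂ (C (g t)) (g t)).re t := by
    have h := (hasDerivAt_exp_smul_apply C f t).inner ℂ (hasDerivAt_exp_smul_apply C f t)
    exact Complex.reCLM.hasFDerivAt.comp_hasDerivAt t h
  have hanti : Antitone (fun s => (inner ℂ (g s) (g s)).re) := by
    refine antitone_of_deriv_nonpos (fun t => (hd t).differentiableAt) fun t => ?_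
    rw [(hd t).deriv, Complex.add_re, ← inner_conj_symm (C (g t)), Complex.conj_re]
    have := hC (g t)
    linarith
  have h := hanti zero_le_one
  have h0 : g 0 = f := by simp [hg]
  have h1 : g 1 = NormedSpace.exp C f := by simp [hg]
  have e (x : H) : (inner ℂ x x).re = ‖x‖ ^ 2 := inner_self_eq_norm_sq (𝕜 := ℂ) x
  simp only [h0, h1, e] at h
  exact (sq_le_sq₀ (norm_nonneg _) (norm_nonneg _)).1 h

/-- The segment C + t(D - C) consists of dissipative operators, and by commutativity exp(C + t(D -
C))f has derivative exp(C + t(D - C))(D - C)f, a contraction applied to a fixed vector. The bound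
therefore does not involve the norms of C and D, which blow up for Yosida approximations. -/
theorem norm_exp_sub_exp_apply_le {C D : H →L[ℂ] H} (hC : IsDissipative C) (hD : IsDissipative D)
    (hcomm : Commute C D) (f : H) :
    ‖NormedSpace.exp D f - NormedSpace.exp C f‖ ≤ ‖D f - C f‖ := by
  let _ : NormedAlgebra ℚ (H →L[ℂ] H) := NormedAlgebra.restrictScalars ℚ ℂ _
  have hsub : Commute C (D - C) := hcomm.sub_right (Commute.refl C)
  set g : ℝ → H := fun s => NormedSpace.exp C (NormedSpace.exp ((s : ℂ) • (D - C)) f) with hg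
  have hd (t : ℝ) : HasDerivAt g
      (NormedSpace.exp (C + (t : ℂ) • (D - C)) ((D - C) f)) t := by
    have h := ((NormedSpace.exp C).restrictScalars ℝ).hasFDerivAt.comp_hasDerivAt t
      (hasDerivAt_exp_smul_apply (D - C) f t)
    refine h.congr_deriv (Eq.symm ?_)
    have hc1 : Commute ((t : ℂ) • (D - C)) (D - C) := (Commute.refl _).smul_left _
    have hc2 : NormedSpace.exp ((t : ℂ) • (D - C)) * (D - C)
        = (D - C) * NormedSpace.exp ((t : ℂ) • (D - C)) := (hc1.exp_left).eq
    have e := NormedSpace.exp_add_of_commute (hsub.smul_right (t : ℂ))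
    rw [e]
    change NormedSpace.exp C ((NormedSpace.exp ((t : ℂ) • (D - C)) * (D - C)) f) = _
    rw [hc2]
    rfl
  have hdis {t : ℝ} (ht : t ∈ Set.Ico (0 : ℝ) 1) : IsDissipative (C + (t : ℂ) • (D - C)) := by
    have : C + (t : ℂ) • (D - C) = ((1 - t : ℝ) : ℂ) • C + (t : ℂ) • D := by
      push_cast
      module
    rw [this]
    exact (hC.smul (by linarith [ht.2])).add (hD.smul ht.1)
  have h := norm_image_sub_le_of_norm_deriv_le_segment_01'
    (f := g) (fun t _ => (hd t).hasDerivWithinAt)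
    (fun t ht => (hdis ht).norm_exp_apply_le ((D - C) f))
  have h0 : g 0 = NormedSpace.exp C f := by simp [hg]
  have h1 : g 1 = NormedSpace.exp D f := by
    have e := NormedSpace.exp_add_of_commute hsub
    rw [add_sub_cancel] at e
    simp [hg, e]
  rw [h0, h1] at h
  simpa using h

theorem IsDissipative.norm_exp_apply_sub_le {C : H →L[ℂ] H} (hC : IsDissipative C) (f : H) :
    ‖NormedSpace.exp C f - f‖ ≤ ‖C f‖ := by
  have h0 : IsDissipative (0 : H →L[ℂ] H) := fun f => by simp
  simpa using norm_exp_sub_exp_apply_le h0 hC (Commute.zero_left C) f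

/-- A first order expansion of `exp (t C) f`, where `v` is a further approximation of `C f`. -/
theorem IsDissipative.norm_exp_apply_sub_sub_le {C : H →L[ℂ] H} (hC : IsDissipative C) (f w v : H)
    {t : ℝ} (ht : 0 ≤ t) :
    ‖NormedSpace.exp ((t : ℂ) • C) f - f - (t : ℂ) • C f‖ ≤
      t * (2 * ‖C f - w‖ + 2 * ‖w - v‖ + t * ‖C v‖) := by
  set g : ℝ → H := fun s => NormedSpace.exp ((s : ℂ) • C) f - (s : ℂ) • C f with hg
  have hd (s : ℝ) : HasDerivAt g (NormedSpace.exp ((s : ℂ) • C) (C f) - C f) s := by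
    have h1 := hasDerivAt_exp_smul_apply C f s
    have h2 : HasDerivAt (fun s : ℝ => (s : ℂ) • C f) (C f) s := by
      simpa using ((hasDerivAt_id (s : ℂ)).comp_ofReal).smul_const (C f)
    have hc1 : NormedSpace.exp ((s : ℂ) • C) * C = C * NormedSpace.exp ((s : ℂ) • C) :=
      (((Commute.refl C).smul_left (s : ℂ)).exp_left).eq
    have e : NormedSpace.exp ((s : ℂ) • C) (C f) = C (NormedSpace.exp ((s : ℂ) • C) f) :=
      DFunLike.congr_fun hc1 f
    rw [e]
    exact h1.sub h2
  have hb : ∀ s ∈ Set.Ico 0 t, ‖NormedSpace.exp ((s : ℂ) • C) (C f) - C f‖ ≤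
      2 * ‖C f - w‖ + 2 * ‖w - v‖ + t * ‖C v‖ := by
    intro s hs
    have hs' := hC.smul hs.1
    set S := NormedSpace.exp ((s : ℂ) • C)
    have h1 := hs'.norm_exp_apply_le (C f - w)
    have h2 := hs'.norm_exp_apply_le (w - v)
    have h3 := hs'.norm_exp_apply_sub_le v
    rw [_root_.smul_apply, norm_smul, Complex.norm_real, Real.norm_eq_abs,
      abs_of_nonneg hs.1] at h3
    have h4 : s * ‖C v‖ ≤ t * ‖C v‖ := by gcongr; exact hs.2.le
    -- Only v is acted on by C again. For Yosida approximations and v in the domain of B the vectors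
    -- C v stay bounded, and the two differences cost at most twice their norms.
    have e : S (C f) - C f = S (C f - w) - (C f - w) + (S (w - v) - (w - v)) + (S v - v) := by
      simp only [map_sub]; abel
    rw [e]
    refine (norm_add₃_le).trans ?_
    have h5 := norm_sub_le (S (C f - w)) (C f - w)
    have h6 := norm_sub_le (S (w - v)) (w - v)
    linarith
  have h := norm_image_sub_le_of_norm_deriv_le_segment'
    (f := g) (fun s _ => (hd s).hasDerivWithinAt) hb t ⟨ht, le_rfl⟩
  have e : g t - g 0 = NormedSpace.exp ((t : ℂ) • C) f - f - (t : ℂ) • C f := by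
    simp [hg]; abel
  rw [e] at h
  calc _ ≤ _ := h
    _ = _ := by ring

/-! ### From strong to norm holomorphy -/

/-- The Schwarz lemma, applied to z ↦ T z f and again to its divided difference at z₀, bounds the
second divided difference by 4‖f‖/r². As this is uniform over the unit ball of f, the first order
expansion holds in operator norm. -/
theorem differentiableAt_of_strongly_differentiableOn {T : ℂ → H →L[ℂ] H} {z₀ : ℂ} {r : ℝ}
    (hr : 0 < r) (hd : ∀ f, DifferentiableOn ℂ (fun z => T z f) (Metric.ball z₀ r))
    (hb : ∀ z ∈ Metric.ball z₀ r, ∀ f, ‖T z f‖ ≤ ‖f‖) : DifferentiableAt ℂ T z₀ := by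
  have hz₀ : z₀ ∈ Metric.ball z₀ r := Metric.mem_ball_self hr
  have hnhds : Metric.ball z₀ r ∈ 𝓝 z₀ := Metric.ball_mem_nhds _ hr
  have hdd (f : H) : DifferentiableOn ℂ (dslope (fun z => T z f) z₀) (Metric.ball z₀ r) :=
    (Complex.differentiableOn_dslope hnhds).2 (hd f)
  have hb1 (f : H) : ∀ z ∈ Metric.ball z₀ r, ‖dslope (fun z => T z f) z₀ z‖ ≤ 2 * ‖f‖ / r := by
    intro z hz
    refine Complex.norm_dslope_le_div_of_mapsTo_ball (hd f) (fun w hw => ?_) hz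
    rw [mem_closedBall_iff_norm]
    have h1 := hb w hw f
    have h2 := hb z₀ hz₀ f
    have h3 := norm_sub_le (T w f) (T z₀ f)
    linarith
  have hb2 (f : H) : ∀ z ∈ Metric.ball z₀ r,
      ‖dslope (dslope (fun z => T z f) z₀) z₀ z‖ ≤ 4 * ‖f‖ / r / r := by
    intro z hz
    refine Complex.norm_dslope_le_div_of_mapsTo_ball (hdd f) (fun w hw => ?_) hz
    rw [mem_closedBall_iff_norm]
    have h1 := hb1 f w hw
    have h2 := hb1 f z₀ hz₀
    have h3 := norm_sub_le (dslope (fun z => T z f) z₀ w) (dslope (fun z => T z f) z₀ z₀)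
    have h5 : 4 * ‖f‖ / r = 2 * ‖f‖ / r + 2 * ‖f‖ / r := by ring
    linarith
  have hat (f : H) : DifferentiableAt ℂ (fun z => T z f) z₀ := (hd f).differentiableAt hnhds
  let D₀ : H →ₗ[ℂ] H :=
    { toFun := fun f => deriv (fun z => T z f) z₀
      map_add' := fun f g => by
        simp only [map_add]
        exact deriv_fun_add (hat f) (hat g)
      map_smul' := fun k f => by
        simp only [map_smul, RingHom.id_apply]
        exact deriv_fun_const_smul k (hat f) }
  let D : H →L[ℂ] H := D₀.mkContinuous (2 / r) fun f => by
    have := hb1 f z₀ hz₀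
    rw [dslope_same] at this
    calc _ ≤ _ := this
      _ = _ := by ring
  have hD (f : H) : D f = deriv (fun z => T z f) z₀ := rfl
  have key : ∀ z ∈ Metric.ball z₀ r, ‖T z - T z₀ - (z - z₀) • D‖ ≤ 4 / r / r * ‖z - z₀‖ ^ 2 := by
    intro z hz
    refine ContinuousLinearMap.opNorm_le_bound _ (by positivity) fun f => ?_
    have e1 := sub_smul_dslope (fun z => T z f) z₀ z
    have e2 := sub_smul_dslope (dslope (fun z => T z f) z₀) z₀ z
    rw [dslope_same] at e2
    have e : (T z - T z₀ - (z - z₀) • D) f =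
        (z - z₀) • (z - z₀) • dslope (dslope (fun z => T z f) z₀) z₀ z := by
      rw [e2, smul_sub, e1]
      simp [hD]
    rw [e, norm_smul, norm_smul]
    calc ‖z - z₀‖ * (‖z - z₀‖ * ‖dslope (dslope (fun z => T z f) z₀) z₀ z‖)
        ≤ ‖z - z₀‖ * (‖z - z₀‖ * (4 * ‖f‖ / r / r)) := by gcongr; exact hb2 f z hz
      _ = _ := by ring
  refine HasDerivAt.differentiableAt (f' := D) ?_
  rw [hasDerivAt_iff_isLittleO]
  have h1 : (fun z => T z - T z₀ - (z - z₀) • D) =O[𝓝 z₀] fun z => ‖z - z₀‖ ^ 2 := by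
    refine Asymptotics.IsBigO.of_bound (4 / r / r) ?_
    filter_upwards [hnhds] with z hz
    simpa using key z hz
  refine h1.trans_isLittleO ?_
  have h2 : (fun z : ℂ => ‖z - z₀‖ ^ 2) =o[𝓝 z₀] fun z => ‖z - z₀‖ ^ 1 :=
    (Asymptotics.isLittleO_pow_pow one_lt_two).comp_tendsto (by
      have : Continuous fun z : ℂ => ‖z - z₀‖ := by fun_prop
      simpa using this.tendsto z₀)
  simpa using h2

end Dissipative

/-! ### Generation of analytic contraction semigroups by sectorial operators -/

section Generation

variable {H : Type*} [NormedAddCommGroup H] [InnerProductSpace ℂ H]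

/-- The numerical range of `-B` lies in the sector `|Im ζ| ≤ K Re ζ`, and `1 - μ⁻¹ B` is onto for
every `μ > 0`. -/
structure IsSectorial (B : H →ₗ.[ℂ] H) (K : ℝ) : Prop where
  nonneg : 0 ≤ K
  re_nonpos : ∀ u w, (u, w) ∈ B.graph → (inner ℂ u w).re ≤ 0
  abs_im_le : ∀ u w, (u, w) ∈ B.graph → |(inner ℂ u w).im| ≤ K * -(inner ℂ u w).re
  range : ∀ μ : ℝ, 0 < μ → ∀ f, ∃ u, (u, (μ : ℂ) • (u - f)) ∈ B.graph

/-- The closed cone `K |Im z| ≤ Re z`. -/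
def cone (K : ℝ) : Set ℂ := {z | K * |z.im| ≤ z.re}

theorem add_mem_cone {K : ℝ} (hK : 0 ≤ K) {z w : ℂ} (hz : z ∈ cone K) (hw : w ∈ cone K) :
    z + w ∈ cone K := by
  simp only [cone, Set.mem_ofPred_eq, Complex.add_im, Complex.add_re] at *
  have := mul_le_mul_of_nonneg_left (abs_add_le z.im w.im) hK
  linarith

theorem ofReal_mem_cone {K t : ℝ} (ht : 0 ≤ t) : (t : ℂ) ∈ cone K := by simpa [cone] using ht

/-- The hypothesis `h` reads u - μ⁻¹Bu = f. Pairing Bu = μ(u - f) with u gives ‖u‖² ≤ Re⟨u, f⟩. -/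
theorem norm_le_norm_of_graph {B : H →ₗ.[ℂ] H}
    (hre : ∀ u w, (u, w) ∈ B.graph → (inner ℂ u w).re ≤ 0) {μ : ℝ} (hμ : 0 < μ) {u f : H}
    (h : (u, (μ : ℂ) • (u - f)) ∈ B.graph) : ‖u‖ ≤ ‖f‖ := by
  have h1 := hre _ _ h
  rw [inner_smul_right, Complex.re_ofReal_mul, inner_sub_right, Complex.sub_re] at h1
  have h2 : (inner ℂ u u).re = ‖u‖ ^ 2 := inner_self_eq_norm_sq (𝕜 := ℂ) u
  have h3 : (inner ℂ u f).re ≤ ‖u‖ * ‖f‖ := re_inner_le_norm (𝕜 := ℂ) u f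
  have h4 : ‖u‖ ^ 2 - (inner ℂ u f).re ≤ 0 := by
    rw [h2] at h1
    exact nonpos_of_mul_nonpos_right h1 hμ
  by_contra! hlt
  nlinarith [norm_nonneg f]

theorem exists_resolvent {B : H →ₗ.[ℂ] H}
    (hre : ∀ u w, (u, w) ∈ B.graph → (inner ℂ u w).re ≤ 0) {μ : ℝ} (hμ : 0 < μ)
    (hr : ∀ f, ∃ u, (u, (μ : ℂ) • (u - f)) ∈ B.graph) :
    ∃ J : H →L[ℂ] H, (∀ f, (J f, (μ : ℂ) • (J f - f)) ∈ B.graph) ∧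
      (∀ f u, (u, (μ : ℂ) • (u - f)) ∈ B.graph → u = J f) ∧ ∀ f, ‖J f‖ ≤ ‖f‖ := by
  choose J hJ using hr
  have huniq (f u : H) (h : (u, (μ : ℂ) • (u - f)) ∈ B.graph) : u = J f := by
    have h1 := B.graph.sub_mem h (hJ f)
    have h2 : (u - J f, (μ : ℂ) • ((u - J f) - 0)) ∈ B.graph := by
      convert h1 using 1
      rw [Prod.mk_sub_mk, Prod.mk.injEq]
      exact ⟨rfl, by module⟩
    have := norm_le_norm_of_graph hre hμ h2
    rw [norm_zero] at this
    exact sub_eq_zero.1 (norm_le_zero_iff.1 this)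
  let J₀ : H →ₗ[ℂ] H :=
    { toFun := J
      map_add' := fun f g => by
        refine (huniq _ _ ?_).symm
        convert B.graph.add_mem (hJ f) (hJ g) using 1
        rw [Prod.mk_add_mk, Prod.mk.injEq]
        exact ⟨rfl, by module⟩
      map_smul' := fun k f => by
        refine (huniq _ _ ?_).symm
        convert B.graph.smul_mem k (hJ f) using 1
        rw [Prod.smul_mk, Prod.mk.injEq]
        exact ⟨rfl, by simp only [RingHom.id_apply]; module⟩ }
  refine ⟨J₀.mkContinuous 1 fun f => ?_, hJ, huniq, fun f => norm_le_norm_of_graph hre hμ (hJ f)⟩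
  rw [one_mul]
  exact norm_le_norm_of_graph hre hμ (hJ f)

/-! ### Resolvents and Yosida approximations of a sectorial operator. -/

namespace IsSectorial

variable {B : H →ₗ.[ℂ] H} {K : ℝ}

/-- With J = (1 - B)⁻¹ bounded, membership of (u, w) in the graph amounts to u = J(u - w), a closed
condition. -/
theorem isClosed (hB : IsSectorial B K) : B.IsClosed := by
  obtain ⟨J, hJ, hu, -⟩ := exists_resolvent hB.re_nonpos one_pos (hB.range 1 one_pos)
  have e : (B.graph : Set (H × H)) = {p | p.1 = J (p.1 - p.2)} := by
    ext ⟨u, w⟩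
    constructor
    · intro h
      refine hu _ _ ?_
      simpa using h
    · intro h
      have h' : u = J (u - w) := h
      have := hJ (u - w)
      rw [← h'] at this
      simpa using this
  rw [LinearPMap.IsClosed, e]
  exact isClosed_eq (by fun_prop) (by fun_prop)

/-- The contraction `(1 - (n+1)⁻¹ B)⁻¹`. -/
def resolvent (hB : IsSectorial B K) (n : ℕ) : H →L[ℂ] H :=
  (exists_resolvent hB.re_nonpos (μ := (n : ℝ) + 1) (by positivity)
    (hB.range _ (by positivity))).choose

/-- The Yosida approximation of `B`. -/
def yosida (hB : IsSectorial B K) (n : ℕ) : H →L[ℂ] H :=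
  (((n : ℝ) + 1 : ℝ) : ℂ) • (hB.resolvent n - 1)

variable (hB : IsSectorial B K)

theorem yosida_apply (n : ℕ) (f : H) :
    hB.yosida n f = (((n : ℝ) + 1 : ℝ) : ℂ) • (hB.resolvent n f - f) := rfl

theorem resolvent_mem_graph (n : ℕ) (f : H) : (hB.resolvent n f, hB.yosida n f) ∈ B.graph :=
  (exists_resolvent hB.re_nonpos (μ := (n : ℝ) + 1) (by positivity)
    (hB.range _ (by positivity))).choose_spec.1 f

theorem eq_resolvent (n : ℕ) {f u : H} (h : (u, (((n : ℝ) + 1 : ℝ) : ℂ) • (u - f)) ∈ B.graph) :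
    u = hB.resolvent n f :=
  (exists_resolvent hB.re_nonpos (μ := (n : ℝ) + 1) (by positivity)
    (hB.range _ (by positivity))).choose_spec.2.1 f u h

theorem norm_resolvent_apply_le (n : ℕ) (f : H) : ‖hB.resolvent n f‖ ≤ ‖f‖ :=
  (exists_resolvent hB.re_nonpos (μ := (n : ℝ) + 1) (by positivity)
    (hB.range _ (by positivity))).choose_spec.2.2 f

/-- B commutes with its resolvents, so on the domain the convergence of the Yosida approximations
reduces to that of the resolvents. -/
theorem yosida_apply_of_mem_graph (n : ℕ) {u w : H} (h : (u, w) ∈ B.graph) :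
    hB.yosida n u = hB.resolvent n w := by
  refine hB.eq_resolvent n ?_
  have h1 := B.graph.smul_mem (((n : ℝ) + 1 : ℝ) : ℂ)
    (B.graph.sub_mem (hB.resolvent_mem_graph n u) h)
  exact h1

/-- The resolvent identity in the form `key`: combined with its copy for n and m exchanged, it shows
that both products, multiplied by n - m, equal (n+1)Jₘf - (m+1)Jₙf. -/
theorem commute_resolvent (n m : ℕ) : Commute (hB.resolvent n) (hB.resolvent m) := by
  have key (n m : ℕ) (f : H) : ((n : ℂ) + 1) • hB.resolvent m f
      = hB.resolvent n (((n : ℂ) - m) • hB.resolvent m f + ((m : ℂ) + 1) • f) := by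
    refine hB.eq_resolvent n ?_
    have h1 := B.graph.smul_mem ((n : ℂ) + 1) (hB.resolvent_mem_graph m f)
    convert h1 using 1
    rw [Prod.smul_mk, Prod.mk.injEq, hB.yosida_apply]
    refine ⟨rfl, ?_⟩
    push_cast
    module
  rcases eq_or_ne n m with rfl | hnm
  · exact Commute.refl _
  refine ContinuousLinearMap.ext fun f => ?_
  have h1 := key n m f
  have h2 := key m n f
  rw [map_add, map_smul, map_smul] at h1 h2
  have hne : (n : ℂ) - m ≠ 0 := sub_ne_zero.2 (by exact_mod_cast hnm)
  change hB.resolvent n (hB.resolvent m f) = hB.resolvent m (hB.resolvent n f)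
  refine smul_right_injective H hne ?_
  have e : ((n : ℂ) - m) • hB.resolvent m (hB.resolvent n f)
      = -(((m : ℂ) - n) • hB.resolvent m (hB.resolvent n f)) := by module
  change ((n : ℂ) - m) • hB.resolvent n (hB.resolvent m f) = _ • hB.resolvent m _
  rw [e, eq_sub_of_add_eq h1.symm, eq_sub_of_add_eq h2.symm, neg_sub]

theorem commute_yosida (n m : ℕ) : Commute (hB.yosida n) (hB.yosida m) := by
  have h := hB.commute_resolvent n m
  exact (((h.sub_left (Commute.one_left _)).sub_right (Commute.one_right _)).smul_left _).smul_right _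

/-- With v = Jₙf and w = Bv one has f = v - w/(n+1), so ⟨f, w⟩ = ⟨v, Bv⟩ - ‖w‖²/(n+1). The numerical
range of B is merely moved to the left, hence it stays in the sector |Im ζ| ≤ -K Re ζ, and
multiplication by z with K|Im z| ≤ Re z keeps the real part nonpositive. -/
theorem isDissipative_smul_yosida (n : ℕ) {z : ℂ} (hz : z ∈ cone K) :
    IsDissipative (z • hB.yosida n) := fun f => by
  set v := hB.resolvent n f
  set w := hB.yosida n f with hw
  have hv : (v, w) ∈ B.graph := hB.resolvent_mem_graph n f
  have hn : (((n : ℝ) + 1 : ℝ) : ℂ) ≠ 0 := by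
    exact_mod_cast (by positivity : (n : ℝ) + 1 ≠ 0)
  have hf : f = v - ((((n : ℝ) + 1)⁻¹ : ℝ) : ℂ) • w := by
    rw [hw, hB.yosida_apply, smul_smul, Complex.ofReal_inv, inv_mul_cancel₀ hn, one_smul]
    abel
  have e : inner ℂ f w = inner ℂ v w - ((((n : ℝ) + 1)⁻¹ * ‖w‖ ^ 2 : ℝ) : ℂ) := by
    conv_lhs => rw [hf]
    rw [inner_sub_left, inner_smul_left, Complex.conj_ofReal, inner_self_eq_norm_sq_to_K]
    push_cast
    rfl
  rw [_root_.smul_apply, inner_smul_right, ← hw, e, Complex.mul_re, Complex.sub_re, Complex.sub_im,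
    Complex.ofReal_re, Complex.ofReal_im, sub_zero]
  have h1 := hB.re_nonpos v w hv
  have h2 := hB.abs_im_le v w hv
  have hz' : K * |z.im| ≤ z.re := hz
  have hre : 0 ≤ z.re := le_trans (mul_nonneg hB.nonneg (abs_nonneg _)) hz'
  have h3 : 0 ≤ ((n : ℝ) + 1)⁻¹ * ‖w‖ ^ 2 := by positivity
  have h4 : -(z.im * (inner ℂ v w).im) ≤ |z.im| * |(inner ℂ v w).im| := by
    rw [← abs_mul]; exact neg_le_abs _
  have h5 : |z.im| * |(inner ℂ v w).im| ≤ |z.im| * (K * -(inner ℂ v w).re) := by gcongr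
  have h6 : K * |z.im| * -(inner ℂ v w).re ≤ z.re * -(inner ℂ v w).re :=
    mul_le_mul_of_nonneg_right hz' (by linarith)
  have h7 : 0 ≤ z.re * (((n : ℝ) + 1)⁻¹ * ‖w‖ ^ 2) := mul_nonneg hre h3
  nlinarith

/-! ### Density of the domain and convergence of the approximating semigroups. -/

variable [CompleteSpace H]

/-- If f is orthogonal to the domain and u = (1 - B)⁻¹f, then Re⟨u, Bu⟩ = Re⟨u, u - f⟩ = ‖u‖² must
be nonpositive. So u = 0, and then f = u - Bu = 0. -/
theorem dense_domain (hB : IsSectorial B K) : Dense (B.domain : Set H) := by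
  rw [Submodule.dense_iff_topologicalClosure_eq_top, Submodule.topologicalClosure_eq_top_iff,
    Submodule.eq_bot_iff]
  intro f hf
  have hmem := hB.resolvent_mem_graph 0 f
  have hdom : hB.resolvent 0 f ∈ B.domain := (LinearPMap.mem_domain_iff).2 ⟨_, hmem⟩
  have h0 : inner ℂ (hB.resolvent 0 f) f = 0 := hf _ hdom
  have h1 := hB.re_nonpos _ _ hmem
  have hy : hB.yosida 0 f = hB.resolvent 0 f - f := by simp [hB.yosida_apply]
  rw [hy, inner_sub_right, h0, sub_zero] at h1
  have h2 : (inner ℂ (hB.resolvent 0 f) (hB.resolvent 0 f)).re = ‖hB.resolvent 0 f‖ ^ 2 :=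
    inner_self_eq_norm_sq (𝕜 := ℂ) _
  have h3 : hB.resolvent 0 f = 0 := by
    rw [h2] at h1
    exact norm_eq_zero.1 (pow_eq_zero_iff two_ne_zero |>.1 (le_antisymm h1 (by positivity)))
  rw [hy, h3, zero_sub] at hmem
  have h4 := LinearPMap.graph_fst_eq_zero_snd B hmem rfl
  exact neg_eq_zero.1 h4

theorem exists_graph_near (hB : IsSectorial B K) (w : H) {ε : ℝ} (hε : 0 < ε) : ∃ v v', (v, v') ∈ B.graph ∧ ‖w - v‖ < ε := by
  obtain ⟨v, hv, hd⟩ := hB.dense_domain.exists_dist_lt w hε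
  obtain ⟨v', hv'⟩ := LinearPMap.mem_domain_iff.1 hv
  exact ⟨v, v', hv', by rwa [← dist_eq_norm]⟩

/-- On the domain ‖Jₙv - v‖ ≤ ‖Bv‖/(n+1); density and contractivity extend the convergence to every
vector. -/
theorem tendsto_resolvent (w : H) : Tendsto (fun n => hB.resolvent n w) atTop (𝓝 w) := by
  rw [Metric.tendsto_atTop]
  intro ε hε
  obtain ⟨v, v', hv, hd⟩ := hB.exists_graph_near w (by positivity : 0 < ε / 3)
  obtain ⟨n₀, hn₀⟩ := exists_nat_gt (‖v'‖ / (ε / 3))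
  refine ⟨n₀, fun n hn => ?_⟩
  have h1 : ‖hB.resolvent n v - v‖ < ε / 3 := by
    have h2 : ‖hB.yosida n v‖ ≤ ‖v'‖ := by
      rw [hB.yosida_apply_of_mem_graph n hv]; exact hB.norm_resolvent_apply_le n v'
    rw [hB.yosida_apply, norm_smul, Complex.norm_real, Real.norm_eq_abs,
      abs_of_pos (by positivity : (0 : ℝ) < (n : ℝ) + 1)] at h2
    have h3 : (n₀ : ℝ) ≤ n := by exact_mod_cast hn
    rw [div_lt_iff₀ (by positivity)] at hn₀
    by_contra! h4
    have h5 : (n₀ : ℝ) * (ε / 3) ≤ ((n : ℝ) + 1) * ‖hB.resolvent n v - v‖ := by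
      gcongr; linarith
    linarith
  have h2 := hB.norm_resolvent_apply_le n (w - v)
  rw [dist_eq_norm]
  have e : hB.resolvent n w - w = hB.resolvent n (w - v) + (hB.resolvent n v - v) + (v - w) := by
    rw [map_sub]; abel
  rw [e]
  have h3 := norm_add₃_le (a := hB.resolvent n (w - v)) (b := hB.resolvent n v - v) (c := v - w)
  rw [norm_sub_rev v w] at h3
  linarith

theorem tendsto_yosida {u w : H} (h : (u, w) ∈ B.graph) :
    Tendsto (fun n => hB.yosida n u) atTop (𝓝 w) := by
  simp only [hB.yosida_apply_of_mem_graph _ h]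
  exact hB.tendsto_resolvent w

/-- The exponentials are compared on v, where commutativity applies, and the remainder f - v is
handled by contractivity. For v in the domain the right side is small uniformly for bounded z, which
gives both the limit semigroup and its holomorphy. -/
theorem norm_exp_yosida_sub_le {z : ℂ} (hz : z ∈ cone K) (n m : ℕ) (f v : H) :
    ‖NormedSpace.exp (z • hB.yosida n) f - NormedSpace.exp (z • hB.yosida m) f‖ ≤
      2 * ‖f - v‖ + ‖z‖ * ‖hB.yosida n v - hB.yosida m v‖ := by
  have hn := hB.isDissipative_smul_yosida n hz
  have hm := hB.isDissipative_smul_yosida m hz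
  have h1 := norm_exp_sub_exp_apply_le hm hn
    (((hB.commute_yosida m n).smul_left z).smul_right z) v
  rw [_root_.smul_apply, _root_.smul_apply, ← smul_sub, norm_smul] at h1
  have h2 := hn.norm_exp_apply_le (f - v)
  have h3 := hm.norm_exp_apply_le (f - v)
  set S := NormedSpace.exp (z • hB.yosida n)
  set R := NormedSpace.exp (z • hB.yosida m)
  have e : S f - R f = (S (f - v) - R (f - v)) + (S v - R v) := by
    simp only [map_sub]; abel
  rw [e]
  have h4 := norm_add_le (S (f - v) - R (f - v)) (S v - R v)
  have h5 := norm_sub_le (S (f - v)) (R (f - v))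
  linarith

theorem cauchySeq_exp_yosida {z : ℂ} (hz : z ∈ cone K) (f : H) :
    CauchySeq fun n => NormedSpace.exp (z • hB.yosida n) f := by
  rw [Metric.cauchySeq_iff]
  intro ε hε
  obtain ⟨v, v', hv, hd⟩ := hB.exists_graph_near f (by positivity : 0 < ε / 4)
  obtain ⟨n₀, hn₀⟩ := Metric.cauchySeq_iff.1 (hB.tendsto_yosida hv).cauchySeq
    (ε / (2 * (‖z‖ + 1))) (by positivity)
  refine ⟨n₀, fun n hn m hm => ?_⟩
  have h1 := hn₀ n hn m hm
  rw [dist_eq_norm] at h1 ⊢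
  have h2 := hB.norm_exp_yosida_sub_le hz n m f v
  have h3 : ‖z‖ * ‖hB.yosida n v - hB.yosida m v‖ ≤ ε / 2 := by
    rw [lt_div_iff₀ (by positivity)] at h1
    nlinarith [norm_nonneg z, norm_nonneg (hB.yosida n v - hB.yosida m v)]
  linarith

theorem exists_semigroup {z : ℂ} (hz : z ∈ cone K) :
    ∃ T : H →L[ℂ] H, ∀ f,
      Tendsto (fun n => NormedSpace.exp (z • hB.yosida n) f) atTop (𝓝 (T f)) := by
  choose T hT using fun f => cauchySeq_tendsto_of_complete (hB.cauchySeq_exp_yosida hz f)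
  let T₀ : H →ₗ[ℂ] H :=
    { toFun := T
      map_add' := fun f g => by
        refine tendsto_nhds_unique (hT (f + g)) ?_
        simp only [map_add]
        exact (hT f).add (hT g)
      map_smul' := fun k f => by
        refine tendsto_nhds_unique (hT (k • f)) ?_
        simp only [map_smul]
        exact (hT f).const_smul k }
  refine ⟨T₀.mkContinuous 1 fun f => ?_, hT⟩
  rw [one_mul]
  exact le_of_tendsto (hT f).norm (Eventually.of_forall fun n =>
    (hB.isDissipative_smul_yosida n hz).norm_exp_apply_le f)

open Classical in
/-- The semigroup generated by `B`, on the closed cone `K |Im z| ≤ Re z`. -/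
def semigroup (z : ℂ) : H →L[ℂ] H :=
  if hz : z ∈ cone K then (hB.exists_semigroup hz).choose else 0

theorem tendsto_semigroup {z : ℂ} (hz : z ∈ cone K) (f : H) :
    Tendsto (fun n => NormedSpace.exp (z • hB.yosida n) f) atTop (𝓝 (hB.semigroup z f)) := by
  rw [semigroup, dif_pos hz]
  exact (hB.exists_semigroup hz).choose_spec f

theorem norm_semigroup_apply_le {z : ℂ} (hz : z ∈ cone K) (f : H) :
    ‖hB.semigroup z f‖ ≤ ‖f‖ :=
  le_of_tendsto (hB.tendsto_semigroup hz f).norm (Eventually.of_forall fun n =>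
    (hB.isDissipative_smul_yosida n hz).norm_exp_apply_le f)

theorem semigroup_zero : hB.semigroup 0 = ContinuousLinearMap.id ℂ H := by
  have h0 : (0 : ℂ) ∈ cone K := by simp [cone]
  refine ContinuousLinearMap.ext fun f => tendsto_nhds_unique (hB.tendsto_semigroup h0 f) ?_
  simp

theorem semigroup_add {z w : ℂ} (hz : z ∈ cone K) (hw : w ∈ cone K) :
    hB.semigroup (z + w) = (hB.semigroup z).comp (hB.semigroup w) := by
  let _ : NormedAlgebra ℚ (H →L[ℂ] H) := NormedAlgebra.restrictScalars ℚ ℂ _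
  refine ContinuousLinearMap.ext fun f => ?_
  refine tendsto_nhds_unique (hB.tendsto_semigroup (add_mem_cone hB.nonneg hz hw) f) ?_
  have e (n : ℕ) : NormedSpace.exp ((z + w) • hB.yosida n) f
      = NormedSpace.exp (z • hB.yosida n) (NormedSpace.exp (w • hB.yosida n) f) := by
    rw [add_smul, NormedSpace.exp_add_of_commute
      (((Commute.refl (hB.yosida n)).smul_left z).smul_right w)]
    rfl
  simp only [e]
  -- The outer exponentials are contractions, so the inner ones may be replaced by their limit with
  -- vanishing error.
  have h1 := hB.tendsto_semigroup hz (hB.semigroup w f)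
  have h2 : Tendsto (fun n => NormedSpace.exp (z • hB.yosida n)
      (NormedSpace.exp (w • hB.yosida n) f - hB.semigroup w f)) atTop (𝓝 0) := by
    refine squeeze_zero_norm (fun n =>
      (hB.isDissipative_smul_yosida n hz).norm_exp_apply_le _) ?_
    have := (hB.tendsto_semigroup hw f).sub_const (hB.semigroup w f)
    rw [sub_self] at this
    simpa using this.norm
  have h3 := h1.add h2
  simpa using h3

theorem norm_semigroup_sub_le {z : ℂ} (hz : z ∈ cone K) {u w : H} (h : (u, w) ∈ B.graph) :
    ‖hB.semigroup z u - u‖ ≤ ‖z‖ * ‖w‖ := by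
  refine le_of_tendsto_of_tendsto ((hB.tendsto_semigroup hz u).sub_const u).norm
    ((hB.tendsto_yosida h).norm.const_mul ‖z‖) (Eventually.of_forall fun n => ?_)
  have := (hB.isDissipative_smul_yosida n hz).norm_exp_apply_sub_le u
  rwa [_root_.smul_apply, norm_smul] at this

theorem tendsto_semigroup_zero (u : H) :
    Tendsto (fun z => hB.semigroup z u) (𝓝[cone K] 0) (𝓝 u) := by
  rw [Metric.tendsto_nhdsWithin_nhds]
  intro ε hε
  obtain ⟨v, v', hv, hd⟩ := hB.exists_graph_near u (by positivity : 0 < ε / 3)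
  refine ⟨ε / (3 * (‖v'‖ + 1)), by positivity, fun z hz hz0 => ?_⟩
  rw [dist_zero_right, lt_div_iff₀ (by positivity)] at hz0
  have h1 := hB.norm_semigroup_sub_le hz hv
  have h2 := hB.norm_semigroup_apply_le hz (u - v)
  rw [dist_eq_norm]
  have e : hB.semigroup z u - u
      = hB.semigroup z (u - v) + (hB.semigroup z v - v) + (v - u) := by
    rw [map_sub]; abel
  have h3 := norm_add₃_le (a := hB.semigroup z (u - v)) (b := hB.semigroup z v - v) (c := v - u)
  rw [norm_sub_rev v u] at h3
  rw [e]
  nlinarith [norm_nonneg z]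

theorem tendstoUniformlyOn_semigroup {s : Set ℂ} (hs : s ⊆ cone K) {R : ℝ} (hR : ∀ z ∈ s, ‖z‖ ≤ R)
    (f : H) : TendstoUniformlyOn (fun n z => NormedSpace.exp (z • hB.yosida n) f)
      (fun z => hB.semigroup z f) atTop s := by
  rw [Metric.tendstoUniformlyOn_iff]
  intro ε hε
  obtain ⟨v, v', hv, hd⟩ := hB.exists_graph_near f (by positivity : 0 < ε / 4)
  have h1 := (Metric.tendsto_atTop.1 (hB.tendsto_yosida hv)) (ε / (2 * (|R| + 1))) (by positivity)
  obtain ⟨n₀, hn₀⟩ := h1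
  filter_upwards [eventually_ge_atTop n₀] with n hn z hz
  have h2 : ‖hB.semigroup z f - NormedSpace.exp (z • hB.yosida n) f‖ ≤
      2 * ‖f - v‖ + ‖z‖ * ‖v' - hB.yosida n v‖ :=
    le_of_tendsto_of_tendsto
      ((hB.tendsto_semigroup (hs hz) f).sub_const (NormedSpace.exp (z • hB.yosida n) f)).norm
      ((((hB.tendsto_yosida hv).sub_const (hB.yosida n v)).norm.const_mul ‖z‖).const_add
        (2 * ‖f - v‖))
      (Eventually.of_forall fun m => hB.norm_exp_yosida_sub_le (hs hz) m n f v)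
  have h3 := hn₀ n hn
  rw [dist_eq_norm, norm_sub_rev, lt_div_iff₀ (by positivity)] at h3
  rw [dist_eq_norm]
  have h4 : ‖z‖ ≤ |R| := (hR z hz).trans (le_abs_self R)
  have h5 : ‖z‖ * ‖v' - hB.yosida n v‖ ≤ |R| * ‖v' - hB.yosida n v‖ := by gcongr
  nlinarith [norm_nonneg (v' - hB.yosida n v)]

/-- On a ball inside the open cone each orbit is a uniform limit of entire functions, hence
holomorphic; contractivity upgrades this to the operator norm. -/
theorem differentiableAt_semigroup {z₀ : ℂ} (hz₀ : K * |z₀.im| < z₀.re) :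
    DifferentiableAt ℂ hB.semigroup z₀ := by
  have hopen : IsOpen {z : ℂ | K * |z.im| < z.re} :=
    isOpen_lt (by fun_prop) (by fun_prop)
  obtain ⟨r, hr, hball⟩ := Metric.isOpen_iff.1 hopen z₀ hz₀
  have hcone : Metric.ball z₀ r ⊆ cone K := fun z hz => by
    have h : K * |z.im| < z.re := hball hz
    exact h.le
  refine differentiableAt_of_strongly_differentiableOn hr (fun f => ?_)
    (fun z hz f => hB.norm_semigroup_apply_le (hcone hz) f)
  have hu := hB.tendstoUniformlyOn_semigroup hcone (R := ‖z₀‖ + r) (fun z hz => by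
    rw [mem_ball_iff_norm] at hz
    have := norm_add_le (z - z₀) z₀
    rw [sub_add_cancel] at this
    linarith) f
  refine hu.tendstoLocallyUniformlyOn.differentiableOn (Eventually.of_forall fun n => ?_)
    Metric.isOpen_ball
  intro z _
  have h := (hasDerivAt_exp_smul_const' (𝕂 := ℂ) (hB.yosida n) z)
  exact ((ContinuousLinearMap.apply ℂ H f).hasFDerivAt.comp_hasDerivAt z
    h).differentiableAt.differentiableWithinAt

/-- The first order expansion for the Yosida approximations passes to the limit in n. Since w = Bu
need not lie in the domain, it is approximated there by v, and v' = Bv multiplies the factor t. -/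
theorem tendsto_difference_quotient {u w : H} (h : (u, w) ∈ B.graph) :
    Tendsto (fun t : ℝ => (t : ℂ)⁻¹ • (hB.semigroup (t : ℂ) u - u)) (𝓝[>] 0) (𝓝 w) := by
  have key {v v' : H} (hv : (v, v') ∈ B.graph) {t : ℝ} (ht : 0 < t) :
      ‖(t : ℂ)⁻¹ • (hB.semigroup (t : ℂ) u - u) - w‖ ≤ 2 * ‖w - v‖ + t * ‖v'‖ := by
    have hY := hB.tendsto_yosida h
    have hlim := le_of_tendsto_of_tendsto
      (((hB.tendsto_semigroup (ofReal_mem_cone ht.le) u).sub_const u).sub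
        (hY.const_smul (t : ℂ))).norm
      (((((hY.sub_const w).norm.const_mul 2).add_const (2 * ‖w - v‖)).add
        ((hB.tendsto_yosida hv).norm.const_mul t)).const_mul t)
      (Eventually.of_forall fun n => by
        have hd : IsDissipative (hB.yosida n) := by
          simpa using hB.isDissipative_smul_yosida n (ofReal_mem_cone (t := 1) zero_le_one)
        exact hd.norm_exp_apply_sub_sub_le u w v ht.le)
    rw [sub_self, norm_zero, mul_zero, zero_add] at hlim
    have ht' : (t : ℂ) ≠ 0 := by exact_mod_cast ht.ne'
    have e : hB.semigroup (t : ℂ) u - u - (t : ℂ) • w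
        = (t : ℂ) • ((t : ℂ)⁻¹ • (hB.semigroup (t : ℂ) u - u) - w) := by
      rw [smul_sub, smul_smul, mul_inv_cancel₀ ht', one_smul]
    rw [e, norm_smul, Complex.norm_real, Real.norm_eq_abs, abs_of_pos ht] at hlim
    exact le_of_mul_le_mul_left hlim ht
  rw [Metric.tendsto_nhdsWithin_nhds]
  intro ε hε
  obtain ⟨v, v', hv, hd⟩ := hB.exists_graph_near w (by positivity : 0 < ε / 4)
  refine ⟨ε / (2 * (‖v'‖ + 1)), by positivity, fun t ht ht0 => ?_⟩
  have h1 := key hv ht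
  rw [dist_zero_right, Real.norm_eq_abs, abs_of_pos ht, lt_div_iff₀ (by positivity)] at ht0
  have ht' : 0 < t := ht
  rw [dist_eq_norm]
  nlinarith

theorem isGenerator_semigroup : IsGenerator B hB.semigroup := by
  intro u w
  refine ⟨hB.tendsto_difference_quotient, fun h => ?_⟩
  -- A generator has no proper dissipative extension: v solves v - Bv = u - w, so the difference
  -- quotients at u - v converge to u - v itself. Contractivity makes their inner products with u -
  -- v have nonpositive real part, which forces u = v.
  obtain ⟨v, hv⟩ := hB.range 1 one_pos (u - w)
  rw [Complex.ofReal_one, one_smul] at hv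
  have h1 := h.sub (hB.tendsto_difference_quotient hv)
  have e (t : ℝ) : (t : ℂ)⁻¹ • (hB.semigroup (t : ℂ) u - u)
      - (t : ℂ)⁻¹ • (hB.semigroup (t : ℂ) v - v)
      = (t : ℂ)⁻¹ • (hB.semigroup (t : ℂ) (u - v) - (u - v)) := by
    rw [map_sub]; module
  have e' : w - (v - (u - w)) = u - v := by abel
  simp only [e, e'] at h1
  have h2 : Tendsto (fun t : ℝ => (inner ℂ (u - v)
      ((t : ℂ)⁻¹ • (hB.semigroup (t : ℂ) (u - v) - (u - v)))).re) (𝓝[>] 0)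
      (𝓝 (inner ℂ (u - v) (u - v)).re) :=
    (Complex.continuous_re.tendsto _).comp (tendsto_const_nhds.inner h1)
  have h3 : (inner ℂ (u - v) (u - v)).re ≤ 0 := by
    refine le_of_tendsto h2 ?_
    filter_upwards [self_mem_nhdsWithin] with t ht
    have ht' : 0 < t := ht
    rw [inner_smul_right, ← Complex.ofReal_inv, Complex.re_ofReal_mul, inner_sub_right,
      Complex.sub_re]
    have h4 : (inner ℂ (u - v) (u - v)).re = ‖u - v‖ ^ 2 := inner_self_eq_norm_sq (𝕜 := ℂ) _
    have h5 : (inner ℂ (u - v) (hB.semigroup (t : ℂ) (u - v))).re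
        ≤ ‖u - v‖ * ‖hB.semigroup (t : ℂ) (u - v)‖ := re_inner_le_norm (𝕜 := ℂ) _ _
    have h6 := hB.norm_semigroup_apply_le (ofReal_mem_cone ht'.le) (u - v)
    have h7 : ‖u - v‖ * ‖hB.semigroup (t : ℂ) (u - v)‖ ≤ ‖u - v‖ * ‖u - v‖ := by gcongr
    refine mul_nonpos_of_nonneg_of_nonpos (by positivity) ?_
    rw [h4]
    nlinarith
  have h4 : (inner ℂ (u - v) (u - v)).re = ‖u - v‖ ^ 2 := inner_self_eq_norm_sq (𝕜 := ℂ) _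
  have h5 : u = v := by
    rw [h4] at h3
    have := pow_eq_zero_iff two_ne_zero |>.1 (le_antisymm h3 (by positivity))
    exact sub_eq_zero.1 (norm_eq_zero.1 this)
  rw [← h5] at hv
  simpa using hv

theorem generatesAnalyticContractionSemigroup (hB : IsSectorial B K) :
    GeneratesAnalyticContractionSemigroup B := by
  have hK := hB.nonneg
  -- Here tan|arg z| = |Im z|/Re z. Using K + 1 instead of K keeps the angle defined when K = 0.
  have hsec : ∀ z ∈ sector (Real.arctan (1 / (K + 1))), K * |z.im| < z.re := by
    rintro z ⟨hz, harg⟩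
    have hlt : |z.arg| < Real.pi / 2 := harg.trans (Real.arctan_lt_pi_div_two _)
    have hre : 0 < z.re := by
      rcases Complex.abs_arg_lt_pi_div_two_iff.1 hlt with h | h
      · exact h
      · exact absurd h hz
    have h1 : Real.tan |z.arg| < 1 / (K + 1) := by
      rw [← Real.tan_arctan (1 / (K + 1))]
      exact Real.tan_lt_tan_of_lt_of_lt_pi_div_two
        (by linarith [abs_nonneg z.arg, Real.pi_pos]) (Real.arctan_lt_pi_div_two _) harg
    have h2 : Real.tan |z.arg| = |z.im| / z.re := by
      rcases abs_cases z.arg with ⟨h, h'⟩ | ⟨h, h'⟩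
      · rw [h, Complex.tan_arg, abs_of_nonneg (Complex.arg_nonneg_iff.1 h')]
      · rw [h, Real.tan_neg, Complex.tan_arg, abs_of_neg (Complex.arg_neg_iff.1 h'), neg_div]
    rw [h2, div_lt_div_iff₀ hre (by positivity)] at h1
    nlinarith [abs_nonneg z.im]
  have hcone : sector (Real.arctan (1 / (K + 1))) ⊆ cone K := fun z hz => (hsec z hz).le
  refine ⟨Real.arctan (1 / (K + 1)), Real.arctan_pos.2 (by positivity),
    (Real.arctan_lt_pi_div_two _).le, hB.semigroup, ⟨hB.semigroup_zero, ?_, ?_, ?_, ?_⟩,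
    hB.isGenerator_semigroup⟩
  · exact fun z hz w hw => hB.semigroup_add (hcone hz) (hcone hw)
  · exact fun z hz => (hB.differentiableAt_semigroup (hsec z hz)).differentiableWithinAt
  · exact fun z hz => ContinuousLinearMap.opNorm_le_bound _ zero_le_one fun f => by
      rw [one_mul]; exact hB.norm_semigroup_apply_le (hcone hz) f
  · exact fun u => (hB.tendsto_semigroup_zero u).mono_left (nhdsWithin_mono _ hcone)

end IsSectorial

end Generation

/-! ### The operator associated with a closed sectorial form -/

section Forms

/-- The Lax–Milgram theorem over `ℂ`. -/
theorem exists_eq_of_coercive {V : Type*} [NormedAddCommGroup V] [InnerProductSpace ℂ V]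
    [CompleteSpace V] (q : V →L⋆[ℂ] V →L[ℂ] ℂ) {k : ℝ} (hk : 0 < k)
    (hq : ∀ u, k * ‖u‖ ^ 2 ≤ (q u u).re) (l : V →L[ℂ] ℂ) : ∃ u, q u = l := by
  set A : V →L[ℂ] V := InnerProductSpace.continuousLinearMapOfBilin q with hA
  have hAq (u v : V) : inner ℂ (A u) v = q u v :=
    InnerProductSpace.continuousLinearMapOfBilin_apply q u v
  have hbelow (u : V) : k * ‖u‖ ≤ ‖A u‖ := by
    rcases eq_or_ne u 0 with rfl | hu
    · simp
    have h1 := hq u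
    rw [← hAq u u] at h1
    have h2 : (inner ℂ (A u) u).re ≤ ‖A u‖ * ‖u‖ := re_inner_le_norm (𝕜 := ℂ) _ _
    refine le_of_mul_le_mul_right ?_ (norm_pos_iff.2 hu)
    calc k * ‖u‖ * ‖u‖ = k * ‖u‖ ^ 2 := by ring
      _ ≤ _ := h1.trans h2
  have hanti : AntilipschitzWith (k⁻¹).toNNReal A := by
    refine A.antilipschitz_of_bound fun u => ?_
    rw [Real.coe_toNNReal _ (by positivity), inv_mul_eq_div, le_div_iff₀ hk, mul_comm]
    exact hbelow u
  have hclosed : IsClosed (A.range : Set V) := hanti.isClosed_range A.uniformContinuous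
  have htop : A.range = ⊤ := by
    have := hclosed.completeSpace_coe
    -- The range is closed, hence complete and equal to its double orthogonal. A vector w orthogonal
    -- to it satisfies ⟨Aw, w⟩ = 0, so coercivity gives w = 0.
    rw [← A.range.orthogonal_orthogonal, Submodule.eq_top_iff']
    intro v w hw
    have h0 : inner ℂ (A w) w = 0 := hw _ ⟨w, rfl⟩
    have h1 := hq w
    rw [← hAq w w, h0, Complex.zero_re] at h1
    have h2 : ‖w‖ ^ 2 ≤ 0 := nonpos_of_mul_nonpos_right h1 hk
    have h3 : w = 0 :=
      norm_eq_zero.1 (pow_eq_zero_iff two_ne_zero |>.1 (le_antisymm h2 (by positivity)))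
    rw [h3, inner_zero_left]
  obtain ⟨u, hu⟩ : (InnerProductSpace.toDual ℂ V).symm l ∈ A.range := htop ▸ Submodule.mem_top
  refine ⟨u, ContinuousLinearMap.ext fun v => ?_⟩
  have hu' : A u = (InnerProductSpace.toDual ℂ V).symm l := hu
  rw [← hAq, hu', InnerProductSpace.toDual_symm_apply]

/-! ### The Hilbert space of a closed accretive form and its operator. -/

namespace SesqForm

variable {H : Type*} [NormedAddCommGroup H] [InnerProductSpace ℂ H]

/-- The domain of a form, to be endowed with the form norm. -/
def Space (a : SesqForm H) : Type _ := a.domain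

/-- Only the algebraic structure is transferred, since the norm inherited from H would compete with
the form norm. -/
instance (a : SesqForm H) : AddCommGroup a.Space := inferInstanceAs (AddCommGroup a.domain)

instance (a : SesqForm H) : Module ℂ a.Space := inferInstanceAs (Module ℂ a.domain)

variable (a : SesqForm H)

/-- The form on the domain, as a type synonym. -/
def spaceForm : a.Space →ₗ[ℂ] a.Space →ₛₗ[starRingEnd ℂ] ℂ := a.form

/-- The inclusion of the domain. -/
def incl : a.Space →ₗ[ℂ] H := a.domain.subtype

/-- The inner product of the form norm. -/
@[reducible] def innerCore {a : SesqForm H} (ha : a.IsAccretive) : InnerProductSpace.Core ℂ a.Space where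
  -- The Hermitian part of the form plus the inner product of H. The arguments are exchanged because
  -- the form is linear in its first variable and `inner` in its second.
  inner u v := (a.spaceForm v u + conj (a.spaceForm u v)) / 2 + inner ℂ (a.incl u) (a.incl v)
  conj_inner_symm u v := by
    simp only [map_add, map_div₀, Complex.conj_conj, inner_conj_symm, map_ofNat]
    ring
  re_inner_nonneg u := by
    have h1 := ha u
    have h2 : 0 ≤ (inner ℂ (a.incl u) (a.incl u)).re := inner_self_nonneg (𝕜 := ℂ)
    have e : (a.spaceForm u u + conj (a.spaceForm u u)) / 2 = ((a.spaceForm u u).re : ℂ) := by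
      rw [Complex.add_conj]; simp
    rw [e, map_add, RCLike.re_eq_complex_re, Complex.ofReal_re]
    exact add_nonneg h1 h2
  add_left u v w := by
    simp only [map_add, LinearMap.add_apply, inner_add_left]
    ring
  smul_left u v k := by
    simp only [map_smulₛₗ, LinearMap.smul_apply, inner_smul_left, smul_eq_mul, map_mul,
      RingHom.id_apply]
    ring
  definite u h := by
    have h1 := ha u
    have e : (a.spaceForm u u + conj (a.spaceForm u u)) / 2 = ((a.spaceForm u u).re : ℂ) := by
      rw [Complex.add_conj]; simp
    rw [e] at h
    have h2 := congrArg Complex.re h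
    rw [Complex.add_re, Complex.ofReal_re, Complex.zero_re] at h2
    have h3 : (inner ℂ (a.incl u) (a.incl u)).re = ‖a.incl u‖ ^ 2 :=
      inner_self_eq_norm_sq (𝕜 := ℂ) _
    have h4 : 0 ≤ (a.spaceForm u u).re := h1
    have h5 : ‖a.incl u‖ ^ 2 = 0 := by nlinarith [sq_nonneg ‖a.incl u‖]
    have h6 : a.incl u = 0 := norm_eq_zero.1 (pow_eq_zero_iff two_ne_zero |>.1 h5)
    exact Subtype.ext h6

/-- Lax–Milgram on the form domain, which is complete exactly because the form is closed. This
supplies the range condition of `IsSectorial`. -/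
theorem exists_form_eq {a : SesqForm H} (ha : a.IsAccretive) (hc : a.IsContinuous)
    (hcl : a.IsClosed) {μ : ℝ} (hμ : 0 < μ) (f : H) :
    ∃ u : a.domain, ∀ h : a.domain, a.form u h + μ * inner ℂ (h : H) (u : H) = inner ℂ (h : H) f := by
  let _ : NormedAddCommGroup a.Space := (innerCore ha).toNormedAddCommGroup
  let _ : InnerProductSpace ℂ a.Space := InnerProductSpace.ofCore (innerCore ha).toCore
  have hinner (u v : a.Space) : inner ℂ u v
      = (a.spaceForm v u + conj (a.spaceForm u v)) / 2 + inner ℂ (a.incl u) (a.incl v) := rfl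
  have hsq (u : a.Space) : ‖u‖ ^ 2 = (a.spaceForm u u).re + ‖a.incl u‖ ^ 2 := by
    have h1 : (inner ℂ u u).re = ‖u‖ ^ 2 := inner_self_eq_norm_sq (𝕜 := ℂ) u
    have h3 : (inner ℂ (a.incl u) (a.incl u)).re = ‖a.incl u‖ ^ 2 :=
      inner_self_eq_norm_sq (𝕜 := ℂ) _
    rw [← h1, hinner, Complex.add_conj, Complex.add_re, h3]
    simp
  have hacc (u : a.Space) : 0 ≤ (a.spaceForm u u).re := ha u
  have hnorm (u : a.Space) : ‖u‖ = a.formNorm u := by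
    rw [← Real.sqrt_sq (norm_nonneg u), hsq]
    rfl
  have hcomplete : CompleteSpace a.Space := by
    refine Metric.complete_of_cauchySeq_tendsto fun u hu => ?_
    obtain ⟨v, hv⟩ := hcl u fun ε hε => by
      obtain ⟨n₀, hn₀⟩ := Metric.cauchySeq_iff.1 hu ε hε
      refine ⟨n₀, fun n hn m hm => ?_⟩
      have := hn₀ n hn m hm
      rw [dist_eq_norm, hnorm] at this
      exact this
    refine ⟨v, tendsto_iff_norm_sub_tendsto_zero.2 ?_⟩
    simp only [hnorm]
    exact hv
  have hincl (u : a.Space) : ‖a.incl u‖ ≤ ‖u‖ := by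
    refine (sq_le_sq₀ (norm_nonneg _) (norm_nonneg _)).1 ?_
    rw [hsq]
    linarith [hacc u]
  obtain ⟨M, hM0, hM⟩ := hc
  let ι : a.Space →L[ℂ] H := a.incl.mkContinuous 1 fun u => by rw [one_mul]; exact hincl u
  -- Conjugating the form makes it antilinear in the first variable, as Lax–Milgram is stated; the
  -- resulting equation is conjugated back at the end.
  let q₀ : a.Space →ₛₗ[starRingEnd ℂ] a.Space →ₗ[ℂ] ℂ :=
    LinearMap.mk₂'ₛₗ (starRingEnd ℂ) (RingHom.id ℂ)
      (fun u v => conj (a.spaceForm u v) + μ * inner ℂ (a.incl u) (a.incl v))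
      (fun u u' v => by
        simp only [map_add, LinearMap.add_apply, inner_add_left]; ring)
      (fun k u v => by
        simp only [map_smul, LinearMap.smul_apply, inner_smul_left, smul_eq_mul, map_mul]; ring)
      (fun u v v' => by
        simp only [map_add, inner_add_right]; ring)
      (fun k u v => by
        simp only [map_smulₛₗ, inner_smul_right, smul_eq_mul, map_mul, Complex.conj_conj,
          RingHom.id_apply]; ring)
  let q : a.Space →L⋆[ℂ] a.Space →L[ℂ] ℂ := q₀.mkContinuous₂ (M + μ) fun u v => by
    have h1 : ‖a.spaceForm u v‖ ≤ M * ‖u‖ * ‖v‖ := by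
      rw [hnorm, hnorm]; exact hM u v
    have h2 : ‖inner ℂ (a.incl u) (a.incl v)‖ ≤ ‖u‖ * ‖v‖ :=
      (norm_inner_le_norm _ _).trans (by gcongr <;> exact hincl _)
    calc ‖conj (a.spaceForm u v) + μ * inner ℂ (a.incl u) (a.incl v)‖
        ≤ ‖conj (a.spaceForm u v)‖ + ‖(μ : ℂ) * inner ℂ (a.incl u) (a.incl v)‖ := norm_add_le _ _
      _ = ‖a.spaceForm u v‖ + μ * ‖inner ℂ (a.incl u) (a.incl v)‖ := by
        rw [RCLike.norm_conj, norm_mul, Complex.norm_real, Real.norm_eq_abs, abs_of_pos hμ]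
      _ ≤ M * ‖u‖ * ‖v‖ + μ * (‖u‖ * ‖v‖) := by gcongr
      _ = _ := by ring
  have hq (u v : a.Space) :
      q u v = conj (a.spaceForm u v) + μ * inner ℂ (a.incl u) (a.incl v) := rfl
  -- The squared form norm weighs Re a(u,u) and ‖u‖² by 1 and 1, and Re q(u,u) weighs them by 1 and
  -- μ.
  obtain ⟨u, hu⟩ := exists_eq_of_coercive q (k := min 1 μ) (by positivity) (fun u => by
    have h3 : (inner ℂ (a.incl u) (a.incl u)).re = ‖a.incl u‖ ^ 2 :=
      inner_self_eq_norm_sq (𝕜 := ℂ) _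
    rw [hq, Complex.add_re, Complex.conj_re, Complex.re_ofReal_mul, h3, hsq, mul_add]
    have h4 := mul_le_mul_of_nonneg_right (min_le_left 1 μ) (hacc u)
    have h5 := mul_le_mul_of_nonneg_right (min_le_right 1 μ) (sq_nonneg ‖a.incl u‖)
    linarith) ((innerSL ℂ f).comp ι)
  refine ⟨u, fun (h : a.Space) => ?_⟩
  have h1 : q u h = inner ℂ f (a.incl h) := by rw [hu]; rfl
  rw [hq] at h1
  have h2 := congrArg (starRingEnd ℂ) h1
  rw [map_add, Complex.conj_conj, map_mul, Complex.conj_ofReal, inner_conj_symm,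
    inner_conj_symm] at h2
  exact h2

/-- The graph of the operator `B` for which `-B` is associated with `a`. -/
def opGraph (a : SesqForm H) : Submodule ℂ (H × H) where
  carrier := {p | ∃ hu : p.1 ∈ a.domain,
    ∀ h : a.domain, a.form ⟨p.1, hu⟩ h = inner ℂ (h : H) (-p.2)}
  zero_mem' := ⟨a.domain.zero_mem, fun h => by
    have e : a.form ⟨(0 : H × H).1, a.domain.zero_mem⟩ = 0 := a.form.map_zero
    rw [e]; simp⟩
  add_mem' := by
    rintro ⟨u, w⟩ ⟨u', w'⟩ ⟨hu, h⟩ ⟨hu', h'⟩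
    refine ⟨a.domain.add_mem hu hu', fun v => ?_⟩
    have e : a.form ⟨((u, w) + (u', w')).1, a.domain.add_mem hu hu'⟩
        = a.form ⟨u, hu⟩ + a.form ⟨u', hu'⟩ := a.form.map_add ⟨u, hu⟩ ⟨u', hu'⟩
    rw [e, LinearMap.add_apply, h v, h' v, ← inner_add_right]
    simp only [Prod.mk_add_mk, neg_add]
  smul_mem' := by
    rintro k ⟨u, w⟩ ⟨hu, h⟩
    refine ⟨a.domain.smul_mem k hu, fun v => ?_⟩
    have e : a.form ⟨(k • (u, w)).1, a.domain.smul_mem k hu⟩ = k • a.form ⟨u, hu⟩ :=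
      a.form.map_smul k ⟨u, hu⟩
    rw [e, LinearMap.smul_apply, h v, smul_eq_mul, ← inner_smul_right]
    simp only [Prod.smul_mk, smul_neg]

/-- The operator `B` for which `-B` is associated with `a`. -/
def op (a : SesqForm H) : H →ₗ.[ℂ] H := a.opGraph.toLinearPMap

/-- Density of the form domain determines w by its inner products, so the graph is that of a
function. -/
theorem isNegAssociated_op {a : SesqForm H} (hd : a.IsDenselyDefined) :
    a.IsNegAssociated a.op := by
  intro u w
  rw [op, Submodule.toLinearPMap_graph_eq]
  · rfl
  · rintro ⟨u, w⟩ ⟨hu, h⟩ hu0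
    obtain rfl : u = 0 := hu0
    have e : a.form ⟨0, hu⟩ = 0 := a.form.map_zero
    simp only [e] at h
    have h1 : ∀ v : a.domain, inner ℂ (v : H) w = 0 := fun v => by
      have := h v
      rw [LinearMap.zero_apply, inner_neg_right, eq_comm, neg_eq_zero] at this
      exact this
    have h2 : w = 0 := hd.eq_zero_of_inner_right ℂ (fun v hv => h1 ⟨v, hv⟩)
    exact h2

theorem isSectorial_op {a : SesqForm H} (hd : a.IsDenselyDefined) (ha : a.IsAccretive)
    (hc : a.IsContinuous) (hcl : a.IsClosed) {K : ℝ} (hK : 0 ≤ K)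
    (hs : ∀ u : a.domain, |(a.form u u).im| ≤ K * (a.form u u).re) : IsSectorial a.op K where
  nonneg := hK
  re_nonpos u w h := by
    obtain ⟨hu, h⟩ := (isNegAssociated_op hd u w).1 h
    have h1 := ha ⟨u, hu⟩
    rw [h ⟨u, hu⟩, inner_neg_right, Complex.neg_re] at h1
    linarith
  abs_im_le u w h := by
    obtain ⟨hu, h⟩ := (isNegAssociated_op hd u w).1 h
    have h1 := hs ⟨u, hu⟩
    rwa [h ⟨u, hu⟩, inner_neg_right, Complex.neg_re, Complex.neg_im, abs_neg] at h1
  range μ hμ f := by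
    -- With right side μf the equation a(u,h) + μ⟨u,h⟩ = ⟨μf,h⟩ says Bu = μ(u - f).
    obtain ⟨u, hu⟩ := exists_form_eq ha hc hcl hμ ((μ : ℂ) • f)
    refine ⟨u, (isNegAssociated_op hd _ _).2 ⟨u.2, fun h => ?_⟩⟩
    rw [← smul_neg, neg_sub, smul_sub, inner_sub_right, ← hu h, inner_smul_right]
    ring

end SesqForm

end Forms

/-! ### Translations in `L²` and the product rule for `|u|²` -/

section Translation

variable {N : ℕ}

/-- The `i`-th unit vector. -/
abbrev unitVec (i : Fin N) : E N := EuclideanSpace.single i 1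

theorem norm_unitVec (i : Fin N) : ‖unitVec i‖ = 1 := by simp

/-- The translation `u ↦ u(· + s eᵢ)` of `L²`. -/
def translate (i : Fin N) (s : ℝ) : L2 N →ₗᵢ[ℂ] L2 N :=
  Lp.compMeasurePreservingₗᵢ ℂ (fun x => x + s • unitVec i)
    (measurePreserving_add_right volume (s • unitVec i))

theorem coeFn_translate (i : Fin N) (s : ℝ) (u : L2 N) :
    translate i s u =ᵐ[volume] fun x => u (x + s • unitVec i) :=
  Lp.coeFn_compMeasurePreserving u (measurePreserving_add_right volume (s • unitVec i))

theorem continuous_translate (i : Fin N) (u : L2 N) : Continuous fun s => translate i s u := by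
  let g : C(ℝ, C(E N, E N)) :=
    (ContinuousMap.mk (fun p : ℝ × E N => p.2 + p.1 • unitVec i) (by fun_prop)).curry
  exact Continuous.compMeasurePreservingLp (continuous_const (y := u)) g.continuous
    (fun s => measurePreserving_add_right volume (s • unitVec i)) (by norm_num)

theorem translate_zero (i : Fin N) (u : L2 N) : translate i 0 u = u := by
  refine Lp.ext ?_
  filter_upwards [coeFn_translate i 0 u] with x hx
  rw [hx]; simp

theorem hasDerivAt_comp_sub {φ : E N → ℝ} (hφ : ContDiff ℝ 1 φ) (i : Fin N) (x : E N) (s : ℝ) :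
    HasDerivAt (fun s : ℝ => φ (x - s • unitVec i)) (-partialDeriv i φ (x - s • unitVec i)) s := by
  have h1 : HasDerivAt (fun s : ℝ => x - s • unitVec i) (-unitVec i) s := by
    simpa using ((hasDerivAt_id s).smul_const (unitVec i)).const_sub x
  have h2 := (hφ.differentiable (by simp) (x - s • unitVec i)).hasFDerivAt.comp_hasDerivAt s h1
  rw [map_neg] at h2
  exact h2

theorem continuous_partialDeriv_of_contDiff_one (i : Fin N) {φ : E N → ℝ} (hφ : ContDiff ℝ 1 φ) :
    Continuous (partialDeriv i φ) :=
  (hφ.continuous_fderiv (by simp)).clm_apply continuous_const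

/-- With the shift placed on φ, the density w need only be integrable. It is used for a truncation
of u and for |u|². -/
theorem hasDerivAt_integral_shift {φ : E N → ℝ} (hφ : ContDiff ℝ 1 φ) (i : Fin N) {C C' : ℝ}
    (hC : ∀ x, |φ x| ≤ C) (hC' : ∀ x, |partialDeriv i φ x| ≤ C') {w : E N → ℂ}
    (hw : Integrable w) (s : ℝ) :
    HasDerivAt (fun s : ℝ => ∫ x, φ (x - s • unitVec i) • w x)
      (-∫ x, partialDeriv i φ (x - s • unitVec i) • w x) s := by
  have hcont (s : ℝ) : Continuous fun x => φ (x - s • unitVec i) :=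
    hφ.continuous.comp (by fun_prop)
  have hcont' (s : ℝ) : Continuous fun x => -partialDeriv i φ (x - s • unitVec i) :=
    ((continuous_partialDeriv_of_contDiff_one i hφ).comp (by fun_prop)).neg
  have h := hasDerivAt_integral_of_dominated_loc_of_deriv_le (μ := (volume : Measure (E N)))
    (F := fun (s : ℝ) x => φ (x - s • unitVec i) • w x)
    (F' := fun (s : ℝ) x => (-partialDeriv i φ (x - s • unitVec i)) • w x)
    (bound := fun x => C' * ‖w x‖) (x₀ := s) univ_mem
    (Eventually.of_forall fun s => (hcont s).aestronglyMeasurable.smul hw.1)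
    (hw.bdd_smul C (hcont s).aestronglyMeasurable (Eventually.of_forall fun x => hC _))
    ((hcont' s).aestronglyMeasurable.smul hw.1)
    (Eventually.of_forall fun x t _ => by
      rw [norm_smul, norm_neg, Real.norm_eq_abs]
      gcongr
      exact hC' _)
    (hw.norm.const_mul C')
    (Eventually.of_forall fun x t _ => (hasDerivAt_comp_sub hφ i x t).smul_const (w x))
  have e : (∫ x, (-partialDeriv i φ (x - s • unitVec i)) • w x)
      = -∫ x, partialDeriv i φ (x - s • unitVec i) • w x := by
    rw [← integral_neg]; simp only [neg_smul]
  rw [← e]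
  exact h.2

theorem integral_smul_translate (i : Fin N) (φ : E N → ℝ) (s : ℝ) (u : L2 N) :
    ∫ x, φ x • translate i s u x = ∫ x, φ (x - s • unitVec i) • u x := by
  have h1 : ∫ x, φ x • translate i s u x = ∫ x, φ x • u (x + s • unitVec i) := by
    refine integral_congr_ae ?_
    filter_upwards [coeFn_translate i s u] with x hx
    rw [hx]
  rw [h1, ← integral_add_right_eq_self (fun x => φ (x - s • unitVec i) • u x) (s • unitVec i)]
  simp

/-- The pairing with a test function, as a functional on `L²`. -/
def testPairing {φ : E N → ℝ} (hφ : Continuous φ) (hc : HasCompactSupport φ) : L2 N →L[ℂ] ℂ :=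
  innerSL ℂ ((hφ.memLp_of_hasCompactSupport (p := 2) (μ := (volume : Measure (E N)))
    hc).ofReal (K := ℂ)).toLp

theorem testPairing_apply {φ : E N → ℝ} (hφ : Continuous φ) (hc : HasCompactSupport φ)
    (u : L2 N) : testPairing hφ hc u = ∫ x, φ x • u x := by
  rw [testPairing, innerSL_apply_apply, L2.inner_def]
  refine integral_congr_ae ?_
  filter_upwards [((hφ.memLp_of_hasCompactSupport (p := 2) (μ := (volume : Measure (E N)))
    hc).ofReal (K := ℂ)).coeFn_toLp] with x hx
  rw [hx]
  simp [mul_comm]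

theorem eq_zero_of_integral_test {u : L2 N} (h : ∀ φ : E N → ℝ, ContDiff ℝ ∞ φ →
    HasCompactSupport φ → ∫ x, φ x • u x = 0) : u = 0 :=
  Lp.eq_zero_iff_ae_eq_zero.2 (ae_eq_zero_of_integral_contDiff_smul_eq_zero
    ((Lp.memLp u).locallyIntegrable (by norm_num)) h)

theorem exists_abs_le_of_hasCompactSupport {φ : E N → ℝ} (hφ : Continuous φ)
    (hc : HasCompactSupport φ) : ∃ C, ∀ x, |φ x| ≤ C := by
  obtain ⟨C, hC⟩ := hc.exists_bound_of_continuous hφ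
  exact ⟨C, hC⟩

theorem hasDerivAt_integral_translate {i : Fin N} {u g : L2 N} (h : HasWeakPartial i u g)
    {φ : E N → ℝ} (hφ : ContDiff ℝ ∞ φ) (hc : HasCompactSupport φ) (s : ℝ) :
    HasDerivAt (fun s => ∫ x, φ x • translate i s u x) (∫ x, φ x • translate i s g x) s := by
  have hφ1 : ContDiff ℝ 1 φ := hφ.of_le (by simp)
  obtain ⟨C, hC⟩ := exists_abs_le_of_hasCompactSupport hφ.continuous hc
  obtain ⟨C', hC'⟩ := exists_abs_le_of_hasCompactSupport (continuous_partialDeriv i hφ)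
    (hasCompactSupport_partialDeriv i hc)
  obtain ⟨R, hR⟩ := hc.isCompact.isBounded.subset_closedBall (0 : E N)
  have hsupp {ψ : E N → ℝ} (hψ : tsupport ψ ⊆ tsupport φ) {t : ℝ} (ht : |t - s| < 1) (x : E N)
      (hx : x ∉ Metric.closedBall (0 : E N) (R + |s| + 1)) : ψ (x - t • unitVec i) = 0 := by
    by_contra h0
    have h1 : x - t • unitVec i ∈ Metric.closedBall (0 : E N) R :=
      hR (hψ (subset_tsupport _ h0))
    rw [mem_closedBall_zero_iff] at h1 hx
    have h2 := norm_add_le (x - t • unitVec i) (t • unitVec i)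
    rw [sub_add_cancel, norm_smul, norm_unitVec, mul_one, Real.norm_eq_abs] at h2
    have h3 := abs_add_le (t - s) s
    rw [sub_add_cancel] at h3
    linarith
  -- A function in L² need not be integrable, so u is truncated to a ball that contains the supports
  -- of φ(· - t eᵢ) for all |t - s| < 1.
  set w : E N → ℂ := (Metric.closedBall (0 : E N) (R + |s| + 1)).indicator u with hw
  have hwint : Integrable w := by
    rw [hw, integrable_indicator_iff Metric.isClosed_closedBall.measurableSet]
    exact ((Lp.memLp u).locallyIntegrable (by norm_num)).integrableOn_isCompact
      (isCompact_closedBall _ _)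
  have hcongr {ψ : E N → ℝ} (hψ : tsupport ψ ⊆ tsupport φ) {t : ℝ} (ht : |t - s| < 1) :
      ∫ x, ψ (x - t • unitVec i) • u x = ∫ x, ψ (x - t • unitVec i) • w x := by
    refine integral_congr_ae (Eventually.of_forall fun x => ?_)
    by_cases hx : x ∈ Metric.closedBall (0 : E N) (R + |s| + 1)
    · simp only [hw, Set.indicator_of_mem hx]
    · simp only [hsupp hψ ht x hx, zero_smul]
  have hd := hasDerivAt_integral_shift hφ1 i hC hC' hwint s
  have hsub : tsupport (partialDeriv i φ) ⊆ tsupport φ := tsupport_fderiv_apply_subset ℝ _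
  rw [← hcongr hsub (by simp)] at hd
  have e : -∫ x, partialDeriv i φ (x - s • unitVec i) • u x = ∫ x, φ x • translate i s g x := by
    have h1 := h (fun x => φ (x - s • unitVec i)) (hφ.comp (by fun_prop))
      (hc.comp_homeomorph (Homeomorph.subRight (s • unitVec i)))
    have h2 (x : E N) : partialDeriv i (fun x => φ (x - s • unitVec i)) x
        = partialDeriv i φ (x - s • unitVec i) := by
      simp only [partialDeriv, fderiv_comp_sub]
    simp only [h2] at h1
    rw [h1, neg_neg, integral_smul_translate]
  rw [e] at hd
  refine hd.congr_of_eventuallyEq ?_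
  filter_upwards [Metric.ball_mem_nhds s one_pos] with t ht
  rw [Metric.mem_ball, Real.dist_eq] at ht
  rw [integral_smul_translate, hcongr subset_rfl ht]

/-- Paired with a test function, this is the scalar fundamental theorem of calculus; test functions
separate L². -/
theorem translate_sub_eq_integral {i : Fin N} {u g : L2 N} (h : HasWeakPartial i u g) (s : ℝ) :
    translate i s u - u = ∫ r in (0 : ℝ)..s, translate i r g := by
  rw [← sub_eq_zero]
  refine eq_zero_of_integral_test fun φ hφ hc => ?_
  rw [← testPairing_apply hφ.continuous hc, map_sub, map_sub,
    ← ContinuousLinearMap.intervalIntegral_comp_comm _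
      ((continuous_translate i g).intervalIntegrable _ _)]
  have hd (r : ℝ) : HasDerivAt (fun s => testPairing hφ.continuous hc (translate i s u))
      (testPairing hφ.continuous hc (translate i r g)) r := by
    simp only [testPairing_apply]
    exact hasDerivAt_integral_translate h hφ hc r
  rw [intervalIntegral.integral_eq_sub_of_hasDerivAt (fun r _ => hd r)
    (((testPairing hφ.continuous hc).continuous.comp
      (continuous_translate i g)).intervalIntegrable _ _), translate_zero, sub_self]

/-- The weak derivative in `L²` is the strong derivative of the translation group. -/
theorem hasDerivAt_translate {i : Fin N} {u g : L2 N} (h : HasWeakPartial i u g) :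
    HasDerivAt (fun s => translate i s u) g 0 := by
  have hc := continuous_translate i g
  have h1 := intervalIntegral.integral_hasDerivAt_right (hc.intervalIntegrable 0 0)
    (hc.stronglyMeasurableAtFilter _ _) hc.continuousAt
  rw [translate_zero] at h1
  have e : (fun s => translate i s u) = fun s => u + ∫ r in (0 : ℝ)..s, translate i r g := by
    funext s
    rw [← translate_sub_eq_integral h, add_sub_cancel]
  rw [e]
  exact h1.const_add u

/-! ### Bounded multiplication operators and the product rule for |u|². -/

theorem memLp_bounded_mul {φ : E N → ℝ} (hφ : Continuous φ) {C : ℝ} (hC : ∀ x, |φ x| ≤ C)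
    (u : L2 N) : MemLp (fun x => (φ x : ℂ) * u x) 2 volume :=
  (Lp.memLp u).of_le_mul (c := C)
    ((Complex.continuous_ofReal.comp hφ).aestronglyMeasurable.mul (Lp.memLp u).1)
    (Eventually.of_forall fun x => by
      rw [norm_mul, Complex.norm_real]
      exact mul_le_mul_of_nonneg_right (hC x) (norm_nonneg _))

/-- Multiplication by a bounded continuous function on `L²`. -/
def mulBounded {φ : E N → ℝ} (hφ : Continuous φ) {C : ℝ} (hC : ∀ x, |φ x| ≤ C) :
    L2 N →L[ℂ] L2 N :=
  have hm := memLp_bounded_mul hφ hC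
  LinearMap.mkContinuous
    { toFun := fun u => (hm u).toLp
      map_add' := fun u v => by
        refine Lp.ext ?_
        filter_upwards [(hm (u + v)).coeFn_toLp, (hm u).coeFn_toLp, (hm v).coeFn_toLp,
          Lp.coeFn_add u v, Lp.coeFn_add (hm u).toLp (hm v).toLp] with x h1 h2 h3 h4 h5
        rw [h1, h5, Pi.add_apply, h2, h3, h4, Pi.add_apply, mul_add]
      map_smul' := fun k u => by
        refine Lp.ext ?_
        filter_upwards [(hm (k • u)).coeFn_toLp, (hm u).coeFn_toLp,
          Lp.coeFn_smul k u, Lp.coeFn_smul k (hm u).toLp] with x h1 h2 h3 h4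
        rw [h1, RingHom.id_apply, h4, Pi.smul_apply, h2, h3, Pi.smul_apply, smul_eq_mul,
          smul_eq_mul]
        ring } C
    (fun u => by
      refine Lp.norm_le_mul_norm_of_ae_le_mul ?_
      filter_upwards [(hm u).coeFn_toLp] with x hx
      rw [LinearMap.coe_mk, AddHom.coe_mk, hx, norm_mul, Complex.norm_real]
      exact mul_le_mul_of_nonneg_right (hC x) (norm_nonneg _))

theorem coeFn_mulBounded {φ : E N → ℝ} (hφ : Continuous φ) {C : ℝ} (hC : ∀ x, |φ x| ≤ C)
    (u : L2 N) : mulBounded hφ hC u =ᵐ[volume] fun x => (φ x : ℂ) * u x :=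
  (memLp_bounded_mul hφ hC u).coeFn_toLp

theorem inner_mulBounded {φ : E N → ℝ} (hφ : Continuous φ) {C : ℝ} (hC : ∀ x, |φ x| ≤ C)
    (u v : L2 N) : inner ℂ u (mulBounded hφ hC v) = ∫ x, φ x • (conj (u x) * v x) := by
  rw [L2.inner_def]
  refine integral_congr_ae ?_
  filter_upwards [coeFn_mulBounded hφ hC v] with x hx
  rw [hx, RCLike.inner_apply, Complex.real_smul]
  ring

theorem integrable_conj_mul (u v : L2 N) : Integrable (fun x => conj (u x) * v x) := by
  simpa only [mul_comm] using integrable_mul_conj (Lp.memLp v) (Lp.memLp u)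

/-- The product rule for `|u|²`, tested against a bounded function with bounded derivative. -/
theorem integral_partialDeriv_mul_norm_sq {i : Fin N} {u g : L2 N} (h : HasWeakPartial i u g)
    {φ : E N → ℝ} (hφ : ContDiff ℝ 1 φ) {C C' : ℝ} (hC : ∀ x, |φ x| ≤ C)
    (hC' : ∀ x, |partialDeriv i φ x| ≤ C') :
    ∫ x, partialDeriv i φ x * ‖u x‖ ^ 2 = -(2 * ∫ x, φ x * (conj (u x) * g x).re) := by
  set A := mulBounded hφ.continuous hC
  -- The function s ↦ ∫ φ |u(· + s eᵢ)|² is differentiated at 0 twice: here through u as a curve in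
  -- L², and in `hd2` through φ after a change of variables. Equating the two is the product rule.
  have hd1 : HasDerivAt (fun s => inner ℂ (translate i s u) (A (translate i s u)))
      (inner ℂ u (A g) + inner ℂ g (A u)) 0 := by
    have h1 := hasDerivAt_translate h
    have h2 := (A.restrictScalars ℝ).hasFDerivAt.comp_hasDerivAt (0 : ℝ) h1
    have h3 := h1.inner ℂ h2
    simp only [translate_zero, Function.comp_def] at h3
    exact h3
  have hint : Integrable (fun x => conj (u x) * u x) := integrable_conj_mul u u
  have e (s : ℝ) : inner ℂ (translate i s u) (A (translate i s u))
      = ∫ x, φ (x - s • unitVec i) • (conj (u x) * u x) := by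
    rw [inner_mulBounded]
    have h1 : ∫ x, φ x • (conj (translate i s u x) * translate i s u x)
        = ∫ x, φ x • (conj (u (x + s • unitVec i)) * u (x + s • unitVec i)) := by
      refine integral_congr_ae ?_
      filter_upwards [coeFn_translate i s u] with x hx
      rw [hx]
    rw [h1, ← integral_add_right_eq_self
      (fun x => φ (x - s • unitVec i) • (conj (u x) * u x)) (s • unitVec i)]
    simp
  simp only [e] at hd1
  have hd2 := hasDerivAt_integral_shift hφ i hC hC' hint 0
  have h3 := hd2.unique hd1
  rw [inner_mulBounded, inner_mulBounded] at h3
  have i1 (v w : L2 N) : Integrable (fun x => φ x • (conj (v x) * w x)) :=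
    (integrable_conj_mul v w).bdd_smul C hφ.continuous.aestronglyMeasurable
      (Eventually.of_forall hC)
  have i2 : Integrable (fun x => partialDeriv i φ x • (conj (u x) * u x)) :=
    hint.bdd_smul C' (continuous_partialDeriv_of_contDiff_one i hφ).aestronglyMeasurable
      (Eventually.of_forall hC')
  have h4 := congrArg Complex.re h3
  simp only [zero_smul, sub_zero] at h4
  rw [Complex.neg_re, Complex.add_re] at h4
  have re_int {F : E N → ℂ} (hF : Integrable F) : (∫ x, F x).re = ∫ x, (F x).re :=
    (integral_re hF).symm
  rw [re_int i2, re_int (i1 u g), re_int (i1 g u)] at h4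
  have e1 (x : E N) : (partialDeriv i φ x • (conj (u x) * u x)).re
      = partialDeriv i φ x * ‖u x‖ ^ 2 := by
    rw [Complex.smul_re, ← Complex.normSq_eq_conj_mul_self, Complex.ofReal_re,
      Complex.normSq_eq_norm_sq, smul_eq_mul]
  have e2 (x : E N) : (φ x • (conj (u x) * g x)).re = φ x * (conj (u x) * g x).re := by
    rw [Complex.smul_re, smul_eq_mul]
  have e3 (x : E N) : (φ x • (conj (g x) * u x)).re = φ x * (conj (u x) * g x).re := by
    rw [Complex.smul_re, smul_eq_mul]
    congr 1
    simp only [Complex.mul_re, Complex.conj_re, Complex.conj_im]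
    ring
  simp only [e1, e2, e3] at h4
  linarith

end Translation

/-! ### Radial vector fields: the Hardy inequality and the drift term -/

section Radial

variable {N : ℕ}

/-- Profiles are functions of |x|² rather than of |x|, so that the field is differentiable at the
origin too. -/
theorem partialDeriv_radial {f f' : ℝ → ℝ} (hf' : ∀ t, 0 ≤ t → HasDerivAt f (f' t) t) (i : Fin N)
    (x : E N) : partialDeriv i (fun x => f (‖x‖ ^ 2) * x i) x
      = f (‖x‖ ^ 2) + 2 * x i ^ 2 * f' (‖x‖ ^ 2) := by
  have h1 : HasFDerivAt (fun x : E N => ‖x‖ ^ 2) (2 • innerSL ℝ x) x :=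
    (hasStrictFDerivAt_norm_sq x).hasFDerivAt
  have h2 := (hf' (‖x‖ ^ 2) (by positivity)).comp_hasFDerivAt x h1
  have h3 : HasFDerivAt (fun x : E N => x i) (EuclideanSpace.proj i : E N →L[ℝ] ℝ) x :=
    (EuclideanSpace.proj i : E N →L[ℝ] ℝ).hasFDerivAt
  have h4 : partialDeriv i (fun x => f (‖x‖ ^ 2) * x i) x = _ :=
    congrArg (fun L : E N →L[ℝ] ℝ => L (unitVec i)) (h2.mul h3).fderiv
  rw [h4]
  simp [EuclideanSpace.inner_single_right]
  ring

theorem abs_coord_le (x : E N) (i : Fin N) : |x i| ≤ ‖x‖ := by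
  simpa using PiLp.norm_apply_le x i

theorem sum_coord_sq (x : E N) : ∑ i, x i ^ 2 = ‖x‖ ^ 2 := by
  rw [EuclideanSpace.real_norm_sq_eq]

theorem integrable_norm_sq (u : L2 N) : Integrable fun x => ‖u x‖ ^ 2 :=
  (memLp_two_iff_integrable_sq_norm (Lp.memLp u).1).1 (Lp.memLp u)

/-- The divergence theorem for the field `f(|x|²) x` and the density `|u|²`. -/
theorem integral_radial {u : L2 N} {g : Fin N → L2 N} (h : ∀ i, HasWeakPartial i u (g i))
    {f f' : ℝ → ℝ} (hf : ContDiff ℝ 1 fun x : E N => f (‖x‖ ^ 2))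
    (hf' : ∀ t, 0 ≤ t → HasDerivAt f (f' t) t) {C : ℝ} (h0 : ∀ t, 0 ≤ t → |f t| ≤ C)
    (h1 : ∀ x : E N, |f (‖x‖ ^ 2)| * ‖x‖ ≤ C) (h2 : ∀ t, 0 ≤ t → t * |f' t| ≤ C) :
    Integrable (fun x => (N * f (‖x‖ ^ 2) + 2 * ‖x‖ ^ 2 * f' (‖x‖ ^ 2)) * ‖u x‖ ^ 2) ∧
    Integrable (fun x => f (‖x‖ ^ 2) * ∑ i, x i * (conj (u x) * g i x).re) ∧
    ∫ x, (N * f (‖x‖ ^ 2) + 2 * ‖x‖ ^ 2 * f' (‖x‖ ^ 2)) * ‖u x‖ ^ 2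
      = -(2 * ∫ x, f (‖x‖ ^ 2) * ∑ i, x i * (conj (u x) * g i x).re) := by
  have hcont (i : Fin N) : ContDiff ℝ 1 fun x : E N => f (‖x‖ ^ 2) * x i :=
    hf.mul (by fun_prop)
  have hb (i : Fin N) (x : E N) : |f (‖x‖ ^ 2) * x i| ≤ C := by
    rw [abs_mul]
    exact (mul_le_mul_of_nonneg_left (abs_coord_le x i) (abs_nonneg _)).trans (h1 x)
  -- One C bounds f, and 2C bounds 2xᵢ²f'.
  have hb' (i : Fin N) (x : E N) : |partialDeriv i (fun x => f (‖x‖ ^ 2) * x i) x| ≤ 3 * C := by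
    rw [partialDeriv_radial hf']
    have e1 := h0 (‖x‖ ^ 2) (by positivity)
    have e2 := h2 (‖x‖ ^ 2) (by positivity)
    have e3 : |2 * x i ^ 2 * f' (‖x‖ ^ 2)| ≤ 2 * (‖x‖ ^ 2 * |f' (‖x‖ ^ 2)|) := by
      rw [abs_mul, abs_mul, abs_two, abs_of_nonneg (sq_nonneg (x i)), mul_assoc]
      have : x i ^ 2 ≤ ‖x‖ ^ 2 := by
        rw [← sq_abs (x i)]
        have := abs_coord_le x i
        gcongr
      gcongr
    have e4 := abs_add_le (f (‖x‖ ^ 2)) (2 * x i ^ 2 * f' (‖x‖ ^ 2))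
    linarith
  have hi1 (i : Fin N) : Integrable fun x =>
      partialDeriv i (fun x => f (‖x‖ ^ 2) * x i) x * ‖u x‖ ^ 2 :=
    (integrable_norm_sq u).bdd_smul (3 * C)
      (continuous_partialDeriv_of_contDiff_one i (hcont i)).aestronglyMeasurable
      (Eventually.of_forall (hb' i))
  have hi2 (i : Fin N) : Integrable fun x =>
      (f (‖x‖ ^ 2) * x i) * (conj (u x) * g i x).re :=
    (integrable_conj_mul u (g i)).re.bdd_smul C (hcont i).continuous.aestronglyMeasurable
      (Eventually.of_forall (hb i))
  have key (i : Fin N) := integral_partialDeriv_mul_norm_sq (h i) (hcont i) (hb i) (hb' i)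
  have hs := Finset.sum_congr rfl fun i (_ : i ∈ Finset.univ) => key i
  rw [← integral_finsetSum _ fun i _ => hi1 i, Finset.sum_neg_distrib, ← Finset.mul_sum,
    ← integral_finsetSum _ fun i _ => hi2 i] at hs
  have e1 (x : E N) : (N * f (‖x‖ ^ 2) + 2 * ‖x‖ ^ 2 * f' (‖x‖ ^ 2)) * ‖u x‖ ^ 2
      = ∑ i, partialDeriv i (fun x => f (‖x‖ ^ 2) * x i) x * ‖u x‖ ^ 2 := by
    rw [← Finset.sum_mul]
    simp only [partialDeriv_radial hf', Finset.sum_add_distrib, ← Finset.sum_mul,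
      ← Finset.mul_sum, sum_coord_sq]
    simp
  have e2 (x : E N) : f (‖x‖ ^ 2) * ∑ i, x i * (conj (u x) * g i x).re
      = ∑ i, (f (‖x‖ ^ 2) * x i) * (conj (u x) * g i x).re := by
    simp only [Finset.mul_sum, mul_assoc]
  simp only [e1, e2]
  exact ⟨integrable_finsetSum _ fun i _ => hi1 i, integrable_finsetSum _ fun i _ => hi2 i, hs⟩

theorem ae_ne_zero (hN : 3 ≤ N) : ∀ᵐ x : E N, x ≠ 0 := by
  have : Nonempty (Fin N) := ⟨⟨0, by omega⟩⟩
  exact Measure.ae_ne volume 0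

/-- Fatou's lemma for real functions with bounded integrals. -/
theorem integrable_and_integral_le_of_tendsto {F : ℕ → E N → ℝ} {G : E N → ℝ} {C : ℝ}
    (hF : ∀ n, Integrable (F n)) (h0 : ∀ n x, 0 ≤ F n x) (hC : ∀ n, ∫ x, F n x ≤ C)
    (hG : ∀ᵐ x, Tendsto (fun n => F n x) atTop (𝓝 (G x))) :
    Integrable G ∧ ∫ x, G x ≤ C := by
  have hm : AEStronglyMeasurable G (volume : Measure (E N)) :=
    aestronglyMeasurable_of_tendsto_ae atTop (fun n => (hF n).1) hG
  have hG0 : 0 ≤ᵐ[volume] G := by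
    filter_upwards [hG] with x hx
    exact ge_of_tendsto' hx fun n => h0 n x
  have hC0 : 0 ≤ C := (integral_nonneg (h0 0)).trans (hC 0)
  have hle : ∫⁻ x, ENNReal.ofReal (G x) ≤ ENNReal.ofReal C := by
    have e : ∫⁻ x, ENNReal.ofReal (G x)
        = ∫⁻ x, liminf (fun n => ENNReal.ofReal (F n x)) atTop := by
      refine lintegral_congr_ae ?_
      filter_upwards [hG] with x hx
      exact ((ENNReal.continuous_ofReal.tendsto _).comp hx).liminf_eq.symm
    rw [e]
    refine (lintegral_liminf_le' fun n => (hF n).1.aemeasurable.ennreal_ofReal).trans ?_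
    refine liminf_le_of_le (by isBoundedDefault) fun b hb => ?_
    obtain ⟨n, hn⟩ := hb.exists
    refine hn.trans ?_
    rw [← ofReal_integral_eq_lintegral_ofReal (hF n) (Eventually.of_forall (h0 n))]
    exact ENNReal.ofReal_le_ofReal (hC n)
  have hint : Integrable G := by
    refine ⟨hm, ?_⟩
    rw [hasFiniteIntegral_iff_ofReal hG0]
    exact hle.trans_lt ENNReal.ofReal_lt_top
  refine ⟨hint, ?_⟩
  rw [← ofReal_integral_eq_lintegral_ofReal hint hG0] at hle
  exact (ENNReal.ofReal_le_ofReal_iff hC0).1 hle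

theorem two_mul_mul_le {k : ℝ} (hk : 0 < k) (a b : ℝ) :
    2 * (a * b) ≤ k * a ^ 2 + k⁻¹ * b ^ 2 := by
  have h1 : k * a ^ 2 + k⁻¹ * b ^ 2 - 2 * (a * b) = k * (a - k⁻¹ * b) ^ 2 := by
    field_simp
    ring
  have h2 : 0 ≤ k * (a - k⁻¹ * b) ^ 2 := by positivity
  linarith

/-- The field x/(|x|²+δ) has divergence at least (N-2)/(|x|²+δ) = 2k/(|x|²+δ) with k = (N-2)/2. The
divergence theorem and Young's inequality absorb half of this, leaving k∫|u|²/(|x|²+δ) ≤ k⁻¹∫|∇u|².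
-/
theorem hardy_regularized (hN : 3 ≤ N) {u : L2 N} {g : Fin N → L2 N}
    (h : ∀ i, HasWeakPartial i u (g i)) {δ : ℝ} (hδ : 0 < δ) :
    Integrable (fun x : E N => (‖x‖ ^ 2 + δ)⁻¹ * ‖u x‖ ^ 2) ∧
    (((N : ℝ) - 2) / 2) ^ 2 * ∫ x : E N, (‖x‖ ^ 2 + δ)⁻¹ * ‖u x‖ ^ 2
      ≤ ∫ x, ∑ i, ‖g i x‖ ^ 2 := by
  have hpos (x : E N) : 0 < ‖x‖ ^ 2 + δ := by positivity
  have hδle (t : ℝ) (ht : 0 ≤ t) : (t + δ)⁻¹ ≤ δ⁻¹ := by gcongr; linarith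
  have hcont : ContDiff ℝ 1 fun x : E N => (‖x‖ ^ 2 + δ)⁻¹ :=
    ((contDiff_norm_sq ℝ).add contDiff_const).inv fun x => (hpos x).ne'
  have hδ0 : 0 < δ⁻¹ := by positivity
  obtain ⟨i3, i4, hid⟩ := integral_radial h (f := fun t => (t + δ)⁻¹) (f' := fun t => -1 / (t + δ) ^ 2)
    (C := 1 + δ⁻¹) hcont
    (fun t ht => by
      have h1 : HasDerivAt (fun t : ℝ => t + δ) 1 t := (hasDerivAt_id t).add_const δ
      exact h1.fun_inv (by positivity))
    (fun t ht => by
      rw [abs_of_pos (by positivity)]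
      linarith [hδle t ht])
    (fun x => by
      rw [abs_of_pos (by positivity)]
      have e1 : ‖x‖ ≤ ‖x‖ ^ 2 + δ + 1 := by nlinarith [sq_nonneg (‖x‖ - 1)]
      calc (‖x‖ ^ 2 + δ)⁻¹ * ‖x‖ ≤ (‖x‖ ^ 2 + δ)⁻¹ * (‖x‖ ^ 2 + δ + 1) := by
            gcongr
        _ = 1 + (‖x‖ ^ 2 + δ)⁻¹ := by
          rw [mul_add, inv_mul_cancel₀ (hpos x).ne', mul_one]
        _ ≤ 1 + δ⁻¹ := by
          have := hδle (‖x‖ ^ 2) (by positivity)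
          linarith)
    (fun t ht => by
      have e0 : 0 < t + δ := by positivity
      rw [abs_div, abs_neg, abs_one, abs_of_pos (by positivity)]
      have e1 : t * (1 / (t + δ) ^ 2) ≤ (t + δ) * (1 / (t + δ) ^ 2) := by gcongr; linarith
      have e2 : (t + δ) * (1 / (t + δ) ^ 2) = (t + δ)⁻¹ := by field_simp
      linarith [hδle t ht])
  set k : ℝ := ((N : ℝ) - 2) / 2 with hk
  have hN' : (3 : ℝ) ≤ N := by exact_mod_cast hN
  have hk0 : 0 < k := by rw [hk]; linarith
  have i1 : Integrable fun x : E N => (‖x‖ ^ 2 + δ)⁻¹ * ‖u x‖ ^ 2 :=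
    (integrable_norm_sq u).bdd_smul δ⁻¹ hcont.continuous.aestronglyMeasurable
      (Eventually.of_forall fun x => by
        rw [Real.norm_eq_abs, abs_of_pos (by positivity)]
        exact hδle _ (by positivity))
  have i2 : Integrable fun x => ∑ i, ‖g i x‖ ^ 2 :=
    integrable_finsetSum _ fun i _ => integrable_norm_sq (g i)
  refine ⟨i1, ?_⟩
  have hlow : 2 * k * ∫ x : E N, (‖x‖ ^ 2 + δ)⁻¹ * ‖u x‖ ^ 2 ≤
      ∫ x : E N, (N * (‖x‖ ^ 2 + δ)⁻¹ + 2 * ‖x‖ ^ 2 * (-1 / (‖x‖ ^ 2 + δ) ^ 2)) * ‖u x‖ ^ 2 := by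
    have hdiv (x : E N) : 2 * k * (‖x‖ ^ 2 + δ)⁻¹ ≤
        N * (‖x‖ ^ 2 + δ)⁻¹ + 2 * ‖x‖ ^ 2 * (-1 / (‖x‖ ^ 2 + δ) ^ 2) ∧
        N * (‖x‖ ^ 2 + δ)⁻¹ + 2 * ‖x‖ ^ 2 * (-1 / (‖x‖ ^ 2 + δ) ^ 2) ≤ N * (‖x‖ ^ 2 + δ)⁻¹ := by
      have e0 := hpos x
      have e1 : ‖x‖ ^ 2 * (1 / (‖x‖ ^ 2 + δ) ^ 2) ≤ (‖x‖ ^ 2 + δ) * (1 / (‖x‖ ^ 2 + δ) ^ 2) := by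
        gcongr; linarith
      have e2 : (‖x‖ ^ 2 + δ) * (1 / (‖x‖ ^ 2 + δ) ^ 2) = (‖x‖ ^ 2 + δ)⁻¹ := by field_simp
      have e3 : 2 * ‖x‖ ^ 2 * (-1 / (‖x‖ ^ 2 + δ) ^ 2)
          = -(2 * (‖x‖ ^ 2 * (1 / (‖x‖ ^ 2 + δ) ^ 2))) := by ring
      have e4 : 2 * k * (‖x‖ ^ 2 + δ)⁻¹ = N * (‖x‖ ^ 2 + δ)⁻¹ - 2 * (‖x‖ ^ 2 + δ)⁻¹ := by
        rw [hk]; ring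
      have e5 : 0 ≤ ‖x‖ ^ 2 * (1 / (‖x‖ ^ 2 + δ) ^ 2) := by positivity
      constructor <;> linarith
    rw [← integral_const_mul]
    refine integral_mono (i1.const_mul _) i3 fun x => ?_
    have := mul_le_mul_of_nonneg_right (hdiv x).1 (sq_nonneg ‖u x‖)
    simpa only [mul_assoc] using this
  have hup : -(2 * ∫ x : E N, (‖x‖ ^ 2 + δ)⁻¹ * ∑ i, x i * (conj (u x) * g i x).re) ≤
      k * (∫ x : E N, (‖x‖ ^ 2 + δ)⁻¹ * ‖u x‖ ^ 2) + k⁻¹ * ∫ x, ∑ i, ‖g i x‖ ^ 2 := by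
    rw [← integral_const_mul, ← integral_const_mul, ← integral_const_mul,
      ← integral_add (i1.const_mul k) (i2.const_mul k⁻¹), ← integral_neg]
    refine integral_mono (i4.const_mul 2).neg ((i1.const_mul k).add (i2.const_mul k⁻¹)) fun x => ?_
    set F := (‖x‖ ^ 2 + δ)⁻¹ with hF
    have hF0 : 0 < F := inv_pos.2 (hpos x)
    have hFx : F * ‖x‖ ^ 2 ≤ 1 := by
      rw [hF, inv_mul_le_iff₀ (hpos x)]; linarith
    have hterm (i : Fin N) : -(2 * (F * (x i * (conj (u x) * g i x).re))) ≤
        k * (F ^ 2 * x i ^ 2 * ‖u x‖ ^ 2) + k⁻¹ * ‖g i x‖ ^ 2 := by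
      have e1 : |(conj (u x) * g i x).re| ≤ ‖u x‖ * ‖g i x‖ := by
        refine (Complex.abs_re_le_norm _).trans ?_
        rw [norm_mul, RCLike.norm_conj]
      have e2 : -(F * (x i * (conj (u x) * g i x).re)) ≤ (F * |x i| * ‖u x‖) * ‖g i x‖ := by
        refine (neg_le_abs _).trans ?_
        rw [abs_mul, abs_mul, abs_of_pos hF0]
        calc F * (|x i| * |(conj (u x) * g i x).re|) ≤ F * (|x i| * (‖u x‖ * ‖g i x‖)) := by gcongr
          _ = _ := by ring
      -- A Young weight s would give the constant (2k - s)s, which is largest, equal to k², at s =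
      -- k.
      have e3 := two_mul_mul_le hk0 (F * |x i| * ‖u x‖) ‖g i x‖
      have e4 : (F * |x i| * ‖u x‖) ^ 2 = F ^ 2 * x i ^ 2 * ‖u x‖ ^ 2 := by
        rw [mul_pow, mul_pow, sq_abs]
      rw [e4] at e3
      linarith
    have hsum := Finset.sum_le_sum fun i (_ : i ∈ Finset.univ) => hterm i
    rw [Finset.sum_neg_distrib, ← Finset.mul_sum, ← Finset.mul_sum, Finset.sum_add_distrib,
      ← Finset.mul_sum, ← Finset.mul_sum, ← Finset.sum_mul, ← Finset.mul_sum, sum_coord_sq] at hsum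
    refine hsum.trans ?_
    have e5 : F ^ 2 * ‖x‖ ^ 2 * ‖u x‖ ^ 2 ≤ F * ‖u x‖ ^ 2 := by
      calc F ^ 2 * ‖x‖ ^ 2 * ‖u x‖ ^ 2 = (F * ‖x‖ ^ 2) * (F * ‖u x‖ ^ 2) := by ring
        _ ≤ 1 * (F * ‖u x‖ ^ 2) := by gcongr
        _ = _ := one_mul _
    have e6 := mul_le_mul_of_nonneg_left e5 hk0.le
    linarith
  rw [← hid] at hup
  have h3 : k * (∫ x : E N, (‖x‖ ^ 2 + δ)⁻¹ * ‖u x‖ ^ 2) ≤ k⁻¹ * ∫ x, ∑ i, ‖g i x‖ ^ 2 := by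
    linarith
  calc k ^ 2 * ∫ x : E N, (‖x‖ ^ 2 + δ)⁻¹ * ‖u x‖ ^ 2
      = k * (k * ∫ x : E N, (‖x‖ ^ 2 + δ)⁻¹ * ‖u x‖ ^ 2) := by ring
    _ ≤ k * (k⁻¹ * ∫ x, ∑ i, ‖g i x‖ ^ 2) := by gcongr
    _ = _ := by rw [← mul_assoc, mul_inv_cancel₀ hk0.ne', one_mul]

/-- The Hardy inequality in `H¹(ℝᴺ)`. -/
theorem hardy (hN : 3 ≤ N) {u : L2 N} {g : Fin N → L2 N} (h : ∀ i, HasWeakPartial i u (g i)) :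
    Integrable (fun x : E N => (((N : ℝ) - 2) / 2) ^ 2 * ((‖x‖ ^ 2)⁻¹ * ‖u x‖ ^ 2)) ∧
    ∫ x : E N, (((N : ℝ) - 2) / 2) ^ 2 * ((‖x‖ ^ 2)⁻¹ * ‖u x‖ ^ 2) ≤ ∫ x, ∑ i, ‖g i x‖ ^ 2 := by
  have hδ (n : ℕ) : 0 < 1 / ((n : ℝ) + 1) := by positivity
  refine integrable_and_integral_le_of_tendsto
    (F := fun n x => (((N : ℝ) - 2) / 2) ^ 2 * ((‖x‖ ^ 2 + 1 / ((n : ℝ) + 1))⁻¹ * ‖u x‖ ^ 2))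
    (fun n => (hardy_regularized hN h (hδ n)).1.const_mul _) (fun n x => by positivity)
    (fun n => by
      rw [integral_const_mul]
      exact (hardy_regularized hN h (hδ n)).2) ?_
  filter_upwards [ae_ne_zero hN] with x hx
  refine Tendsto.const_mul _ (Tendsto.mul_const _ ?_)
  refine Tendsto.inv₀ ?_ (by positivity)
  simpa using tendsto_one_div_add_atTop_nhds_zero_nat.const_add (‖x‖ ^ 2)

/-! ### The singular drift term. -/

variable {α β : ℝ}

theorem hasWeakPartial_weakGrad (i : Fin N) (u : sobolevH1 N) :
    HasWeakPartial i (u : L2 N) (weakGrad i u) := by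
  rw [← mem_graph_weakPartial]
  exact (weakPartial i).mem_graph (Submodule.inclusion (iInf_le _ i) u)

theorem hasWeakPartial_grad (i : Fin N) (u : formDomain N α β) :
    HasWeakPartial i (u : L2 N) (grad i u) :=
  hasWeakPartial_weakGrad i (⟨u, u.2.1⟩ : sobolevH1 N)

theorem integrable_weight_norm_sq {w : E N → ℝ} (hw : ∀ x, 0 ≤ w x) {f : L2 N}
    (hf : f ∈ weightedL2 fun x => √(w x)) : Integrable fun x => w x * ‖f x‖ ^ 2 := by
  refine (integrable_weight hw hf hf).re.congr (Eventually.of_forall fun x => ?_)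
  simp only [mul_assoc, Complex.mul_conj, Complex.normSq_eq_norm_sq]
  rw [← Complex.ofReal_mul]
  exact Complex.ofReal_re _

/-- The regularization of `t ↦ t ^ p`. -/
def powReg (p δ t : ℝ) : ℝ := (t + δ) ^ p * (1 + δ * t)⁻¹

/-- In `powReg` the shift by δ removes the singularity at 0 and the factor (1+δt)⁻¹ gives decay at
infinity, so at t = |x|² the corresponding radial field is bounded. The derivative is kept as the
function times its logarithmic derivative. -/
theorem hasDerivAt_powReg {p δ t : ℝ} (hδ : 0 < δ) (ht : 0 ≤ t) :
    HasDerivAt (powReg p δ) (powReg p δ t * (p / (t + δ) - δ / (1 + δ * t))) t := by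
  have h0 : 0 < t + δ := by positivity
  have h0' : 0 < 1 + δ * t := by positivity
  have h1 : HasDerivAt (fun t : ℝ => t + δ) 1 t := (hasDerivAt_id t).add_const δ
  have h2 := h1.rpow_const (p := p) (Or.inl h0.ne')
  have h3 : HasDerivAt (fun t : ℝ => 1 + δ * t) δ t := by
    simpa using ((hasDerivAt_id t).const_mul δ).const_add 1
  have h4 := h2.mul (h3.fun_inv h0'.ne')
  refine h4.congr_deriv ?_
  rw [powReg, Real.rpow_sub_one h0.ne']
  field_simp
  ring

theorem powReg_pos {p δ t : ℝ} (hδ : 0 < δ) (ht : 0 ≤ t) : 0 < powReg p δ t := by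
  unfold powReg; positivity

theorem powReg_le {p δ t : ℝ} (hp : p ≤ 0) (hδ : 0 < δ) (ht : 0 ≤ t) : powReg p δ t ≤ δ ^ p := by
  have h1 : (t + δ) ^ p ≤ δ ^ p := Real.rpow_le_rpow_of_nonpos hδ (by linarith) hp
  have h2 : (1 + δ * t)⁻¹ ≤ 1 := inv_le_one_of_one_le₀ (by nlinarith)
  calc powReg p δ t ≤ (t + δ) ^ p * 1 := by unfold powReg; gcongr
    _ ≤ _ := by rwa [mul_one]

theorem powReg_le_rpow {p δ t : ℝ} (hp : p ≤ 0) (hδ : 0 < δ) (ht : 0 < t) :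
    powReg p δ t ≤ t ^ p := by
  have h1 : (t + δ) ^ p ≤ t ^ p := Real.rpow_le_rpow_of_nonpos ht (by linarith) hp
  have h2 : (1 + δ * t)⁻¹ ≤ 1 := inv_le_one_of_one_le₀ (by nlinarith)
  calc powReg p δ t ≤ (t + δ) ^ p * 1 := by unfold powReg; gcongr
    _ ≤ _ := by rwa [mul_one]

/-- Both t/(t+δ) and δt/(1+δt) lie in [0,1]. The bound is free of δ, as dominated convergence
requires. -/
theorem abs_mul_log_deriv_powReg_le {p δ t : ℝ} (hp : -1 ≤ p) (hp0 : p ≤ 0) (hδ : 0 < δ)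
    (ht : 0 ≤ t) : |t * (p / (t + δ) - δ / (1 + δ * t))| ≤ 2 := by
  have h1 : 0 ≤ t / (t + δ) := by positivity
  have h2 : t / (t + δ) ≤ 1 := by rw [div_le_one (by positivity)]; linarith
  have h3 : 0 ≤ δ * t / (1 + δ * t) := by positivity
  have h4 : δ * t / (1 + δ * t) ≤ 1 := by rw [div_le_one (by positivity)]; linarith
  have e : t * (p / (t + δ) - δ / (1 + δ * t)) = p * (t / (t + δ)) - δ * t / (1 + δ * t) := by ring
  rw [e, abs_le]
  constructor <;> nlinarith

theorem tendsto_powReg {p t : ℝ} (ht : 0 < t) :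
    Tendsto (fun δ => powReg p δ t) (𝓝 0) (𝓝 (t ^ p)) := by
  have h1 : ContinuousAt (fun δ => powReg p δ t) 0 := by
    unfold powReg
    refine ContinuousAt.mul (ContinuousAt.rpow_const (by fun_prop) (Or.inl (by simpa using ht.ne')))
      (ContinuousAt.inv₀ (by fun_prop) (by simp))
  simpa [ContinuousAt, powReg] using h1

/-- The drift term: `∫ |x|^(α-2) x·∇|u|² = -(α-2+N) ∫ |x|^(α-2) |u|²`. -/
theorem integral_drift (hN : 3 ≤ N) (hα0 : 0 < α) (hα2 : α < 2) (u : formDomain N α β) :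
    2 * ∫ x : E N, ‖x‖ ^ (α - 2) * ∑ i, x i * (conj ((u : L2 N) x) * grad i u x).re
      = -((α - 2 + N) * ∫ x : E N, ‖x‖ ^ (α - 2) * ‖(u : L2 N) x‖ ^ 2) := by
  -- The exponent is halved because the profile is evaluated at |x|².
  set p : ℝ := (α - 2) / 2 with hp
  have hp1 : -1 ≤ p := by rw [hp]; linarith
  have hp0 : p ≤ 0 := by rw [hp]; linarith
  have hpow (x : E N) : (‖x‖ ^ 2) ^ p = ‖x‖ ^ (α - 2) := by
    rw [← Real.rpow_natCast, ← Real.rpow_mul (norm_nonneg x)]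
    congr 1
    rw [hp]; push_cast; ring
  have hδ (n : ℕ) : 0 < 1 / ((n : ℝ) + 1) := by positivity
  have hδ0 : Tendsto (fun n : ℕ => 1 / ((n : ℝ) + 1)) atTop (𝓝 0) :=
    tendsto_one_div_add_atTop_nhds_zero_nat
  set d : ℕ → ℝ := fun n => 1 / ((n : ℝ) + 1) with hd
  have hid (n : ℕ) := integral_radial (u := (u : L2 N)) (fun i => hasWeakPartial_grad i u)
    (f := powReg p (d n))
    (f' := fun t => powReg p (d n) t * (p / (t + d n) - d n / (1 + d n * t)))
    -- The three quantities to be bounded are at most δ^p, δ^p(1+δ⁻¹) and 2δ^p with δ = d n, and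
    -- this constant exceeds them all.
    (C := 2 * ((d n) ^ p * (1 + (d n)⁻¹)))
    (by
      have h1 : ContDiff ℝ 1 fun x : E N => (‖x‖ ^ 2 + d n) ^ p :=
        ((contDiff_norm_sq ℝ).add contDiff_const).rpow_const_of_ne fun x =>
          (by have := hδ n; positivity)
      have h2 : ContDiff ℝ 1 fun x : E N => (1 + d n * ‖x‖ ^ 2)⁻¹ :=
        (contDiff_const.add (contDiff_const.mul (contDiff_norm_sq ℝ))).inv fun x =>
          (by have := hδ n; positivity)
      exact h1.mul h2)
    (fun t ht => hasDerivAt_powReg (hδ n) ht)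
    (fun t ht => by
      have h1 := powReg_le hp0 (hδ n) ht
      have h2 : 0 < d n ^ p := Real.rpow_pos_of_pos (hδ n) p
      have h3 : 0 < (d n)⁻¹ := inv_pos.2 (hδ n)
      rw [abs_of_pos (powReg_pos (hδ n) ht)]
      refine h1.trans ?_
      nlinarith)
    (fun x => by
      have h0 := hδ n
      have h2 : 0 < d n ^ p := Real.rpow_pos_of_pos (hδ n) p
      have h3 : 0 < (d n)⁻¹ := inv_pos.2 (hδ n)
      rw [abs_of_pos (powReg_pos (hδ n) (by positivity)), powReg, mul_assoc]
      have h4 : (‖x‖ ^ 2 + d n) ^ p ≤ d n ^ p :=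
        Real.rpow_le_rpow_of_nonpos (hδ n) (by nlinarith [sq_nonneg ‖x‖]) hp0
      have h5 : (1 + d n * ‖x‖ ^ 2)⁻¹ * ‖x‖ ≤ 1 + (d n)⁻¹ := by
        rw [inv_mul_le_iff₀ (by positivity)]
        have : (1 + d n * ‖x‖ ^ 2) * (1 + (d n)⁻¹) =
            1 + (d n)⁻¹ + d n * ‖x‖ ^ 2 + ‖x‖ ^ 2 := by
          have : d n * (d n)⁻¹ = 1 := mul_inv_cancel₀ h0.ne'
          linear_combination ‖x‖ ^ 2 * this
        rw [this]
        have h6 : 0 ≤ d n * ‖x‖ ^ 2 := by positivity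
        nlinarith [sq_nonneg (‖x‖ - 1)]
      calc (‖x‖ ^ 2 + d n) ^ p * ((1 + d n * ‖x‖ ^ 2)⁻¹ * ‖x‖)
          ≤ d n ^ p * (1 + (d n)⁻¹) := by gcongr
        _ ≤ _ := by
          have : 0 < d n ^ p * (1 + (d n)⁻¹) := by positivity
          linarith)
    (fun t ht => by
      have h1 := powReg_le hp0 (hδ n) ht
      have h2 : 0 < d n ^ p := Real.rpow_pos_of_pos (hδ n) p
      have h3 : 0 < (d n)⁻¹ := inv_pos.2 (hδ n)
      have h4 := abs_mul_log_deriv_powReg_le hp1 hp0 (hδ n) ht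
      have h5 := powReg_pos (p := p) (hδ n) ht
      rw [abs_mul, abs_of_pos h5]
      rw [abs_mul, abs_of_nonneg ht] at h4
      calc t * (powReg p (d n) t * |p / (t + d n) - d n / (1 + d n * t)|)
          = powReg p (d n) t * (t * |p / (t + d n) - d n / (1 + d n * t)|) := by ring
        _ ≤ d n ^ p * 2 := by gcongr
        _ ≤ _ := by nlinarith)
  have hw : Integrable fun x : E N => ‖x‖ ^ (α - 2) * ‖(u : L2 N) x‖ ^ 2 :=
    integrable_weight_norm_sq (w := fun x => ‖x‖ ^ (α - 2)) (fun x => by positivity) u.2.2.2.1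
  have hne := ae_ne_zero hN
  have hL : Tendsto (fun n => ∫ x : E N, (N * powReg p (d n) (‖x‖ ^ 2) + 2 * ‖x‖ ^ 2 *
      (powReg p (d n) (‖x‖ ^ 2) * (p / (‖x‖ ^ 2 + d n) - d n / (1 + d n * ‖x‖ ^ 2))))
        * ‖(u : L2 N) x‖ ^ 2) atTop
      (𝓝 (∫ x : E N, (α - 2 + N) * (‖x‖ ^ (α - 2) * ‖(u : L2 N) x‖ ^ 2))) := by
    -- N + 4 bounds N plus twice the quantity |t · (log derivative)| ≤ 2.
    refine tendsto_integral_of_dominated_convergence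
      (fun x => (N + 4) * (‖x‖ ^ (α - 2) * ‖(u : L2 N) x‖ ^ 2)) (fun n => (hid n).1.1)
      (hw.const_mul _) (fun n => ?_) ?_
    · filter_upwards [hne] with x hx
      have hx2 : 0 < ‖x‖ ^ 2 := by positivity
      have h1 := powReg_le_rpow hp0 (hδ n) hx2
      have h2 := powReg_pos (p := p) (hδ n) hx2.le
      have h3 := abs_mul_log_deriv_powReg_le hp1 hp0 (hδ n) hx2.le
      rw [hpow] at h1
      set P := powReg p (d n) (‖x‖ ^ 2)
      set L := p / (‖x‖ ^ 2 + d n) - d n / (1 + d n * ‖x‖ ^ 2)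
      have e : N * P + 2 * ‖x‖ ^ 2 * (P * L) = P * (N + 2 * (‖x‖ ^ 2 * L)) := by ring
      have h4 : |(N : ℝ) + 2 * (‖x‖ ^ 2 * L)| ≤ (N : ℝ) + 4 := by
        have := abs_add_le (N : ℝ) (2 * (‖x‖ ^ 2 * L))
        rw [abs_mul 2, abs_two, Nat.abs_cast] at this
        linarith
      rw [Real.norm_eq_abs, abs_mul, e, abs_mul, abs_of_pos h2,
        abs_of_nonneg (sq_nonneg ‖(u : L2 N) x‖)]
      calc P * |(N : ℝ) + 2 * (‖x‖ ^ 2 * L)| * ‖(u : L2 N) x‖ ^ 2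
          ≤ ‖x‖ ^ (α - 2) * (N + 4) * ‖(u : L2 N) x‖ ^ 2 := by gcongr
        _ = _ := by ring
    · filter_upwards [hne] with x hx
      have hx2 : 0 < ‖x‖ ^ 2 := by positivity
      have h1 := (tendsto_powReg (p := p) hx2).comp hδ0
      rw [hpow] at h1
      have h2 : Tendsto (fun n => p / (‖x‖ ^ 2 + d n) - d n / (1 + d n * ‖x‖ ^ 2)) atTop
          (𝓝 (p / (‖x‖ ^ 2 + 0) - 0 / (1 + 0 * ‖x‖ ^ 2))) := by
        refine Tendsto.sub ?_ ?_
        · exact tendsto_const_nhds.div (hδ0.const_add _) (by simpa using hx)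
        · exact hδ0.div ((hδ0.mul_const _).const_add _) (by simp)
      have h3 := ((h1.const_mul (N : ℝ)).add ((h1.mul h2).const_mul
        (2 * ‖x‖ ^ 2))).mul_const (‖(u : L2 N) x‖ ^ 2)
      -- In the limit the divergence has the factor N + 2p = α - 2 + N.
      have e : (N * ‖x‖ ^ (α - 2) + 2 * ‖x‖ ^ 2 * (‖x‖ ^ (α - 2) *
          (p / (‖x‖ ^ 2 + 0) - 0 / (1 + 0 * ‖x‖ ^ 2)))) * ‖(u : L2 N) x‖ ^ 2
          = (α - 2 + N) * (‖x‖ ^ (α - 2) * ‖(u : L2 N) x‖ ^ 2) := by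
        rw [hp]
        simp only [add_zero, zero_div, sub_zero]
        field_simp
        ring
      rw [e] at h3
      exact h3
  have hR : Tendsto (fun n => ∫ x : E N, powReg p (d n) (‖x‖ ^ 2) *
      ∑ i, x i * (conj ((u : L2 N) x) * grad i u x).re) atTop
      (𝓝 (∫ x : E N, ‖x‖ ^ (α - 2) * ∑ i, x i * (conj ((u : L2 N) x) * grad i u x).re)) := by
    have hb : Integrable fun x : E N =>
        ∑ i, ‖((‖x‖ ^ (α - 2) : ℝ) : ℂ) * ((x i : ℂ) * grad i u x) * conj ((u : L2 N) x)‖ :=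
      integrable_finsetSum _ fun i _ => (integrable_drift i u u).norm
    refine tendsto_integral_of_dominated_convergence _ (fun n => (hid n).2.1.1) hb
      (fun n => ?_) ?_
    · filter_upwards [hne] with x hx
      have hx2 : 0 < ‖x‖ ^ 2 := by positivity
      have h1 := powReg_le_rpow hp0 (hδ n) hx2
      have h2 := powReg_pos (p := p) (hδ n) hx2.le
      rw [hpow] at h1
      rw [Real.norm_eq_abs, Finset.mul_sum]
      refine (Finset.abs_sum_le_sum_abs _ _).trans (Finset.sum_le_sum fun i _ => ?_)
      rw [abs_mul, abs_mul, abs_of_pos h2, norm_mul, norm_mul, norm_mul, Complex.norm_real,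
        Complex.norm_real, RCLike.norm_conj, Real.norm_eq_abs, Real.norm_eq_abs,
        abs_of_nonneg (by positivity : 0 ≤ ‖x‖ ^ (α - 2))]
      have h3 : |(conj ((u : L2 N) x) * grad i u x).re| ≤ ‖(u : L2 N) x‖ * ‖grad i u x‖ := by
        refine (Complex.abs_re_le_norm _).trans ?_
        rw [norm_mul, RCLike.norm_conj]
      calc powReg p (d n) (‖x‖ ^ 2) * (|x i| * |(conj ((u : L2 N) x) * grad i u x).re|)
          ≤ ‖x‖ ^ (α - 2) * (|x i| * (‖(u : L2 N) x‖ * ‖grad i u x‖)) := by gcongr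
        _ = _ := by ring
    · filter_upwards [hne] with x hx
      have hx2 : 0 < ‖x‖ ^ 2 := by positivity
      have h1 := (tendsto_powReg (p := p) hx2).comp hδ0
      rw [hpow] at h1
      exact h1.mul_const _
  have hlim := tendsto_nhds_unique (hL.congr fun n => (hid n).2.2) (hR.const_mul 2).neg
  rw [integral_const_mul] at hlim
  linarith

end Radial

/-! ### Sectorial forms are continuous -/

section Sectorial

variable {H : Type*} [NormedAddCommGroup H] [InnerProductSpace ℂ H]

/-- Polarization bounds 4‖a(u,v)‖ by the diagonal values at u ± v and u ± iv. Sectoriality reduces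
these to their real parts, whose sum is 4(Re a(u,u) + Re a(v,v)) by the parallelogram law. -/
theorem SesqForm.norm_form_le_add {a : SesqForm H} {K : ℝ} (ha : a.IsAccretive)
    (hs : ∀ u : a.domain, |(a.form u u).im| ≤ K * (a.form u u).re) (u v : a.domain) :
    ‖a.form u v‖ ≤ (1 + K) * ((a.form u u).re + (a.form v v).re) := by
  have hdiag (w : a.domain) : ‖a.form w w‖ ≤ (1 + K) * (a.form w w).re := by
    have h1 := Complex.norm_le_abs_re_add_abs_im (a.form w w)
    rw [abs_of_nonneg (ha w)] at h1
    linarith [hs w]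
  have hpol : 4 * a.form u v = a.form (u + v) (u + v) - a.form (u - v) (u - v)
      + Complex.I * a.form (u + Complex.I • v) (u + Complex.I • v)
      - Complex.I * a.form (u - Complex.I • v) (u - Complex.I • v) := by
    simp only [map_add, map_sub, LinearMap.add_apply, LinearMap.sub_apply, map_smulₛₗ,
      LinearMap.smul_apply, smul_eq_mul, Complex.conj_I, RingHom.id_apply]
    ring_nf
    simp only [Complex.I_sq]
    ring
  have hsum : (a.form (u + v) (u + v)).re + (a.form (u - v) (u - v)).re
      + (a.form (u + Complex.I • v) (u + Complex.I • v)).re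
      + (a.form (u - Complex.I • v) (u - Complex.I • v)).re
      = 4 * ((a.form u u).re + (a.form v v).re) := by
    have e : a.form (u + v) (u + v) + a.form (u - v) (u - v)
        + a.form (u + Complex.I • v) (u + Complex.I • v)
        + a.form (u - Complex.I • v) (u - Complex.I • v) = 4 * (a.form u u + a.form v v) := by
      simp only [map_add, map_sub, LinearMap.add_apply, LinearMap.sub_apply, map_smulₛₗ,
        LinearMap.smul_apply, smul_eq_mul, Complex.conj_I, RingHom.id_apply]
      ring_nf
      simp only [Complex.I_sq]
      ring
    have h := congrArg Complex.re e
    simpa using h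
  have h1 := hdiag (u + v)
  have h2 := hdiag (u - v)
  have h3 := hdiag (u + Complex.I • v)
  have h4 := hdiag (u - Complex.I • v)
  have h5 : 4 * ‖a.form u v‖ ≤ ‖a.form (u + v) (u + v)‖ + ‖a.form (u - v) (u - v)‖
      + ‖a.form (u + Complex.I • v) (u + Complex.I • v)‖
      + ‖a.form (u - Complex.I • v) (u - Complex.I • v)‖ := by
    have e : 4 * ‖a.form u v‖ = ‖4 * a.form u v‖ := by rw [norm_mul]; simp
    rw [e, hpol]
    refine (norm_sub_le _ _).trans ?_
    rw [norm_mul, Complex.norm_I, one_mul]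
    gcongr
    refine (norm_add_le _ _).trans ?_
    rw [norm_mul, Complex.norm_I, one_mul]
    gcongr
    exact norm_sub_le _ _
  have h6 := congrArg (fun t => (1 + K) * t) hsum
  linarith

theorem SesqForm.isContinuous_of_sectorial {a : SesqForm H} {K : ℝ} (hK : 0 ≤ K)
    (ha : a.IsAccretive) (hs : ∀ u : a.domain, |(a.form u u).im| ≤ K * (a.form u u).re) :
    a.IsContinuous := by
  have hsq (u : a.domain) : a.formNorm u ^ 2 = (a.form u u).re + ‖(u : H)‖ ^ 2 :=
    Real.sq_sqrt (add_nonneg (ha u) (by positivity))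
  have hnn (u : a.domain) : 0 ≤ a.formNorm u := Real.sqrt_nonneg _
  have hzero (u : a.domain) (h : a.formNorm u = 0) : u = 0 := by
    have h1 := hsq u
    rw [h] at h1
    have h2 := ha u
    have h3 : ‖(u : H)‖ ^ 2 = 0 := by nlinarith [sq_nonneg ‖(u : H)‖]
    exact Subtype.ext (norm_eq_zero.1 (pow_eq_zero_iff two_ne_zero |>.1 h3))
  refine ⟨2 * (1 + K), by positivity, fun u v => ?_⟩
  rcases (hnn u).eq_or_lt with hu | hu
  · rw [hzero u hu.symm, map_zero, LinearMap.zero_apply, norm_zero]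
    exact mul_nonneg (mul_nonneg (by positivity) (hnn _)) (hnn _)
  rcases (hnn v).eq_or_lt with hv | hv
  · rw [hzero v hv.symm, map_zero, norm_zero]
    exact mul_nonneg (mul_nonneg (by positivity) (hnn _)) (hnn _)
  set p := a.formNorm u with hp
  set r := a.formNorm v with hr
  -- Each vector is scaled by the form norm of the other, which balances the sum and turns it into a
  -- product; the two equal terms account for the factor 2 in the constant.
  have h1 := norm_form_le_add ha hs ((r : ℂ) • u) ((p : ℂ) • v)
  simp only [map_smulₛₗ, LinearMap.smul_apply, smul_eq_mul, RingHom.id_apply, Complex.conj_ofReal,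
    norm_mul, Complex.norm_real, Real.norm_eq_abs, abs_of_pos hu, abs_of_pos hv,
    Complex.re_ofReal_mul] at h1
  have h2 := hsq u
  have h3 := hsq v
  rw [← hp] at h2
  rw [← hr] at h3
  have h4 : (a.form u u).re ≤ p ^ 2 := by nlinarith [sq_nonneg ‖(u : H)‖]
  have h5 : (a.form v v).re ≤ r ^ 2 := by nlinarith [sq_nonneg ‖(v : H)‖]
  have h6 : r * (p * ‖a.form u v‖) ≤ (1 + K) * (r * (r * p ^ 2) + p * (p * r ^ 2)) := by
    calc _ ≤ _ := by simpa only [mul_comm, mul_left_comm, mul_assoc] using h1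
      _ ≤ (1 + K) * (r * (r * p ^ 2) + p * (p * r ^ 2)) := by gcongr
  refine le_of_mul_le_mul_left ?_ (mul_pos hv hu)
  calc r * p * ‖a.form u v‖ = r * (p * ‖a.form u v‖) := by ring
    _ ≤ _ := h6
    _ = _ := by ring

end Sectorial

/-! ### Energy estimates -/

section Energy

variable {N : ℕ} {α β : ℝ}

/-- `∫ (1+|x|^α) |∇u|²`. -/
def gradEnergy (u : formDomain N α β) : ℝ := ∫ x, (1 + ‖x‖ ^ α) * ∑ i, ‖grad i u x‖ ^ 2

/-- `∫ |x|^(α-2) |u|²`. -/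
def singularEnergy (u : formDomain N α β) : ℝ := ∫ x, ‖x‖ ^ (α - 2) * ‖(u : L2 N) x‖ ^ 2

/-- `∫ |x|^β |u|²`. -/
def growthEnergy (u : formDomain N α β) : ℝ := ∫ x, ‖x‖ ^ β * ‖(u : L2 N) x‖ ^ 2

theorem integrable_weight_grad (i : Fin N) (u : formDomain N α β) :
    Integrable fun x => (1 + ‖x‖ ^ α) * ‖grad i u x‖ ^ 2 :=
  integrable_weight_norm_sq (w := fun x => 1 + ‖x‖ ^ α) (fun x => by positivity) (u.2.2.1 i)

theorem integrable_gradEnergy (u : formDomain N α β) :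
    Integrable fun x => (1 + ‖x‖ ^ α) * ∑ i, ‖grad i u x‖ ^ 2 := by
  simp only [Finset.mul_sum]
  exact integrable_finsetSum _ fun i _ => integrable_weight_grad i u

theorem integrable_singularEnergy (u : formDomain N α β) :
    Integrable fun x => ‖x‖ ^ (α - 2) * ‖(u : L2 N) x‖ ^ 2 :=
  integrable_weight_norm_sq (w := fun x => ‖x‖ ^ (α - 2)) (fun x => by positivity) u.2.2.2.1

theorem integrable_growthEnergy (u : formDomain N α β) :
    Integrable fun x => ‖x‖ ^ β * ‖(u : L2 N) x‖ ^ 2 :=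
  integrable_weight_norm_sq (w := fun x => ‖x‖ ^ β) (fun x => by positivity) u.2.2.2.2

theorem gradEnergy_nonneg (u : formDomain N α β) : 0 ≤ gradEnergy u :=
  integral_nonneg fun x => by positivity

theorem singularEnergy_nonneg (u : formDomain N α β) : 0 ≤ singularEnergy u :=
  integral_nonneg fun x => by positivity

theorem growthEnergy_nonneg (u : formDomain N α β) : 0 ≤ growthEnergy u :=
  integral_nonneg fun x => by positivity

theorem norm_sq_eq_integral (u : L2 N) : ‖u‖ ^ 2 = ∫ x, ‖u x‖ ^ 2 := by
  have h1 : (inner ℂ u u).re = ‖u‖ ^ 2 := inner_self_eq_norm_sq (𝕜 := ℂ) u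
  rw [← h1, L2.inner_def]
  have h2 : (∫ x, inner ℂ (u x) (u x)).re = ∫ x, (inner ℂ (u x) (u x)).re :=
    (integral_re (L2.integrable_inner (𝕜 := ℂ) u u)).symm
  rw [h2]
  refine integral_congr_ae (Eventually.of_forall fun x => ?_)
  exact inner_self_eq_norm_sq (𝕜 := ℂ) (u x)

theorem integrable_drift_re (u : formDomain N α β) : Integrable fun x : E N =>
    ‖x‖ ^ (α - 2) * ∑ i, x i * (conj ((u : L2 N) x) * grad i u x).re := by
  have h : Integrable fun x : E N => ∑ i, ((((‖x‖ ^ (α - 2) : ℝ) : ℂ) * ((x i : ℂ) * grad i u x)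
      * conj ((u : L2 N) x))).re :=
    integrable_finsetSum _ fun i _ => (integrable_drift i u u).re
  refine h.congr (Eventually.of_forall fun x => ?_)
  simp only [Finset.mul_sum]
  refine Finset.sum_congr rfl fun i _ => ?_
  rw [mul_assoc, mul_assoc, Complex.re_ofReal_mul, Complex.re_ofReal_mul, mul_comm (grad i u x)]

theorem re_formIntegrand (b c lam : ℝ) (u : formDomain N α β) (x : E N) :
    (formIntegrand b c lam u u x).re = (1 + ‖x‖ ^ α) * (∑ i, ‖grad i u x‖ ^ 2)
      + (α - b) * (‖x‖ ^ (α - 2) * ∑ i, x i * (conj ((u : L2 N) x) * grad i u x).re)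
      + c * (‖x‖ ^ (α - 2) * ‖(u : L2 N) x‖ ^ 2) + ‖x‖ ^ β * ‖(u : L2 N) x‖ ^ 2
      + lam * ‖(u : L2 N) x‖ ^ 2 := by
  have e1 : (∑ i, grad i u x * conj (grad i u x)) = ((∑ i, ‖grad i u x‖ ^ 2 : ℝ) : ℂ) := by
    rw [Complex.ofReal_sum]
    refine Finset.sum_congr rfl fun i _ => ?_
    rw [Complex.mul_conj, Complex.normSq_eq_norm_sq]
  have e2 : ((∑ i, (x i : ℂ) * grad i u x) * conj ((u : L2 N) x)).re
      = ∑ i, x i * (conj ((u : L2 N) x) * grad i u x).re := by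
    rw [Finset.sum_mul, Complex.re_sum]
    refine Finset.sum_congr rfl fun i _ => ?_
    rw [mul_assoc, Complex.re_ofReal_mul, mul_comm (grad i u x)]
  have e3 (r : ℝ) : ((r : ℂ) * (u : L2 N) x * conj ((u : L2 N) x)).re
      = r * ‖(u : L2 N) x‖ ^ 2 := by
    rw [mul_assoc, Complex.re_ofReal_mul, Complex.mul_conj, Complex.ofReal_re,
      Complex.normSq_eq_norm_sq]
  rw [formIntegrand, Complex.add_re, Complex.add_re, Complex.add_re, Complex.add_re, e1, e3, e3, e3,
    ← Complex.ofReal_mul, Complex.ofReal_re, mul_assoc (((α - b) * ‖x‖ ^ (α - 2) : ℝ) : ℂ),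
    Complex.re_ofReal_mul, e2]
  ring

theorem im_formIntegrand (b c lam : ℝ) (u : formDomain N α β) (x : E N) :
    (formIntegrand b c lam u u x).im
      = (α - b) * (‖x‖ ^ (α - 2) * ∑ i, x i * (conj ((u : L2 N) x) * grad i u x).im) := by
  have e1 : (∑ i, grad i u x * conj (grad i u x)) = ((∑ i, ‖grad i u x‖ ^ 2 : ℝ) : ℂ) := by
    rw [Complex.ofReal_sum]
    refine Finset.sum_congr rfl fun i _ => ?_
    rw [Complex.mul_conj, Complex.normSq_eq_norm_sq]
  have e2 : ((∑ i, (x i : ℂ) * grad i u x) * conj ((u : L2 N) x)).im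
      = ∑ i, x i * (conj ((u : L2 N) x) * grad i u x).im := by
    rw [Finset.sum_mul, Complex.im_sum]
    refine Finset.sum_congr rfl fun i _ => ?_
    rw [mul_assoc, Complex.im_ofReal_mul, mul_comm (grad i u x)]
  have e3 (r : ℝ) : ((r : ℂ) * (u : L2 N) x * conj ((u : L2 N) x)).im = 0 := by
    rw [mul_assoc, Complex.im_ofReal_mul, Complex.mul_conj, Complex.ofReal_im, mul_zero]
  rw [formIntegrand, Complex.add_im, Complex.add_im, Complex.add_im, Complex.add_im, e1, e3, e3, e3,
    ← Complex.ofReal_mul, Complex.ofReal_im, mul_assoc (((α - b) * ‖x‖ ^ (α - 2) : ℝ) : ℂ),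
    Complex.im_ofReal_mul, e2]
  ring

theorem form_apply (b c lam : ℝ) (u v : formDomain N α β) :
    (ellipticForm N α β b c lam).form u v = ∫ x, formIntegrand b c lam u v x := rfl

/-- Only the drift is transformed: by `integral_drift` its real part contributes -(α-b)/2 (α-2+N)
times the singular energy. -/
theorem re_form (hN : 3 ≤ N) (hα0 : 0 < α) (hα2 : α < 2) (b c lam : ℝ) (u : formDomain N α β) :
    ((ellipticForm N α β b c lam).form u u).re = gradEnergy u
      + (c - (α - b) / 2 * (α - 2 + N)) * singularEnergy u + growthEnergy u
      + lam * ‖(u : L2 N)‖ ^ 2 := by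
  have h1 : ((ellipticForm N α β b c lam).form u u).re
      = ∫ x, (formIntegrand b c lam u u x).re := by
    rw [form_apply]
    exact (integral_re (integrable_formIntegrand b c lam u u)).symm
  have i1 := integrable_gradEnergy u
  have i2 := (integrable_drift_re u).const_mul (α - b)
  have i3 := (integrable_singularEnergy u).const_mul c
  have i4 := integrable_growthEnergy u
  have i5 := (integrable_norm_sq (u : L2 N)).const_mul lam
  rw [h1]
  simp only [re_formIntegrand]
  have i12 : Integrable fun x : E N => (1 + ‖x‖ ^ α) * (∑ i, ‖grad i u x‖ ^ 2)
      + (α - b) * (‖x‖ ^ (α - 2) * ∑ i, x i * (conj ((u : L2 N) x) * grad i u x).re) := i1.add i2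
  have i123 : Integrable fun x : E N => (1 + ‖x‖ ^ α) * (∑ i, ‖grad i u x‖ ^ 2)
      + (α - b) * (‖x‖ ^ (α - 2) * ∑ i, x i * (conj ((u : L2 N) x) * grad i u x).re)
      + c * (‖x‖ ^ (α - 2) * ‖(u : L2 N) x‖ ^ 2) := i12.add i3
  have i1234 : Integrable fun x : E N => (1 + ‖x‖ ^ α) * (∑ i, ‖grad i u x‖ ^ 2)
      + (α - b) * (‖x‖ ^ (α - 2) * ∑ i, x i * (conj ((u : L2 N) x) * grad i u x).re)
      + c * (‖x‖ ^ (α - 2) * ‖(u : L2 N) x‖ ^ 2) + ‖x‖ ^ β * ‖(u : L2 N) x‖ ^ 2 := i123.add i4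
  rw [integral_add i1234 i5, integral_add i123 i4, integral_add i12 i3, integral_add i1 i2,
    integral_const_mul, integral_const_mul, integral_const_mul, ← norm_sq_eq_integral]
  have h2 := integral_drift hN hα0 hα2 u
  rw [← singularEnergy] at h2 ⊢
  rw [← gradEnergy, ← growthEnergy]
  linear_combination (α - b) / 2 * h2

/-- Condition (1) is multiplied by |u|² and integrated, its inverse square term being paid by half
of ∫|∇u|² through Hardy. The -1 in the condition is what leaves one full singular energy on the
left. -/
theorem le_re_form (hN : 3 ≤ N) (hα0 : 0 < α) (hα2 : α < 2) {b c lam : ℝ}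
    (hlam : IsAdmissible N α b c lam) (u : formDomain N α β) :
    gradEnergy u / 2 + singularEnergy u + growthEnergy u
      ≤ ((ellipticForm N α β b c lam).form u u).re := by
  obtain ⟨hi, hh⟩ := hardy hN (fun i => hasWeakPartial_grad i u)
  have hD : ∫ x, ∑ i, ‖grad i u x‖ ^ 2 ≤ gradEnergy u := by
    refine integral_mono (integrable_finsetSum _ fun i _ => integrable_norm_sq _)
      (integrable_gradEnergy u) fun x => ?_
    have h1 : 0 ≤ ∑ i, ‖grad i u x‖ ^ 2 := by positivity
    have h2 : 0 ≤ ‖x‖ ^ α := by positivity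
    nlinarith
  have i1 := hi.const_mul (1 / 2)
  have i2 := (integrable_singularEnergy u).const_mul (c - 1 - (α - b) / 2 * (α - 2 + N))
  have i3 := (integrable_norm_sq (u : L2 N)).const_mul lam
  have hpos : 0 ≤ ∫ x : E N, (1 / 2) * ((((N : ℝ) - 2) / 2) ^ 2 * ((‖x‖ ^ 2)⁻¹ *
      ‖(u : L2 N) x‖ ^ 2)) + (c - 1 - (α - b) / 2 * (α - 2 + N)) *
      (‖x‖ ^ (α - 2) * ‖(u : L2 N) x‖ ^ 2) + lam * ‖(u : L2 N) x‖ ^ 2 := by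
    refine integral_nonneg_of_ae ?_
    filter_upwards [ae_ne_zero hN] with x hx
    have h1 := mul_nonneg (hlam.2 x hx).le (sq_nonneg ‖(u : L2 N) x‖)
    have e : (((N : ℝ) - 2) / 2) ^ 2 / (2 * ‖x‖ ^ 2)
        = 1 / 2 * ((((N : ℝ) - 2) / 2) ^ 2 * (‖x‖ ^ 2)⁻¹) := by
      rw [div_eq_mul_inv, mul_inv]; ring
    rw [e] at h1
    simp only [Pi.zero_apply]
    linarith
  have i12 : Integrable fun x : E N => (1 / 2) * ((((N : ℝ) - 2) / 2) ^ 2 * ((‖x‖ ^ 2)⁻¹ *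
      ‖(u : L2 N) x‖ ^ 2)) + (c - 1 - (α - b) / 2 * (α - 2 + N)) *
      (‖x‖ ^ (α - 2) * ‖(u : L2 N) x‖ ^ 2) := i1.add i2
  rw [integral_add i12 i3, integral_add i1 i2, integral_const_mul (1 / 2 : ℝ),
    integral_const_mul (c - 1 - (α - b) / 2 * (α - 2 + N)), integral_const_mul lam,
    ← norm_sq_eq_integral, ← singularEnergy] at hpos
  rw [re_form hN hα0 hα2]
  linarith

/-- By `drift_weight_le` and Young's inequality, each coordinate of the drift is at most half the
weighted gradient term plus half the singular term. Summation over the coordinates produces the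
factor N. -/
theorem abs_im_form_le (hN : 3 ≤ N) (hα0 : 0 < α) (hα2 : α < 2) {b c lam : ℝ}
    (hlam : IsAdmissible N α b c lam) (u : formDomain N α β) :
    |((ellipticForm N α β b c lam).form u u).im|
      ≤ |α - b| * N * ((ellipticForm N α β b c lam).form u u).re := by
  have h1 : ((ellipticForm N α β b c lam).form u u).im
      = ∫ x, (formIntegrand b c lam u u x).im := by
    rw [form_apply]
    exact (integral_im (integrable_formIntegrand b c lam u u)).symm
  have hN' : (3 : ℝ) ≤ N := by exact_mod_cast hN
  have i1 := (integrable_gradEnergy u).const_mul (1 / 2)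
  have i2 := (integrable_singularEnergy u).const_mul ((N : ℝ) / 2)
  have hpt (x : E N) : ‖x‖ ^ (α - 2) * ∑ i, |x i| * (‖(u : L2 N) x‖ * ‖grad i u x‖) ≤
      1 / 2 * ((1 + ‖x‖ ^ α) * ∑ i, ‖grad i u x‖ ^ 2)
        + N / 2 * (‖x‖ ^ (α - 2) * ‖(u : L2 N) x‖ ^ 2) := by
    have hterm (i : Fin N) : ‖x‖ ^ (α - 2) * (|x i| * (‖(u : L2 N) x‖ * ‖grad i u x‖)) ≤
        1 / 2 * ((1 + ‖x‖ ^ α) * ‖grad i u x‖ ^ 2)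
          + 1 / 2 * (‖x‖ ^ (α - 2) * ‖(u : L2 N) x‖ ^ 2) := by
      have e1 := drift_weight_le α x i
      have e2 : √(1 + ‖x‖ ^ α) ^ 2 = 1 + ‖x‖ ^ α := Real.sq_sqrt (by positivity)
      have e3 : √(‖x‖ ^ (α - 2)) ^ 2 = ‖x‖ ^ (α - 2) := Real.sq_sqrt (by positivity)
      calc ‖x‖ ^ (α - 2) * (|x i| * (‖(u : L2 N) x‖ * ‖grad i u x‖))
          = (‖x‖ ^ (α - 2) * |x i|) * (‖(u : L2 N) x‖ * ‖grad i u x‖) := by ring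
        _ ≤ (√(1 + ‖x‖ ^ α) * √(‖x‖ ^ (α - 2))) * (‖(u : L2 N) x‖ * ‖grad i u x‖) := by gcongr
        _ ≤ 1 / 2 * (√(1 + ‖x‖ ^ α) ^ 2 * ‖grad i u x‖ ^ 2)
          + 1 / 2 * (√(‖x‖ ^ (α - 2)) ^ 2 * ‖(u : L2 N) x‖ ^ 2) := by
            nlinarith [sq_nonneg (√(1 + ‖x‖ ^ α) * ‖grad i u x‖
              - √(‖x‖ ^ (α - 2)) * ‖(u : L2 N) x‖)]
        _ = _ := by rw [e2, e3]
    have hsum := Finset.sum_le_sum fun i (_ : i ∈ Finset.univ) => hterm i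
    rw [← Finset.mul_sum, Finset.sum_add_distrib, ← Finset.mul_sum, ← Finset.mul_sum,
      Finset.sum_const, Finset.card_univ, Fintype.card_fin, nsmul_eq_mul] at hsum
    linarith
  have h2 : |∫ x, (formIntegrand b c lam u u x).im| ≤ ∫ x : E N, |α - b| *
      (1 / 2 * ((1 + ‖x‖ ^ α) * ∑ i, ‖grad i u x‖ ^ 2)
        + N / 2 * (‖x‖ ^ (α - 2) * ‖(u : L2 N) x‖ ^ 2)) := by
    rw [← Real.norm_eq_abs]
    refine norm_integral_le_of_norm_le ((i1.add i2).const_mul _) (Eventually.of_forall fun x => ?_)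
    rw [im_formIntegrand, Real.norm_eq_abs, abs_mul, abs_mul,
      abs_of_nonneg (by positivity : 0 ≤ ‖x‖ ^ (α - 2))]
    refine mul_le_mul_of_nonneg_left (le_trans ?_ (hpt x)) (abs_nonneg _)
    refine mul_le_mul_of_nonneg_left ?_ (by positivity)
    refine (Finset.abs_sum_le_sum_abs _ _).trans (Finset.sum_le_sum fun i _ => ?_)
    rw [abs_mul]
    refine mul_le_mul_of_nonneg_left ?_ (abs_nonneg _)
    refine (Complex.abs_im_le_norm _).trans ?_
    rw [norm_mul, RCLike.norm_conj]
  rw [integral_const_mul, integral_add i1 i2, integral_const_mul, integral_const_mul,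
    ← gradEnergy, ← singularEnergy] at h2
  rw [h1]
  refine h2.trans ?_
  rw [mul_assoc]
  refine mul_le_mul_of_nonneg_left ?_ (abs_nonneg _)
  have h3 := le_re_form hN hα0 hα2 hlam u
  have h4 := gradEnergy_nonneg u
  have h5 := singularEnergy_nonneg u
  have h6 := growthEnergy_nonneg u
  have h7 := mul_le_mul_of_nonneg_left h3 (by linarith : (0 : ℝ) ≤ N)
  nlinarith

theorem isAccretive_ellipticForm (hN : 3 ≤ N) (hα0 : 0 < α) (hα2 : α < 2) {b c lam : ℝ}
    (hlam : IsAdmissible N α b c lam) : (ellipticForm N α β b c lam).IsAccretive := fun u => by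
  have h3 := le_re_form hN hα0 hα2 hlam u
  have h4 := gradEnergy_nonneg u
  have h5 := singularEnergy_nonneg u
  have h6 := growthEnergy_nonneg u
  linarith

theorem exists_isAdmissible (hN : 3 ≤ N) (hα0 : 0 < α) (hα2 : α < 2) (b c : ℝ) :
    ∃ lam, IsAdmissible N α b c lam := by
  set m : ℝ := c - 1 - (α - b) / 2 * (α - 2 + N)
  have hN' : (3 : ℝ) ≤ N := by exact_mod_cast hN
  set k : ℝ := (((N : ℝ) - 2) / 2) ^ 2
  have hk : 0 < k := pow_pos (by linarith) 2
  -- For |x| ≤ r one has 2|m||x|^α ≤ k, so the Hardy term dominates; for |x| ≥ r the singular weight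
  -- is at most r^(α-2), which λ absorbs. Both added ones guard against m = 0.
  set r : ℝ := (k / (2 * (|m| + 1))) ^ α⁻¹ with hr
  have hr0 : 0 < r := by positivity
  have hrα : r ^ α = k / (2 * (|m| + 1)) := by
    rw [hr, ← Real.rpow_mul (by positivity), inv_mul_cancel₀ hα0.ne', Real.rpow_one]
  refine ⟨|m| * r ^ (α - 2) + 1, by positivity, fun x hx => ?_⟩
  have hx0 : 0 < ‖x‖ := norm_pos_iff.2 hx
  have hw : 0 < ‖x‖ ^ (α - 2) := by positivity
  have h1 : -(|m| * ‖x‖ ^ (α - 2)) ≤ m * ‖x‖ ^ (α - 2) := by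
    nlinarith [neg_abs_le m]
  have h2 : |m| * ‖x‖ ^ (α - 2) < k / (2 * ‖x‖ ^ 2) + (|m| * r ^ (α - 2) + 1) := by
    rcases le_total ‖x‖ r with h | h
    · have h3 : ‖x‖ ^ α ≤ k / (2 * (|m| + 1)) := by
        rw [← hrα]; exact Real.rpow_le_rpow hx0.le h hα0.le
      have h4 : ‖x‖ ^ (α - 2) = ‖x‖ ^ α / ‖x‖ ^ 2 := by
        rw [Real.rpow_sub hx0]; norm_cast
      have h5 : |m| * ‖x‖ ^ (α - 2) ≤ k / (2 * ‖x‖ ^ 2) := by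
        rw [h4, ← mul_div_assoc, div_le_div_iff₀ (by positivity) (by positivity)]
        rw [le_div_iff₀ (by positivity)] at h3
        have h6 : |m| * ‖x‖ ^ α * 2 ≤ k := by
          have : 0 < ‖x‖ ^ α := by positivity
          nlinarith
        have h7 : 0 < ‖x‖ ^ 2 := by positivity
        nlinarith
      have h8 : 0 ≤ |m| * r ^ (α - 2) := by positivity
      linarith
    · have h3 : ‖x‖ ^ (α - 2) ≤ r ^ (α - 2) :=
        Real.rpow_le_rpow_of_nonpos hr0 h (by linarith)
      have h4 : |m| * ‖x‖ ^ (α - 2) ≤ |m| * r ^ (α - 2) := by gcongr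
      have h5 : 0 < k / (2 * ‖x‖ ^ 2) := by positivity
      linarith
  change 0 < k / (2 * ‖x‖ ^ 2) + m * ‖x‖ ^ (α - 2) + (|m| * r ^ (α - 2) + 1)
  linarith

end Energy

/-! ### Closedness of the form -/

section Closed

variable {N : ℕ} {α β : ℝ}

/-- Multiplication by a weight, with its maximal domain in `L²`. -/
def mulWeight (w : E N → ℝ) : weightedL2 w →ₗ[ℂ] L2 N where
  toFun f := MemLp.toLp (fun x => (w x : ℂ) * (f : L2 N) x) f.2
  map_add' f g := by
    refine Lp.ext ?_
    filter_upwards [MemLp.coeFn_toLp (f + g).2, MemLp.coeFn_toLp f.2, MemLp.coeFn_toLp g.2,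
      Lp.coeFn_add (f : L2 N) (g : L2 N), Lp.coeFn_add (MemLp.toLp _ f.2) (MemLp.toLp _ g.2)]
      with x h1 h2 h3 h4 h5
    rw [h1, h5, Pi.add_apply, h2, h3, Submodule.coe_add, h4, Pi.add_apply, mul_add]
  map_smul' k f := by
    refine Lp.ext ?_
    filter_upwards [MemLp.coeFn_toLp (k • f).2, MemLp.coeFn_toLp f.2,
      Lp.coeFn_smul k (f : L2 N), Lp.coeFn_smul k (MemLp.toLp _ f.2)] with x h1 h2 h3 h4
    rw [h1, RingHom.id_apply, h4, Pi.smul_apply, h2, Submodule.coe_smul, h3, Pi.smul_apply,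
      smul_eq_mul, smul_eq_mul]
    ring

theorem coeFn_mulWeight {w : E N → ℝ} (f : weightedL2 w) :
    mulWeight w f =ᵐ[volume] fun x => (w x : ℂ) * (f : L2 N) x :=
  MemLp.coeFn_toLp f.2

theorem norm_sq_mulWeight {w : E N → ℝ} (hw : ∀ x, 0 ≤ w x) (f : weightedL2 fun x => √(w x)) :
    ‖mulWeight _ f‖ ^ 2 = ∫ x, w x * ‖(f : L2 N) x‖ ^ 2 := by
  rw [norm_sq_eq_integral]
  refine integral_congr_ae ?_
  filter_upwards [coeFn_mulWeight f] with x hx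
  rw [hx, norm_mul, mul_pow, Complex.norm_real, Real.norm_eq_abs, sq_abs, Real.sq_sqrt (hw x)]

/-- Multiplication by a weight is a closed operator. -/
theorem mulWeight_closed {w : E N → ℝ} {f : ℕ → weightedL2 w} {g F : L2 N}
    (hf : Tendsto (fun n => (f n : L2 N)) atTop (𝓝 g))
    (hF : Tendsto (fun n => mulWeight w (f n)) atTop (𝓝 F)) :
    ∃ hg : g ∈ weightedL2 w, mulWeight w ⟨g, hg⟩ = F := by
  -- Along a common subsequence both sequences converge almost everywhere, which identifies F with
  -- the weight times g.
  obtain ⟨ns, hns, h1⟩ := (tendstoInMeasure_of_tendsto_Lp hf).exists_seq_tendsto_ae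
  obtain ⟨ms, hms, h2⟩ :=
    (tendstoInMeasure_of_tendsto_Lp (hF.comp hns.tendsto_atTop)).exists_seq_tendsto_ae
  have hc : ∀ᵐ x : E N, ∀ n, mulWeight w (f n) x = (w x : ℂ) * (f n : L2 N) x :=
    ae_all_iff.2 fun n => coeFn_mulWeight (f n)
  have key : F =ᵐ[volume] fun x => (w x : ℂ) * g x := by
    filter_upwards [h1, h2, hc] with x hx1 hx2 hx3
    refine tendsto_nhds_unique hx2 ?_
    simp only [Function.comp_apply, hx3]
    exact (hx1.comp hms.tendsto_atTop).const_mul _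
  have hg : g ∈ weightedL2 w := (Lp.memLp F).ae_eq key
  refine ⟨hg, Lp.ext ?_⟩
  filter_upwards [coeFn_mulWeight ⟨g, hg⟩, key] with x h3 h4
  rw [h3, h4]

theorem hasWeakPartial_of_tendsto {i : Fin N} {u g : ℕ → L2 N} {v h : L2 N}
    (hw : ∀ n, HasWeakPartial i (u n) (g n)) (hu : Tendsto u atTop (𝓝 v))
    (hg : Tendsto g atTop (𝓝 h)) : HasWeakPartial i v h := by
  intro φ hφ hc
  rw [← testPairing_apply (continuous_partialDeriv i hφ) (hasCompactSupport_partialDeriv i hc),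
    ← testPairing_apply hφ.continuous hc]
  refine tendsto_nhds_unique (((testPairing (continuous_partialDeriv i hφ)
    (hasCompactSupport_partialDeriv i hc)).continuous.tendsto _).comp hu)
    ((((testPairing hφ.continuous hc).continuous.tendsto _).comp hg).neg.congr fun n => ?_)
  simp only [Function.comp_apply, testPairing_apply]
  exact (hw n φ hφ hc).symm

theorem exists_weakGrad_of_hasWeakPartial {u : L2 N} {g : Fin N → L2 N}
    (h : ∀ i, HasWeakPartial i u (g i)) :
    ∃ hu : u ∈ sobolevH1 N, ∀ i, weakGrad i ⟨u, hu⟩ = g i := by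
  have hd (i : Fin N) : u ∈ (weakPartial i).domain :=
    LinearPMap.mem_domain_iff.2 ⟨g i, (mem_graph_weakPartial i u (g i)).2 (h i)⟩
  have hu : u ∈ sobolevH1 N := (Submodule.mem_iInf _).2 hd
  refine ⟨hu, fun i => ?_⟩
  have h1 := (mem_graph_weakPartial i _ _).2 (hasWeakPartial_weakGrad i ⟨u, hu⟩)
  exact LinearPMap.mem_graph_snd_inj' (f := weakPartial i) h1
    ((mem_graph_weakPartial i u (g i)).2 (h i)) rfl

/-- `u ↦ (1+|x|^α)^(1/2) ∂ᵢu`. -/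
def weightedGrad (i : Fin N) : formDomain N α β →ₗ[ℂ] L2 N :=
  mulWeight _ ∘ₗ (grad i).codRestrict (weightedL2 fun x => √(1 + ‖x‖ ^ α)) fun u => u.2.2.1 i

/-- `u ↦ (|x|^(α-2))^(1/2) u`. -/
def weightedSingular : formDomain N α β →ₗ[ℂ] L2 N :=
  mulWeight _ ∘ₗ (formDomain N α β).subtype.codRestrict
    (weightedL2 fun x => √(‖x‖ ^ (α - 2))) fun u => u.2.2.2.1

/-- `u ↦ (|x|^β)^(1/2) u`. -/
def weightedGrowth : formDomain N α β →ₗ[ℂ] L2 N :=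
  mulWeight _ ∘ₗ (formDomain N α β).subtype.codRestrict
    (weightedL2 fun x => √(‖x‖ ^ β)) fun u => u.2.2.2.2

theorem sum_norm_sq_weightedGrad (u : formDomain N α β) :
    ∑ i, ‖weightedGrad i u‖ ^ 2 = gradEnergy u := by
  have h (i : Fin N) : ‖weightedGrad i u‖ ^ 2 = ∫ x, (1 + ‖x‖ ^ α) * ‖grad i u x‖ ^ 2 :=
    norm_sq_mulWeight (w := fun x => 1 + ‖x‖ ^ α) (fun x => by positivity) _
  simp only [h, gradEnergy, Finset.mul_sum]
  rw [integral_finsetSum _ fun i _ => integrable_weight_grad i u]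

theorem norm_sq_weightedSingular (u : formDomain N α β) :
    ‖weightedSingular u‖ ^ 2 = singularEnergy u :=
  norm_sq_mulWeight (w := fun x => ‖x‖ ^ (α - 2)) (fun x => by positivity) _

theorem norm_sq_weightedGrowth (u : formDomain N α β) :
    ‖weightedGrowth u‖ ^ 2 = growthEnergy u :=
  norm_sq_mulWeight (w := fun x => ‖x‖ ^ β) (fun x => by positivity) _

theorem norm_grad_le (i : Fin N) (u : formDomain N α β) : ‖grad i u‖ ≤ ‖weightedGrad i u‖ := by
  refine (sq_le_sq₀ (norm_nonneg _) (norm_nonneg _)).1 ?_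
  have h : ‖weightedGrad i u‖ ^ 2 = ∫ x, (1 + ‖x‖ ^ α) * ‖grad i u x‖ ^ 2 :=
    norm_sq_mulWeight (w := fun x => 1 + ‖x‖ ^ α) (fun x => by positivity) _
  rw [h, norm_sq_eq_integral]
  refine integral_mono (integrable_norm_sq _) (integrable_weight_grad i u) fun x => ?_
  have h2 : 0 ≤ ‖x‖ ^ α := by positivity
  nlinarith [sq_nonneg ‖grad i u x‖]

/-- The factor 2 leaves room for the coefficient 1/2 of the gradient energy in the coercivity
estimate. -/
theorem cauchySeq_of_norm_le {V : Type*} [AddCommGroup V] [Module ℂ V] {L : V →ₗ[ℂ] L2 N}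
    {p : V → ℝ} (hL : ∀ v, ‖L v‖ ≤ 2 * p v) {u : ℕ → V}
    (hu : ∀ ε > 0, ∃ n₀ : ℕ, ∀ n ≥ n₀, ∀ m ≥ n₀, p (u n - u m) < ε) :
    ∃ F, Tendsto (fun n => L (u n)) atTop (𝓝 F) := by
  refine cauchySeq_tendsto_of_complete (Metric.cauchySeq_iff.2 fun ε hε => ?_)
  obtain ⟨n₀, hn₀⟩ := hu (ε / 2) (by positivity)
  refine ⟨n₀, fun n hn m hm => ?_⟩
  rw [dist_eq_norm, ← map_sub]
  have h1 := hL (u n - u m)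
  have h2 := hn₀ n hn m hm
  linarith

/-- Completeness of the form domain for any norm that controls the energies. -/
theorem exists_limit {p : formDomain N α β → ℝ} {u : ℕ → formDomain N α β}
    (hu : ∀ ε > 0, ∃ n₀ : ℕ, ∀ n ≥ n₀, ∀ m ≥ n₀, p (u n - u m) < ε)
    (bGrad : ∀ i w, ‖weightedGrad i w‖ ≤ 2 * p w) (bSing : ∀ w, ‖weightedSingular w‖ ≤ 2 * p w)
    (bGrow : ∀ w, ‖weightedGrowth w‖ ≤ 2 * p w)
    (bId : ∀ w, ‖(formDomain N α β).subtype w‖ ≤ 2 * p w) :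
    ∃ v : formDomain N α β, (∀ i, Tendsto (fun n => weightedGrad i (u n)) atTop
        (𝓝 (weightedGrad i v))) ∧
      Tendsto (fun n => weightedSingular (u n)) atTop (𝓝 (weightedSingular v)) ∧
      Tendsto (fun n => weightedGrowth (u n)) atTop (𝓝 (weightedGrowth v)) ∧
      Tendsto (fun n => (u n : L2 N)) atTop (𝓝 (v : L2 N)) := by
  obtain ⟨v, hv⟩ := cauchySeq_of_norm_le bId hu
  obtain ⟨S, hS⟩ := cauchySeq_of_norm_le bSing hu
  obtain ⟨W, hW⟩ := cauchySeq_of_norm_le bGrow hu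
  choose G hG using fun i => cauchySeq_of_norm_le (bGrad i) hu
  -- The unweighted derivatives must converge as well: their limits are the weak derivatives of v,
  -- and multiplication by the weight is closed over them.
  choose g hg using fun i => cauchySeq_of_norm_le
    (fun w => (norm_grad_le i w).trans (bGrad i w)) hu
  obtain ⟨hv1, hgv⟩ := exists_weakGrad_of_hasWeakPartial fun i =>
    hasWeakPartial_of_tendsto (fun n => hasWeakPartial_grad i (u n)) hv (hg i)
  have cGrad (i : Fin N) := mulWeight_closed (f := fun n => (grad i).codRestrict
    (weightedL2 fun x => √(1 + ‖x‖ ^ α)) (fun u => u.2.2.1 i) (u n)) (hg i) (hG i)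
  obtain ⟨hv2, eS⟩ := mulWeight_closed (f := fun n => (formDomain N α β).subtype.codRestrict
    (weightedL2 fun x => √(‖x‖ ^ (α - 2))) (fun u => u.2.2.2.1) (u n)) hv hS
  obtain ⟨hv3, eW⟩ := mulWeight_closed (f := fun n => (formDomain N α β).subtype.codRestrict
    (weightedL2 fun x => √(‖x‖ ^ β)) (fun u => u.2.2.2.2) (u n)) hv hW
  have hmem : v ∈ formDomain N α β := ⟨hv1, fun i => by
    rw [hgv i]; exact (cGrad i).1, hv2, hv3⟩
  refine ⟨⟨v, hmem⟩, fun i => ?_, ?_, ?_, hv⟩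
  · obtain ⟨h1, h2⟩ := cGrad i
    have e : weightedGrad i ⟨v, hmem⟩ = G i := by
      rw [← h2]
      have : (grad i).codRestrict (weightedL2 fun x => √(1 + ‖x‖ ^ α)) (fun u => u.2.2.1 i)
          (⟨v, hmem⟩ : formDomain N α β) = ⟨g i, h1⟩ := Subtype.ext (hgv i)
      exact congrArg (mulWeight fun x => √(1 + ‖x‖ ^ α)) this
    rw [e]
    exact hG i
  · have e : weightedSingular ⟨v, hmem⟩ = S := eS
    rw [e]
    exact hS
  · have e : weightedGrowth ⟨v, hmem⟩ = W := eW
    rw [e]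
    exact hW

theorem tendsto_norm_sq_map_sub {V : Type*} [AddCommGroup V] [Module ℂ V] (L : V →ₗ[ℂ] L2 N)
    {u : ℕ → V} {v : V} (h : Tendsto (fun n => L (u n)) atTop (𝓝 (L v))) :
    Tendsto (fun n => ‖L (u n - v)‖ ^ 2) atTop (𝓝 0) := by
  have h3 := h.sub_const (L v)
  rw [sub_self] at h3
  simpa using h3.norm.pow 2

theorem energies_le_formNorm_sq (hN : 3 ≤ N) (hα0 : 0 < α) (hα2 : α < 2) {b c lam : ℝ}
    (hlam : IsAdmissible N α b c lam) (w : formDomain N α β) :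
    gradEnergy w / 2 + singularEnergy w + growthEnergy w + ‖(w : L2 N)‖ ^ 2
      ≤ (ellipticForm N α β b c lam).formNorm w ^ 2 := by
  have hsq : (ellipticForm N α β b c lam).formNorm w ^ 2
      = ((ellipticForm N α β b c lam).form w w).re + ‖(w : L2 N)‖ ^ 2 :=
    Real.sq_sqrt (add_nonneg (isAccretive_ellipticForm hN hα0 hα2 hlam w) (by positivity))
  rw [hsq]
  linarith [le_re_form hN hα0 hα2 hlam w]

/-- The form norm becomes a continuous function of L² norms of linear maps. So convergence of those
maps gives form convergence whatever the sign of the singular coefficient. -/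
theorem formNorm_eq (hN : 3 ≤ N) (hα0 : 0 < α) (hα2 : α < 2) (b c lam : ℝ)
    (w : formDomain N α β) : (ellipticForm N α β b c lam).formNorm w =
      √(∑ i, ‖weightedGrad i w‖ ^ 2
        + (c - (α - b) / 2 * (α - 2 + N)) * ‖weightedSingular w‖ ^ 2
        + ‖weightedGrowth w‖ ^ 2 + lam * ‖(formDomain N α β).subtype w‖ ^ 2
        + ‖(formDomain N α β).subtype w‖ ^ 2) := by
  rw [sum_norm_sq_weightedGrad, norm_sq_weightedSingular, norm_sq_weightedGrowth,
    Submodule.subtype_apply, ← re_form hN hα0 hα2]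
  rfl

theorem isClosed_ellipticForm (hN : 3 ≤ N) (hα0 : 0 < α) (hα2 : α < 2) {b c lam : ℝ}
    (hlam : IsAdmissible N α b c lam) : (ellipticForm N α β b c lam).IsClosed := by
  intro (u : ℕ → formDomain N α β) hu
  have hlow := energies_le_formNorm_sq (β := β) hN hα0 hα2 hlam
  have hg0 := gradEnergy_nonneg (N := N) (α := α) (β := β)
  have hs0 := singularEnergy_nonneg (N := N) (α := α) (β := β)
  have hw0 := growthEnergy_nonneg (N := N) (α := α) (β := β)
  have hle {w : formDomain N α β} {r : ℝ}
      (h : r ^ 2 ≤ 2 * (ellipticForm N α β b c lam).formNorm w ^ 2) :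
      r ≤ 2 * (ellipticForm N α β b c lam).formNorm w := by
    have hp : 0 ≤ (ellipticForm N α β b c lam).formNorm w := Real.sqrt_nonneg _
    refine le_of_sq_le_sq ?_ (by positivity)
    nlinarith
  obtain ⟨v, tG, tS, tW, tI⟩ := exists_limit hu
    (fun i w => hle (by
      have h1 : ‖weightedGrad i w‖ ^ 2 ≤ gradEnergy w := by
        rw [← sum_norm_sq_weightedGrad]
        exact Finset.single_le_sum (f := fun i => ‖weightedGrad i w‖ ^ 2)
          (fun j _ => by positivity) (Finset.mem_univ i)
      linarith [hlow w, hs0 w, hw0 w, sq_nonneg ‖(w : L2 N)‖]))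
    (fun w => hle (by
      rw [norm_sq_weightedSingular]
      linarith [hlow w, hs0 w, hw0 w, hg0 w, sq_nonneg ‖(w : L2 N)‖]))
    (fun w => hle (by
      rw [norm_sq_weightedGrowth]
      linarith [hlow w, hs0 w, hw0 w, hg0 w, sq_nonneg ‖(w : L2 N)‖]))
    (fun w => hle (by
      rw [Submodule.subtype_apply]
      linarith [hlow w, hs0 w, hw0 w, hg0 w, sq_nonneg ‖(w : L2 N)‖]))
  have tI' := tendsto_norm_sq_map_sub (formDomain N α β).subtype (u := u) (v := v) tI
  have tot := ((((tendsto_finsetSum Finset.univ fun i _ =>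
    tendsto_norm_sq_map_sub _ (tG i)).add
    ((tendsto_norm_sq_map_sub _ tS).const_mul (c - (α - b) / 2 * (α - 2 + N)))).add
    (tendsto_norm_sq_map_sub _ tW)).add (tI'.const_mul lam)).add tI'
  have lim := (Real.continuous_sqrt.tendsto _).comp tot
  refine ⟨v, Tendsto.congr' (Eventually.of_forall fun n =>
    (formNorm_eq hN hα0 hα2 b c lam (u n - v)).symm) ?_⟩
  simpa [Function.comp_def] using lim

end Closed

/-! ### Test functions supported away from the origin -/

section TestFunctions

variable {N : ℕ} {α β : ℝ}

theorem IsTestAwayFromZero.memLp {u : E N → ℂ} (hu : IsTestAwayFromZero u) :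
    MemLp u 2 (volume : Measure (E N)) :=
  hu.1.continuous.memLp_of_hasCompactSupport hu.2.1

theorem IsTestAwayFromZero.fderiv_apply {u : E N → ℂ} (hu : IsTestAwayFromZero u) (v : E N) :
    IsTestAwayFromZero fun x => fderiv ℝ u x v :=
  ⟨(hu.1.fderiv_right (m := ∞) (by simp)).clm_apply contDiff_const, hu.2.1.fderiv_apply (𝕜 := ℝ) v,
    fun h => hu.2.2 (tsupport_fderiv_apply_subset ℝ v h)⟩

/-- Near the origin the product vanishes identically, so a singularity of the weight there is
harmless. -/
theorem IsTestAwayFromZero.weight_mul {u : E N → ℂ} (hu : IsTestAwayFromZero u) {w : E N → ℝ}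
    (hw : ∀ x, x ≠ 0 → ContDiffAt ℝ ∞ w x) : IsTestAwayFromZero fun x => (w x : ℂ) * u x := by
  have hsub : tsupport (fun x => (w x : ℂ) * u x) ⊆ tsupport u :=
    tsupport_mul_subset_right
  refine ⟨contDiff_iff_contDiffAt.2 fun x => ?_,
    hu.2.1.mono' (subset_trans (subset_tsupport _) hsub), fun h => hu.2.2 (hsub h)⟩
  rcases eq_or_ne x 0 with rfl | hx
  · have h0 : (fun x => (w x : ℂ) * u x) =ᶠ[𝓝 0] fun _ => 0 := by
      filter_upwards [notMem_tsupport_iff_eventuallyEq.1 hu.2.2] with y hy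
      rw [hy]; simp
    exact contDiffAt_const.congr_of_eventuallyEq h0
  · exact (Complex.ofRealCLM.contDiff.contDiffAt.comp x (hw x hx)).mul hu.1.contDiffAt

theorem contDiffAt_norm_rpow {x : E N} (hx : x ≠ 0) (s : ℝ) :
    ContDiffAt ℝ ∞ (fun x : E N => ‖x‖ ^ s) x :=
  (contDiffAt_norm ℝ hx).rpow_const_of_ne (norm_ne_zero_iff.2 hx)

/-- Integration by parts against a complex test function. -/
theorem HasWeakPartial.integral_mul_conj {i : Fin N} {v g : L2 N} (h : HasWeakPartial i v g)
    {Φ : E N → ℂ} (hΦ : ContDiff ℝ ∞ Φ) (hc : HasCompactSupport Φ) :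
    ∫ x, Φ x * conj (g x) = -∫ x, fderiv ℝ Φ x (unitVec i) * conj (v x) := by
  have hre : ContDiff ℝ ∞ fun x => (Φ x).re := Complex.reCLM.contDiff.comp hΦ
  have him : ContDiff ℝ ∞ fun x => (Φ x).im := Complex.imCLM.contDiff.comp hΦ
  have hcre : HasCompactSupport fun x => (Φ x).re := hc.comp_left (g := Complex.re) rfl
  have hcim : HasCompactSupport fun x => (Φ x).im := hc.comp_left (g := Complex.im) rfl
  have hd (x : E N) : DifferentiableAt ℝ Φ x := hΦ.differentiable (by simp) x
  have dre (x : E N) : partialDeriv i (fun x => (Φ x).re) x = (fderiv ℝ Φ x (unitVec i)).re := by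
    have := (Complex.reCLM.hasFDerivAt.comp x (hd x).hasFDerivAt).fderiv
    exact congrArg (fun L : E N →L[ℝ] ℝ => L (unitVec i)) this
  have dim (x : E N) : partialDeriv i (fun x => (Φ x).im) x = (fderiv ℝ Φ x (unitVec i)).im := by
    have := (Complex.imCLM.hasFDerivAt.comp x (hd x).hasFDerivAt).fderiv
    exact congrArg (fun L : E N →L[ℝ] ℝ => L (unitVec i)) this
  -- `HasWeakPartial` tests with real functions only, hence the decomposition into real and
  -- imaginary parts.
  have split {p q : E N → ℝ} (hp : Continuous p) (hq : Continuous q) (cp : HasCompactSupport p)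
      (cq : HasCompactSupport q) (w : L2 N) {F : E N → ℂ}
      (hF : ∀ x, F x = (p x : ℂ) + q x * Complex.I) :
      ∫ x, F x * conj (w x) = conj (∫ x, p x • w x) + Complex.I * conj (∫ x, q x • w x) := by
    have i1 := (integrable_test_smul hp cp w)
    have i2 := (integrable_test_smul hq cq w)
    have i1' : Integrable fun x => conj (p x • w x) :=
      Complex.conjCLE.toContinuousLinearMap.integrable_comp i1
    have i2' : Integrable fun x => conj (q x • w x) :=
      Complex.conjCLE.toContinuousLinearMap.integrable_comp i2
    rw [← integral_conj, ← integral_conj, ← integral_const_mul,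
      ← integral_add i1' (i2'.const_mul Complex.I)]
    refine integral_congr_ae (Eventually.of_forall fun x => ?_)
    simp only [hF, Complex.real_smul, map_mul, Complex.conj_ofReal]
    ring
  have h1 := h _ hre hcre
  have h2 := h _ him hcim
  rw [split hre.continuous him.continuous hcre hcim g (fun x => (Complex.re_add_im (Φ x)).symm),
    split (F := fun x => fderiv ℝ Φ x (unitVec i)) (continuous_partialDeriv i hre)
      (continuous_partialDeriv i him) (hasCompactSupport_partialDeriv i hcre)
      (hasCompactSupport_partialDeriv i hcim) v (fun x => by
        rw [dre, dim]; exact (Complex.re_add_im _).symm), h1, h2]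
  simp only [map_neg]
  ring

theorem IsTestAwayFromZero.hasWeakPartial {u : E N → ℂ} (hu : IsTestAwayFromZero u) (i : Fin N) :
    HasWeakPartial i hu.memLp.toLp (hu.fderiv_apply (unitVec i)).memLp.toLp := by
  intro φ hφ hc
  have e1 : ∫ x, partialDeriv i φ x • hu.memLp.toLp u x = ∫ x, partialDeriv i φ x • u x := by
    refine integral_congr_ae ?_
    filter_upwards [hu.memLp.coeFn_toLp] with x hx
    rw [hx]
  have e2 : ∫ x, φ x • (hu.fderiv_apply (unitVec i)).memLp.toLp _ x
      = ∫ x, φ x • fderiv ℝ u x (unitVec i) := by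
    refine integral_congr_ae ?_
    filter_upwards [(hu.fderiv_apply (unitVec i)).memLp.coeFn_toLp] with x hx
    rw [hx]
  have hcd : Continuous (partialDeriv i φ) := continuous_partialDeriv i hφ
  rw [e1, e2, integral_smul_fderiv_eq_neg_fderiv_smul_of_integrable, neg_neg]
  · rfl
  · exact (hcd.smul hu.1.continuous).integrable_of_hasCompactSupport
      (hu.2.1.smul_left (f := partialDeriv i φ))
  · exact (hφ.continuous.smul (hu.fderiv_apply (unitVec i)).1.continuous).integrable_of_hasCompactSupport
      (hc.smul_right)
  · exact (hφ.continuous.smul hu.1.continuous).integrable_of_hasCompactSupport (hc.smul_right)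
  · exact fun x _ => hφ.differentiable (by simp) x
  · exact fun x _ => hu.1.differentiable (by simp) x

theorem IsTestAwayFromZero.toLp_mem_weightedL2 {u : E N → ℂ} (hu : IsTestAwayFromZero u)
    {w : E N → ℝ} (hw : ∀ x, x ≠ 0 → ContDiffAt ℝ ∞ w x) : hu.memLp.toLp u ∈ weightedL2 w := by
  refine (hu.weight_mul hw).memLp.ae_eq ?_
  filter_upwards [hu.memLp.coeFn_toLp] with x hx
  rw [hx]

theorem IsTestAwayFromZero.exists_grad {u : E N → ℂ} (hu : IsTestAwayFromZero u) :
    ∃ h : hu.memLp.toLp u ∈ formDomain N α β,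
      ∀ i, grad i ⟨hu.memLp.toLp u, h⟩ = (hu.fderiv_apply (unitVec i)).memLp.toLp := by
  obtain ⟨h1, hg⟩ := exists_weakGrad_of_hasWeakPartial hu.hasWeakPartial
  refine ⟨⟨h1, fun i => ?_, hu.toLp_mem_weightedL2 fun x hx => ?_,
    hu.toLp_mem_weightedL2 fun x hx => ?_⟩, hg⟩
  · rw [hg i]
    refine (hu.fderiv_apply (unitVec i)).toLp_mem_weightedL2 fun x hx => ?_
    exact (contDiffAt_const.add (contDiffAt_norm_rpow hx α)).sqrt (by positivity)
  · exact (contDiffAt_norm_rpow hx _).sqrt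
      (Real.rpow_pos_of_pos (norm_pos_iff.2 hx) _).ne'
  · exact (contDiffAt_norm_rpow hx _).sqrt
      (Real.rpow_pos_of_pos (norm_pos_iff.2 hx) _).ne'

/-- The domain contains the test functions supported away from 0. A vector orthogonal to them
vanishes almost everywhere off the origin, which is a null set. -/
theorem isDenselyDefined_ellipticForm (hN : 3 ≤ N) (b c lam : ℝ) :
    (ellipticForm N α β b c lam).IsDenselyDefined := by
  change Dense (formDomain N α β : Set (L2 N))
  rw [Submodule.dense_iff_topologicalClosure_eq_top, Submodule.topologicalClosure_eq_top_iff,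
    Submodule.eq_bot_iff]
  intro v hv
  refine Lp.eq_zero_iff_ae_eq_zero.2 ?_
  have h := (isOpen_compl_singleton (x := (0 : E N))).ae_eq_zero_of_integral_contDiff_smul_eq_zero
    (f := v) (μ := volume) (((Lp.memLp v).locallyIntegrable (by norm_num)).locallyIntegrableOn _)
    (fun φ hφ hc hs => by
      have hu : IsTestAwayFromZero fun x => (φ x : ℂ) :=
        ⟨Complex.ofRealCLM.contDiff.comp hφ, hc.comp_left (g := fun r : ℝ => (r : ℂ)) rfl,
          fun h => hs (tsupport_comp_subset (g := fun r : ℝ => (r : ℂ)) rfl φ h) rfl⟩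
      obtain ⟨hmem, -⟩ := hu.exists_grad (α := α) (β := β)
      have h0 : inner ℂ (hu.memLp.toLp _) v = 0 := hv _ hmem
      rw [← h0, L2.inner_def]
      refine integral_congr_ae ?_
      filter_upwards [hu.memLp.coeFn_toLp] with x hx
      rw [hx]
      simp [mul_comm])
  filter_upwards [h, ae_ne_zero hN] with x h1 h2
  exact h1 h2

/-! ### The differential expression on test functions. -/

theorem laplacian_eq_sum {u : E N → ℂ} (hu : ContDiff ℝ ∞ u) (x : E N) :
    Laplacian.laplacian u x
      = ∑ i, fderiv ℝ (fun y => fderiv ℝ u y (unitVec i)) x (unitVec i) := by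
  rw [InnerProductSpace.laplacian_eq_iteratedFDeriv_orthonormalBasis u
    (EuclideanSpace.basisFun (Fin N) ℝ)]
  refine Finset.sum_congr rfl fun i _ => ?_
  rw [iteratedFDeriv_two_apply]
  have hd : DifferentiableAt ℝ (fderiv ℝ u) x :=
    (hu.fderiv_right (m := ∞) (by simp)).differentiable (by simp) x
  rw [fderiv_clm_apply hd (differentiableAt_const _)]
  simp

theorem fderiv_apply_self (u : E N → ℂ) (x : E N) :
    fderiv ℝ u x x = ∑ i, (x i : ℂ) * fderiv ℝ u x (unitVec i) := by
  have e : x = ∑ i, x i • unitVec i := by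
    have := (EuclideanSpace.basisFun (Fin N) ℝ).sum_repr x
    simpa using this.symm
  conv_lhs => rw [e]
  rw [map_sum]
  have e' : ∑ i, x i • unitVec i = x := e.symm
  simp only [map_smul, Complex.real_smul, e']

/-- The second term, from ∇|x|^α = α|x|^(α-2)x, is what turns the drift coefficient α-b of the form
into the b of the differential expression. -/
theorem fderiv_weight_mul {f : E N → ℂ} {x : E N} (hf : DifferentiableAt ℝ f x) (hx : x ≠ 0)
    (α : ℝ) (i : Fin N) :
    fderiv ℝ (fun y => ((1 + ‖y‖ ^ α : ℝ) : ℂ) * f y) x (unitVec i)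
      = ((1 + ‖x‖ ^ α : ℝ) : ℂ) * fderiv ℝ f x (unitVec i)
        + ((α * ‖x‖ ^ (α - 2) : ℝ) : ℂ) * ((x i : ℂ) * f x) := by
  have hx0 : 0 < ‖x‖ := norm_pos_iff.2 hx
  have h1 : HasFDerivAt (fun x : E N => ‖x‖ ^ 2) (2 • innerSL ℝ x) x :=
    (hasStrictFDerivAt_norm_sq x).hasFDerivAt
  have h2 := ((Real.hasDerivAt_rpow_const (x := ‖x‖ ^ 2) (p := α / 2)
    (Or.inl (by positivity))).comp_hasFDerivAt x h1).const_add 1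
  have e1 (y : E N) : (‖y‖ ^ 2) ^ (α / 2) = ‖y‖ ^ α := by
    rw [← Real.rpow_natCast, ← Real.rpow_mul (norm_nonneg y)]
    congr 1
    push_cast; ring
  have e2 : (‖x‖ ^ 2) ^ (α / 2 - 1) = ‖x‖ ^ (α - 2) := by
    rw [← Real.rpow_natCast, ← Real.rpow_mul (norm_nonneg x)]
    congr 1
    push_cast; ring
  simp only [Function.comp_apply, e1, e2] at h2
  have h3 := (Complex.ofRealCLM.hasFDerivAt.comp x h2).mul hf.hasFDerivAt
  have h4 : fderiv ℝ (fun y => ((1 + ‖y‖ ^ α : ℝ) : ℂ) * f y) x (unitVec i) = _ :=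
    congrArg (fun L : E N →L[ℝ] ℂ => L (unitVec i)) h3.fderiv
  rw [h4]
  simp [EuclideanSpace.inner_single_right]
  ring

/-- The expanded form of the differential expression. -/
theorem ellipticOp_eq {u : E N → ℂ} (hu : ContDiff ℝ ∞ u) (β b c lam : ℝ) (x : E N) :
    ellipticOp α β b c u x - (lam : ℂ) * u x
      = ∑ i, (((1 + ‖x‖ ^ α : ℝ) : ℂ) * fderiv ℝ (fun y => fderiv ℝ u y (unitVec i)) x (unitVec i)
        + ((b * ‖x‖ ^ (α - 2) * x i : ℝ) : ℂ) * fderiv ℝ u x (unitVec i))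
        - ((c * ‖x‖ ^ (α - 2) + ‖x‖ ^ β + lam : ℝ) : ℂ) * u x := by
  rw [ellipticOp, laplacian_eq_sum hu, fderiv_apply_self, Finset.sum_add_distrib, Finset.mul_sum,
    Finset.mul_sum]
  push_cast
  simp only [mul_assoc]
  ring

theorem contDiffAt_coord (i : Fin N) (x : E N) : ContDiffAt ℝ ∞ (fun x : E N => x i) x :=
  (EuclideanSpace.proj i : E N →L[ℝ] ℝ).contDiff.contDiffAt

theorem IsTestAwayFromZero.memLp_ellipticOp {u : E N → ℂ} (hu : IsTestAwayFromZero u)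
    (b c lam : ℝ) :
    MemLp (fun x => ellipticOp α β b c u x - (lam : ℂ) * u x) 2 (volume : Measure (E N)) := by
  simp only [ellipticOp_eq hu.1]
  refine MemLp.sub (memLp_finsetSum _ fun i _ => MemLp.add ?_ ?_) ?_
  · exact (((hu.fderiv_apply (unitVec i)).fderiv_apply (unitVec i)).weight_mul
      (w := fun x => 1 + ‖x‖ ^ α) fun x hx =>
        contDiffAt_const.add (contDiffAt_norm_rpow hx α)).memLp
  · exact ((hu.fderiv_apply (unitVec i)).weight_mul
      (w := fun x => b * ‖x‖ ^ (α - 2) * x i) fun x hx =>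
        (contDiffAt_const.mul (contDiffAt_norm_rpow hx _)).mul (contDiffAt_coord i x)).memLp
  · exact (hu.weight_mul (w := fun x => c * ‖x‖ ^ (α - 2) + ‖x‖ ^ β + lam) fun x hx =>
        ((contDiffAt_const.mul (contDiffAt_norm_rpow hx _)).add
          (contDiffAt_norm_rpow hx _)).add contDiffAt_const).memLp

/-- Drift and zero order terms, collected in `R`, appear identically on both sides. Only the second
order part is integrated by parts, moving ∂ᵢ from h onto the test function (1+|x|^α)∂ᵢu. -/
theorem IsTestAwayFromZero.form_eq_inner (hN : 3 ≤ N) {u : E N → ℂ} (hu : IsTestAwayFromZero u)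
    (b c lam : ℝ) (hmem : hu.memLp.toLp u ∈ formDomain N α β)
    (hgrad : ∀ i, grad i (⟨hu.memLp.toLp u, hmem⟩ : formDomain N α β)
      = (hu.fderiv_apply (unitVec i)).memLp.toLp) (h : formDomain N α β) :
    (ellipticForm N α β b c lam).form ⟨hu.memLp.toLp u, hmem⟩ h
      = inner ℂ (h : L2 N) (-(hu.memLp_ellipticOp (α := α) (β := β) b c lam).toLp) := by
  have hΦ (i : Fin N) : IsTestAwayFromZero fun x =>
      ((1 + ‖x‖ ^ α : ℝ) : ℂ) * fderiv ℝ u x (unitVec i) :=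
    (hu.fderiv_apply (unitVec i)).weight_mul (w := fun x => 1 + ‖x‖ ^ α) fun x hx =>
      contDiffAt_const.add (contDiffAt_norm_rpow hx α)
  have hdrift (i : Fin N) : MemLp (fun x => (((α - b) * ‖x‖ ^ (α - 2) * x i : ℝ) : ℂ)
      * fderiv ℝ u x (unitVec i)) 2 (volume : Measure (E N)) :=
    ((hu.fderiv_apply (unitVec i)).weight_mul
      (w := fun x => (α - b) * ‖x‖ ^ (α - 2) * x i) fun x hx =>
        (contDiffAt_const.mul (contDiffAt_norm_rpow hx _)).mul (contDiffAt_coord i x)).memLp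
  have hpot : MemLp (fun x => ((c * ‖x‖ ^ (α - 2) + ‖x‖ ^ β + lam : ℝ) : ℂ) * u x) 2
      (volume : Measure (E N)) :=
    (hu.weight_mul (w := fun x => c * ‖x‖ ^ (α - 2) + ‖x‖ ^ β + lam) fun x hx =>
        ((contDiffAt_const.mul (contDiffAt_norm_rpow hx _)).add
          (contDiffAt_norm_rpow hx _)).add contDiffAt_const).memLp
  set R : E N → ℂ := fun x => (∑ i, (((α - b) * ‖x‖ ^ (α - 2) * x i : ℝ) : ℂ)
      * fderiv ℝ u x (unitVec i)) + ((c * ‖x‖ ^ (α - 2) + ‖x‖ ^ β + lam : ℝ) : ℂ) * u x with hR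
  have hRm : MemLp R 2 (volume : Measure (E N)) := (memLp_finsetSum _ fun i _ => hdrift i).add hpot
  have hv : MemLp (fun x => (h : L2 N) x) 2 (volume : Measure (E N)) := Lp.memLp _
  have iR : Integrable fun x => R x * conj ((h : L2 N) x) := integrable_mul_conj hRm hv
  have iG (i : Fin N) : Integrable fun x => ((1 + ‖x‖ ^ α : ℝ) : ℂ) * fderiv ℝ u x (unitVec i)
      * conj (grad i h x) := integrable_mul_conj (hΦ i).memLp (Lp.memLp _)
  have iD (i : Fin N) : Integrable fun x => fderiv ℝ (fun y => ((1 + ‖y‖ ^ α : ℝ) : ℂ)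
      * fderiv ℝ u y (unitVec i)) x (unitVec i) * conj ((h : L2 N) x) :=
    integrable_mul_conj ((hΦ i).fderiv_apply (unitVec i)).memLp hv
  have step1 : (ellipticForm N α β b c lam).form ⟨hu.memLp.toLp u, hmem⟩ h
      = ∫ x, (∑ i, ((1 + ‖x‖ ^ α : ℝ) : ℂ) * fderiv ℝ u x (unitVec i) * conj (grad i h x))
        + R x * conj ((h : L2 N) x) := by
    refine (form_apply b c lam (⟨hu.memLp.toLp u, hmem⟩ : formDomain N α β) h).trans
      (integral_congr_ae ?_)
    have hg : ∀ᵐ x : E N, ∀ i, grad i (⟨hu.memLp.toLp u, hmem⟩ : formDomain N α β) x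
        = fderiv ℝ u x (unitVec i) := ae_all_iff.2 fun i => by
      rw [hgrad i]; exact (hu.fderiv_apply (unitVec i)).memLp.coeFn_toLp
    filter_upwards [hg, hu.memLp.coeFn_toLp] with x h1 h2
    simp only [formIntegrand, h1, h2, hR]
    rw [Finset.mul_sum, Finset.mul_sum, add_mul, Finset.sum_mul, Finset.sum_mul]
    push_cast
    simp only [mul_assoc]
    ring
  have step2 : inner ℂ (h : L2 N) (-(hu.memLp_ellipticOp (α := α) (β := β) b c lam).toLp)
      = ∫ x, -(∑ i, fderiv ℝ (fun y => ((1 + ‖y‖ ^ α : ℝ) : ℂ)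
        * fderiv ℝ u y (unitVec i)) x (unitVec i) * conj ((h : L2 N) x))
        + R x * conj ((h : L2 N) x) := by
    rw [inner_neg_right, L2.inner_def, ← integral_neg]
    refine integral_congr_ae ?_
    -- The origin is discarded because the derivative of |x|^α is computed for x ≠ 0 only.
    filter_upwards [(hu.memLp_ellipticOp (α := α) (β := β) b c lam).coeFn_toLp,
      ae_ne_zero hN] with x h1 hx
    have hd (i : Fin N) : DifferentiableAt ℝ (fun y => fderiv ℝ u y (unitVec i)) x :=
      (hu.fderiv_apply (unitVec i)).1.differentiable (by simp) x
    simp only [fun i => fderiv_weight_mul (hd i) hx α i]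
    rw [h1, ellipticOp_eq hu.1, RCLike.inner_apply, ← Finset.sum_mul, hR]
    simp only [Finset.sum_add_distrib]
    have e1 : ∑ i, ((b * ‖x‖ ^ (α - 2) * x i : ℝ) : ℂ) * fderiv ℝ u x (unitVec i)
        = ((b * ‖x‖ ^ (α - 2) : ℝ) : ℂ) * ∑ i, (x i : ℂ) * fderiv ℝ u x (unitVec i) := by
      rw [Finset.mul_sum]; push_cast; simp only [mul_assoc]
    have e2 : ∑ i, (((α - b) * ‖x‖ ^ (α - 2) * x i : ℝ) : ℂ) * fderiv ℝ u x (unitVec i)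
        = (((α - b) * ‖x‖ ^ (α - 2) : ℝ) : ℂ) * ∑ i, (x i : ℂ) * fderiv ℝ u x (unitVec i) := by
      rw [Finset.mul_sum]; push_cast; simp only [mul_assoc]
    have e3 : ∑ i, ((α * ‖x‖ ^ (α - 2) : ℝ) : ℂ) * ((x i : ℂ) * fderiv ℝ u x (unitVec i))
        = ((α * ‖x‖ ^ (α - 2) : ℝ) : ℂ) * ∑ i, (x i : ℂ) * fderiv ℝ u x (unitVec i) := by
      rw [Finset.mul_sum]
    rw [e1, e2, e3]
    push_cast
    ring
  have iGs : Integrable fun x => ∑ i, ((1 + ‖x‖ ^ α : ℝ) : ℂ) * fderiv ℝ u x (unitVec i)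
      * conj (grad i h x) := integrable_finsetSum _ fun i _ => iG i
  have iDs : Integrable fun x => -∑ i, fderiv ℝ (fun y => ((1 + ‖y‖ ^ α : ℝ) : ℂ)
        * fderiv ℝ u y (unitVec i)) x (unitVec i) * conj ((h : L2 N) x) :=
    (integrable_finsetSum _ fun i _ => iD i).neg
  rw [step1, step2, integral_add iGs iR, integral_add iDs iR, integral_neg,
    integral_finsetSum _ fun i _ => iG i, integral_finsetSum _ fun i _ => iD i,
    ← Finset.sum_neg_distrib]
  congr 1
  refine Finset.sum_congr rfl fun i _ => ?_
  exact (hasWeakPartial_grad i h).integral_mul_conj (hΦ i).1 (hΦ i).2.1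

end TestFunctions

end SingularElliptic

end

/-! ### Assembly of the result. -/

theorem mainTheorem9 (N : ℕ) (hN : 3 ≤ N) (α β b c : ℝ) (hα0 : 0 < α) (hα2 : α < 2) (hβ : 0 < β) :
    (∃ lam : ℝ, SingularElliptic.IsAdmissible N α b c lam) ∧
    ∀ lam : ℝ, SingularElliptic.IsAdmissible N α b c lam →
      (SingularElliptic.ellipticForm N α β b c lam).IsDenselyDefined ∧
      (SingularElliptic.ellipticForm N α β b c lam).IsAccretive ∧
      (SingularElliptic.ellipticForm N α β b c lam).IsContinuous ∧
      (SingularElliptic.ellipticForm N α β b c lam).IsClosed ∧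
      ∃ B : SingularElliptic.L2 N →ₗ.[ℂ] SingularElliptic.L2 N,
        (SingularElliptic.ellipticForm N α β b c lam).IsNegAssociated B ∧
        B.IsClosed ∧
        SingularElliptic.GeneratesAnalyticContractionSemigroup B ∧
        ∀ u : SingularElliptic.E N → ℂ, SingularElliptic.IsTestAwayFromZero u →
          ∃ (hu : MemLp u 2 volume)
            (hAu : MemLp (fun x => SingularElliptic.ellipticOp α β b c u x - (lam : ℂ) * u x)
              2 volume),
            (hu.toLp u, hAu.toLp (fun x =>
              SingularElliptic.ellipticOp α β b c u x - (lam : ℂ) * u x)) ∈ B.graph := by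
  refine ⟨SingularElliptic.exists_isAdmissible hN hα0 hα2 b c, fun lam hlam => ?_⟩
  have hK : 0 ≤ |α - b| * N := by positivity
  have hd := SingularElliptic.isDenselyDefined_ellipticForm (α := α) (β := β) hN b c lam
  have ha := SingularElliptic.isAccretive_ellipticForm (β := β) hN hα0 hα2 hlam
  have hs := SingularElliptic.abs_im_form_le (β := β) hN hα0 hα2 hlam
  have hc := SingularElliptic.SesqForm.isContinuous_of_sectorial hK ha hs
  have hcl := SingularElliptic.isClosed_ellipticForm (β := β) hN hα0 hα2 hlam
  have hB := SingularElliptic.SesqForm.isSectorial_op hd ha hc hcl hK hs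
  have hassoc := SingularElliptic.SesqForm.isNegAssociated_op hd
  refine ⟨hd, ha, hc, hcl, _, hassoc, hB.isClosed, hB.generatesAnalyticContractionSemigroup,
    fun u hu => ⟨hu.memLp, hu.memLp_ellipticOp b c lam, ?_⟩⟩
  obtain ⟨hmem, hgrad⟩ := hu.exists_grad (α := α) (β := β)
  exact (hassoc _ _).2 ⟨hmem, hu.form_eq_inner hN b c lam hmem hgrad⟩
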